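/- Let $-\infty\le a<b\le\infty$ and $n\in\mathbb N$. Let $J\in\mathbb C^{n\times n}$ be a constant, invertible, skew-Hermitian matrix ($J^*=-J$), and let $q$ and $w$ be $n\times n$ matrices whose entries are complex distributions of order $0$ on $(a,b)$, with $q$ Hermitian ($\overline{q_{k\ell}}=q_{\ell k}$) and $w$ non-negative ($c^*wc$ is a non-negative distribution for every $c\in\mathbb C^n$). For $x\in(a,b)$ put $\Delta_q(x)=Q^+(x)-Q^-(x)$, where $Q$ is an antiderivative of $q$ of locally bounded variation and $Q^\pm(x)$ are its right- and left-hand limits at $x$, and assume that the matrices $2J\pm\Delta_q(x)$ are invertible for all $x\in(a,b)$. Write $w=\tilde W\,dS$, where $dS$ is the positive measure given by $\operatorname{tr} w$ and $\tilde W\ge 0$ is the Radon–Nikodym density. Let $\mathcal L^2(w)$ be the space of ($dS$-measurable) functions $f:(a,b)\to\mathbb C^n$ with $\int f^*\tilde W f\,dS<\infty$, with the semi-scalar product $\langle f,g\rangle=\int f^*\tilde W g\,dS$, and let $L^2(w)$ be the Hilbert space obtained from it by identifying functions whose difference has norm $0$; $[f]$ is the class of $f$. Let $\mathrm{BV}_{\rm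 loc}^\#((a,b))^n$ be the space of functions $u:(a,b)\to\mathbb C^n$ whose components are of locally bounded variation and which are balanced, i.e. $u(x)=\frac12(u^+(x)+u^-(x))$ for all $x\in(a,b)$. For such $u$ and for $f\in\mathcal L^2(w)$, the equation $Ju'+qu=wf$ is understood as an equality of distributions on $(a,b)$, where $u'$ is the distributional derivative, $(qu)(\varphi)=\int\varphi\,dQ\,u$ and $(wf)(\varphi)=\int\varphi\,\tilde Wf\,dS$ for test functions $\varphi$. Define $$\mathcal T_{\max}=\{(u,f)\in\mathcal L^2(w)\times\mathcal L^2(w): u\in\mathrm{BV}_{\rm loc}^\#((a,b))^n,\ Ju'+qu=wf\},$$ $$\mathcal T_{\min}=\{(u,f)\in\mathcal T_{\max}:\operatorname{supp}u\text{ is compact in }(a,b)\},$$ and let $T_{\max}=\{([u],[f]):(u,f)\in\mathcal T_{\max}\}$ and $T_{\min}=\{([u],[f]):(u,f)\in\mathcal T_{\min}\}$ be the associated linear relations in $L^2(w)\times L^2(w)$. The adjoint of a relation $T\subset L^2(w)\times L^2(w)$ is $$T^*=\{(v,g)\in L^2(w)\times L^2(w):\langle g,u\rangle=\langle v,f\rangle\text{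 for all }(u,f)\in T\}.$$ Then $T_{\min}^*=T_{\max}$. (No definiteness condition is assumed: there may be non-trivial solutions of $Ju'+qu=0$ with $[u]=0$.) -/

import Mathlib

open scoped Distributions Topology ComplexConjugate

noncomputable section

namespace DistSystem

/-- The open interval `(a, b)`, where `-∞ ≤ a` and `b ≤ ∞`. -/
def openInterval (a b : EReal) : TopologicalSpace.Opens ℝ where
  carrier := {x : ℝ | a < (x : EReal) ∧ (x : EReal) < b}
  is_open' := (isOpen_lt continuous_const continuous_coe_real_ereal).inter
    (isOpen_lt continuous_coe_real_ereal continuous_const)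

/-- `n × n` matrices whose entries are complex distributions of order `0` on `(a, b)`. -/
abbrev MatrixDist (a b : EReal) (n : ℕ) : Type :=
  Matrix (Fin n) (Fin n) (Distribution (openInterval a b) ℂ 0)

variable {a b : EReal} {n : ℕ}

/-- A smooth test function, regarded as a continuous function with compact support. -/
def toContinuousTest (φ : TestFunction (openInterval a b) ℝ ⊤) :
    TestFunction (openInterval a b) ℝ 0 :=
  ⟨φ, φ.contDiff.of_le (by simp), φ.hasCompactSupport, φ.tsupport_subset⟩

/-- `Q` is of locally bounded variation on `(a, b)` and its distributional derivative is `q`. -/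
def IsAntiderivative (Q : ℝ → ℂ) (q : Distribution (openInterval a b) ℂ 0) : Prop :=
  LocallyBoundedVariationOn Q (openInterval a b) ∧
    ∀ φ : TestFunction (openInterval a b) ℝ ⊤,
      q (toContinuousTest φ) = -∫ x, deriv (φ : ℝ → ℝ) x • Q x

open Classical in
/-- An antiderivative of locally bounded variation (two of them differ by a constant off a
countable set). -/
def antiderivative (q : Distribution (openInterval a b) ℂ 0) : ℝ → ℂ :=
  if h : ∃ Q, IsAntiderivative Q q then h.choose else 0

/-- `Δ_q(x) = Q⁺(x) - Q⁻(x)`, where `Q` is an antiderivative of `q`. -/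
def jump (q : MatrixDist a b n) (x : ℝ) : Matrix (Fin n) (Fin n) ℂ :=
  Matrix.of fun i j =>
    Function.rightLim (antiderivative (q i j)) x - Function.leftLim (antiderivative (q i j)) x

/-- `q* = q`; as test functions are real, conjugating a distribution conjugates its values. -/
def IsHermitianDist (q : MatrixDist a b n) : Prop :=
  ∀ (φ : TestFunction (openInterval a b) ℝ 0) (i j : Fin n), q i j φ = conj (q j i φ)

open scoped ComplexOrder in
/-- For every `c ∈ ℂⁿ` the distribution `c* w c` is non-negative. -/
def IsNonnegDist (w : MatrixDist a b n) : Prop :=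
  ∀ (c : Fin n → ℂ) (φ : TestFunction (openInterval a b) ℝ 0), (∀ x, 0 ≤ φ x) →
    0 ≤ ∑ i, ∑ j, conj (c i) * w i j φ * c j

/-- The distribution `q` is the (locally finite, matrix-valued complex) measure `H dμ`. -/
structure IsDensityRep (μ : MeasureTheory.Measure ℝ) (H : ℝ → Matrix (Fin n) (Fin n) ℂ)
    (q : MatrixDist a b n) : Prop where
  measurable : ∀ i j, Measurable fun x => H x i j
  compl : μ (openInterval a b : Set ℝ)ᶜ = 0
  finite : ∀ K : Set ℝ, IsCompact K → K ⊆ openInterval a b → μ K < ⊤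
  integrableOn : ∀ K : Set ℝ, IsCompact K → K ⊆ openInterval a b →
    ∀ i j, MeasureTheory.IntegrableOn (fun x => H x i j) K μ
  apply_eq : ∀ (φ : TestFunction (openInterval a b) ℝ 0) (i j : Fin n),
    q i j φ = ∫ x, φ x * H x i j ∂μ

open scoped ComplexOrder in
/-- `w = W̃ dS` with `S` the measure of `tr w` (this is the trace condition) and `W̃ ≥ 0`. -/
structure IsWeightRep (S : MeasureTheory.Measure ℝ) (W : ℝ → Matrix (Fin n) (Fin n) ℂ)
    (w : MatrixDist a b n) : Prop extends IsDensityRep S W w where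
  posSemidef : ∀ x, (W x).PosSemidef
  trace_eq_one : ∀ᵐ x ∂S, (W x).trace = 1

open Classical in
/-- A measure and a density representing `q`. -/
def densityRep (q : MatrixDist a b n) :
    MeasureTheory.Measure ℝ × (ℝ → Matrix (Fin n) (Fin n) ℂ) :=
  if h : ∃ p : MeasureTheory.Measure ℝ × (ℝ → Matrix (Fin n) (Fin n) ℂ),
    IsDensityRep p.1 p.2 q then h.choose else (0, 0)

open Classical in
/-- The trace measure `S` of `w` and the Radon-Nikodym density `W̃` of `w` with respect to it. -/
def weightRep (w : MatrixDist a b n) :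
    MeasureTheory.Measure ℝ × (ℝ → Matrix (Fin n) (Fin n) ℂ) :=
  if h : ∃ p : MeasureTheory.Measure ℝ × (ℝ → Matrix (Fin n) (Fin n) ℂ),
    IsWeightRep p.1 p.2 w then h.choose else (0, 0)

/-- The trace measure `S`. -/
def traceMeasure (w : MatrixDist a b n) : MeasureTheory.Measure ℝ := (weightRep w).1

/-- The density `W̃`. -/
def weightDensity (w : MatrixDist a b n) (x : ℝ) : Matrix (Fin n) (Fin n) ℂ := (weightRep w).2 x

theorem densityRep_integrableOn (q : MatrixDist a b n) {K : Set ℝ} (hK : IsCompact K)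
    (hKs : K ⊆ openInterval a b) (i j : Fin n) :
    MeasureTheory.IntegrableOn (fun x => (densityRep q).2 x i j) K (densityRep q).1 := by
  unfold densityRep
  split_ifs with h
  · exact h.choose_spec.integrableOn K hK hKs i j
  · simp

theorem weightDensity_integrableOn (w : MatrixDist a b n) {K : Set ℝ} (hK : IsCompact K)
    (hKs : K ⊆ openInterval a b) (i j : Fin n) :
    MeasureTheory.IntegrableOn (fun x => weightDensity w x i j) K (traceMeasure w) := by
  unfold weightDensity traceMeasure weightRep
  split_ifs with h
  · exact h.choose_spec.integrableOn K hK hKs i j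
  · simp

theorem weightDensity_measurable (w : MatrixDist a b n) (i j : Fin n) :
    Measurable fun x => weightDensity w x i j := by
  unfold weightDensity weightRep
  split_ifs with h
  · exact h.choose_spec.measurable i j
  · exact measurable_const

open scoped ComplexOrder in
theorem weightDensity_posSemidef (w : MatrixDist a b n) (x : ℝ) :
    (weightDensity w x).PosSemidef := by
  unfold weightDensity weightRep
  split_ifs with h
  · exact h.choose_spec.posSemidef x
  · exact Matrix.PosSemidef.zero

/-- The sesquilinear expression `f(x)* W̃(x) g(x)`. -/
def weightForm (w : MatrixDist a b n) (f g : ℝ → Fin n → ℂ) (x : ℝ) : ℂ :=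
  star (f x) ⬝ᵥ (weightDensity w x).mulVec (g x)


open scoped ComplexOrder in
theorem weightForm_self_nonneg (w : MatrixDist a b n) (f : ℝ → Fin n → ℂ) (x : ℝ) :
    0 ≤ weightForm w f f x :=
  (weightDensity_posSemidef w x).dotProduct_mulVec_nonneg (f x)

theorem weightForm_add_left (w : MatrixDist a b n) (f g h : ℝ → Fin n → ℂ) (x : ℝ) :
    weightForm w (f + g) h x = weightForm w f h x + weightForm w g h x := by
  simp [weightForm, add_dotProduct]

theorem weightForm_smul_left (w : MatrixDist a b n) (c : ℂ) (f h : ℝ → Fin n → ℂ) (x : ℝ) :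
    weightForm w (c • f) h x = conj c * weightForm w f h x := by
  simp [weightForm, smul_dotProduct]

open scoped ComplexOrder in
theorem weightForm_conj (w : MatrixDist a b n) (f g : ℝ → Fin n → ℂ) (x : ℝ) :
    conj (weightForm w g f x) = weightForm w f g x := by
  have h := (weightDensity_posSemidef w x).isHermitian
  rw [weightForm, weightForm, starRingEnd_apply, Matrix.star_dotProduct, star_star,
    Matrix.star_mulVec, h.eq, Matrix.dotProduct_mulVec]

theorem weightForm_add_right (w : MatrixDist a b n) (f g h : ℝ → Fin n → ℂ) (x : ℝ) :
    weightForm w f (g + h) x = weightForm w f g x + weightForm w f h x := by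
  simp [weightForm, Matrix.mulVec_add, dotProduct_add]

theorem weightForm_smul_right (w : MatrixDist a b n) (c : ℂ) (f h : ℝ → Fin n → ℂ) (x : ℝ) :
    weightForm w f (c • h) x = c * weightForm w f h x := by
  simp [weightForm, Matrix.mulVec_smul, dotProduct_smul]

open scoped ComplexOrder in
theorem norm_weightForm_le (w : MatrixDist a b n) (f g : ℝ → Fin n → ℂ) (x : ℝ) :
    ‖weightForm w f g x‖ ≤ ‖weightForm w f f x‖ + ‖weightForm w g g x‖ := by
  obtain ⟨c, hc, hcz⟩ : ∃ c : ℂ, ‖c‖ = 1 ∧ c * weightForm w f g x = -(‖weightForm w f g x‖ : ℂ) := by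
    rcases eq_or_ne (weightForm w f g x) 0 with h | h
    · exact ⟨1, by simp, by simp [h]⟩
    · have h' : (‖weightForm w f g x‖ : ℂ) ≠ 0 := by simpa using h
      refine ⟨-(‖weightForm w f g x‖ : ℂ) / weightForm w f g x, ?_, by field_simp⟩
      simp [h]
  have h0 := (Complex.le_def.1 (weightForm_self_nonneg w (f + c • g) x)).1
  have h1 := (Complex.le_def.1 (weightForm_self_nonneg w f x)).1
  have h2 := (Complex.le_def.1 (weightForm_self_nonneg w g x)).1
  have h3 : weightForm w (f + c • g) (f + c • g) x = weightForm w f f x + weightForm w g g x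
      + (c * weightForm w f g x + conj (c * weightForm w f g x)) := by
    have hcc : conj c * c = 1 := by rw [← Complex.normSq_eq_conj_mul_self, Complex.normSq_eq_norm_sq, hc]; simp
    rw [weightForm_add_left, weightForm_add_right, weightForm_add_right, weightForm_smul_left,
      weightForm_smul_left, weightForm_smul_right, weightForm_smul_right, map_mul,
      weightForm_conj]
    linear_combination weightForm w g g x * hcc
  rw [h3, hcz] at h0
  simp at h0 h1 h2
  have h4 := Complex.re_le_norm (weightForm w f f x)
  have h5 := Complex.re_le_norm (weightForm w g g x)
  linarith [norm_nonneg (weightForm w f g x)]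

theorem weightForm_aestronglyMeasurable (w : MatrixDist a b n) {μ : MeasureTheory.Measure ℝ}
    {f g : ℝ → Fin n → ℂ} (hf : AEMeasurable f μ) (hg : AEMeasurable g μ) :
    MeasureTheory.AEStronglyMeasurable (weightForm w f g) μ := by
  have h : weightForm w f g = fun x => ∑ i, star (f x i) * ∑ j, weightDensity w x i j * g x j := by
    ext x
    simp [weightForm, dotProduct, Matrix.mulVec]
  rw [h]
  refine AEMeasurable.aestronglyMeasurable ?_
  have hf' : ∀ i, AEMeasurable (fun x => f x i) μ := fun i => aemeasurable_pi_iff.1 hf i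
  have hg' : ∀ i, AEMeasurable (fun x => g x i) μ := fun i => aemeasurable_pi_iff.1 hg i
  refine Finset.aemeasurable_fun_sum _ fun i _ => ?_
  refine AEMeasurable.mul ?_ ?_
  · exact Complex.continuous_conj.measurable.comp_aemeasurable (hf' i)
  · exact Finset.aemeasurable_fun_sum _ fun j _ =>
      (weightDensity_measurable w i j).aemeasurable.mul (hg' j)

theorem weightForm_integrable (w : MatrixDist a b n) {μ : MeasureTheory.Measure ℝ}
    {f g : ℝ → Fin n → ℂ} (hf : AEMeasurable f μ) (hg : AEMeasurable g μ)
    (hff : MeasureTheory.Integrable (weightForm w f f) μ)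
    (hgg : MeasureTheory.Integrable (weightForm w g g) μ) :
    MeasureTheory.Integrable (weightForm w f g) μ :=
  (hff.norm.add hgg.norm).mono' (weightForm_aestronglyMeasurable w hf hg)
    (Filter.Eventually.of_forall fun x => norm_weightForm_le w f g x)

/-- The functions `f` with `∫ f* W̃ f dS < ∞` (values outside of `(a, b)` are irrelevant, as
`S` does not charge the complement of the interval). -/
def squareIntegrable (w : MatrixDist a b n) : Submodule ℂ (ℝ → Fin n → ℂ) where
  carrier := {f | AEMeasurable f (traceMeasure w) ∧
    MeasureTheory.Integrable (weightForm w f f) (traceMeasure w)}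
  zero_mem' := by
    refine ⟨aemeasurable_const, ?_⟩
    have h : weightForm w 0 0 = 0 := by ext x; simp [weightForm]
    rw [h]
    exact MeasureTheory.integrable_zero _ _ _
  add_mem' := by
    rintro f g ⟨hf, hff⟩ ⟨hg, hgg⟩
    refine ⟨hf.add hg, ?_⟩
    have h : weightForm w (f + g) (f + g) = (weightForm w f f + weightForm w g g)
        + (weightForm w f g + weightForm w g f) := by
      ext x
      simp only [weightForm_add_left, weightForm_add_right, Pi.add_apply]
      ring
    rw [h]
    exact (hff.add hgg).add ((weightForm_integrable w hf hg hff hgg).add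
      (weightForm_integrable w hg hf hgg hff))
  smul_mem' := by
    rintro c f ⟨hf, hff⟩
    refine ⟨hf.const_smul c, ?_⟩
    have h : weightForm w (c • f) (c • f) = fun x => (conj c * c) * weightForm w f f x := by
      ext x
      simp only [weightForm_smul_left, weightForm_smul_right]
      ring
    rw [h]
    exact hff.const_mul _

/-- The space `𝓛²(w)` of representatives, to be equipped with its semi-scalar product. -/
def PreL2 (w : MatrixDist a b n) : Type := squareIntegrable w

instance (w : MatrixDist a b n) : AddCommGroup (PreL2 w) :=
  inferInstanceAs (AddCommGroup (squareIntegrable w))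

instance (w : MatrixDist a b n) : Module ℂ (PreL2 w) :=
  inferInstanceAs (Module ℂ (squareIntegrable w))

/-- The underlying function. -/
def PreL2.fn (w : MatrixDist a b n) : PreL2 w →ₗ[ℂ] (ℝ → Fin n → ℂ) :=
  (squareIntegrable w).subtype

theorem PreL2.aemeasurable {w : MatrixDist a b n} (f : PreL2 w) :
    AEMeasurable (PreL2.fn w f) (traceMeasure w) := f.2.1

theorem PreL2.integrable {w : MatrixDist a b n} (f g : PreL2 w) :
    MeasureTheory.Integrable (weightForm w (PreL2.fn w f) (PreL2.fn w g)) (traceMeasure w) :=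
  weightForm_integrable w f.2.1 g.2.1 f.2.2 g.2.2

open scoped ComplexOrder in
/-- The semi-scalar product `⟨f, g⟩ = ∫ f* W̃ g dS`. -/
abbrev preL2Core (w : MatrixDist a b n) : PreInnerProductSpace.Core ℂ (PreL2 w) where
  inner f g := ∫ x, weightForm w (PreL2.fn w f) (PreL2.fn w g) x ∂traceMeasure w
  conj_inner_symm f g := by
    rw [← integral_conj]
    simp only [weightForm_conj]
  re_inner_nonneg f := by
    have h := integral_re (𝕜 := ℂ) (PreL2.integrable f f)
    rw [← h]
    exact MeasureTheory.integral_nonneg fun x =>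
      (Complex.le_def.1 (weightForm_self_nonneg w (PreL2.fn w f) x)).1
  add_left f g h := by
    rw [← MeasureTheory.integral_add (PreL2.integrable f h) (PreL2.integrable g h)]
    simp only [map_add, weightForm_add_left]
  smul_left f g c := by
    rw [← MeasureTheory.integral_const_mul]
    simp only [map_smul, weightForm_smul_left]

instance (w : MatrixDist a b n) : SeminormedAddCommGroup (PreL2 w) :=
  letI := preL2Core w
  InnerProductSpace.Core.toSeminormedAddCommGroup (𝕜 := ℂ)

instance (w : MatrixDist a b n) : InnerProductSpace ℂ (PreL2 w) :=
  InnerProductSpace.ofCore (preL2Core w)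

theorem PreL2.inner_def {w : MatrixDist a b n} (f g : PreL2 w) :
    inner ℂ f g = ∫ x, weightForm w (PreL2.fn w f) (PreL2.fn w g) x ∂traceMeasure w := rfl

/-- The space `L²(w)`: elements of `𝓛²(w)` are identified when the norm of their difference
vanishes. -/
abbrev L2 (w : MatrixDist a b n) : Type := SeparationQuotient (PreL2 w)

/-- `u` is the average of its one-sided limits at every point of `(a, b)`. -/
def IsBalancedOn (s : Set ℝ) (u : ℝ → ℂ) : Prop :=
  ∀ x ∈ s, ∃ l r : ℂ, Filter.Tendsto u (𝓝[<] x) (𝓝 l) ∧ Filter.Tendsto u (𝓝[>] x) (𝓝 r) ∧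
    u x = (l + r) / 2

theorem LocallyBV.add {u v : ℝ → ℂ} {s : Set ℝ} (hu : LocallyBoundedVariationOn u s)
    (hv : LocallyBoundedVariationOn v s) : LocallyBoundedVariationOn (fun x => u x + v x) s := by
  intro c d hc hd
  refine ne_top_of_le_ne_top (ENNReal.add_ne_top.2 ⟨hu c d hc hd, hv c d hc hd⟩) ?_
  refine iSup_le fun p => ?_
  calc ∑ i ∈ Finset.range p.1, edist (u (p.2.1 (i + 1)) + v (p.2.1 (i + 1)))
          (u (p.2.1 i) + v (p.2.1 i))
      ≤ ∑ i ∈ Finset.range p.1, (edist (u (p.2.1 (i + 1))) (u (p.2.1 i))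
          + edist (v (p.2.1 (i + 1))) (v (p.2.1 i))) :=
        Finset.sum_le_sum fun i _ => edist_add_add_le _ _ _ _
    _ ≤ _ := by
        rw [Finset.sum_add_distrib]
        exact add_le_add (eVariationOn.sum_le p.2.2.1 p.2.2.2)
          (eVariationOn.sum_le p.2.2.1 p.2.2.2)

theorem LocallyBV.const_mul {u : ℝ → ℂ} {s : Set ℝ} (c : ℂ)
    (hu : LocallyBoundedVariationOn u s) : LocallyBoundedVariationOn (fun x => c * u x) s :=
  (lipschitzWith_smul c).comp_locallyBoundedVariationOn hu

/-- The space `BV_loc^#((a, b))ⁿ` of balanced functions of locally bounded variation. -/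
def balancedBV (a b : EReal) (n : ℕ) : Submodule ℂ (ℝ → Fin n → ℂ) where
  carrier := {u | ∀ i, LocallyBoundedVariationOn (fun x => u x i) (openInterval a b) ∧
    IsBalancedOn (openInterval a b) fun x => u x i}
  zero_mem' := by
    intro i
    refine ⟨(LipschitzWith.const (0 : ℂ)).locallyBoundedVariationOn _, fun x _ => ⟨0, 0, ?_⟩⟩
    simp
  add_mem' := by
    intro u v hu hv i
    refine ⟨LocallyBV.add (hu i).1 (hv i).1, fun x hx => ?_⟩
    obtain ⟨l, r, hl, hr, he⟩ := (hu i).2 x hx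
    obtain ⟨l', r', hl', hr', he'⟩ := (hv i).2 x hx
    refine ⟨l + l', r + r', hl.add hl', hr.add hr', ?_⟩
    simp only [Pi.add_apply] at *
    rw [he, he']
    ring
  smul_mem' := by
    intro c u hu i
    refine ⟨LocallyBV.const_mul c (hu i).1, fun x hx => ?_⟩
    obtain ⟨l, r, hl, hr, he⟩ := (hu i).2 x hx
    refine ⟨c * l, c * r, hl.const_mul c, hr.const_mul c, ?_⟩
    simp only [Pi.smul_apply, smul_eq_mul] at *
    rw [he]
    ring

theorem exists_Icc_superset {K : Set ℝ} (hK : IsCompact K) (hKs : K ⊆ openInterval a b) :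
    K = ∅ ∨ ∃ c d, c ∈ openInterval a b ∧ d ∈ openInterval a b ∧ K ⊆ Set.Icc c d := by
  rcases K.eq_empty_or_nonempty with h | h
  · exact Or.inl h
  · refine Or.inr ⟨sInf K, sSup K, hKs (hK.sInf_mem h), hKs (hK.sSup_mem h), fun x hx => ?_⟩
    exact ⟨csInf_le hK.bddBelow hx, le_csSup hK.bddAbove hx⟩

theorem Icc_subset_openInterval {c d : ℝ} (hc : c ∈ openInterval a b)
    (hd : d ∈ openInterval a b) : Set.Icc c d ⊆ openInterval a b := fun _ hx =>
  ⟨hc.1.trans_le (EReal.coe_le_coe_iff.2 hx.1), (EReal.coe_le_coe_iff.2 hx.2).trans_lt hd.2⟩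

/-- Functions of locally bounded variation are measurable and bounded on compact subsets. -/
theorem LocallyBV.aemeasurable_bounded {u : ℝ → ℂ}
    (hu : LocallyBoundedVariationOn u (openInterval a b)) {K : Set ℝ} (hK : IsCompact K)
    (hKs : K ⊆ openInterval a b) (μ : MeasureTheory.Measure ℝ) :
    AEMeasurable u (μ.restrict K) ∧ ∃ C, ∀ x ∈ K, ‖u x‖ ≤ C := by
  rcases exists_Icc_superset hK hKs with rfl | ⟨c, d, hc, hd, hcd⟩
  · simp
  have hre := ((Complex.reCLM.lipschitz).comp_locallyBoundedVariationOn hu)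
  have him := ((Complex.imCLM.lipschitz).comp_locallyBoundedVariationOn hu)
  have key : ∀ v : ℝ → ℝ, LocallyBoundedVariationOn v (openInterval a b : Set ℝ) →
      AEMeasurable v (μ.restrict K) := by
    intro v hv
    obtain ⟨p, q, hp, hq, rfl⟩ := hv.exists_monotoneOn_sub_monotoneOn
    exact (aemeasurable_restrict_of_monotoneOn hK.measurableSet (hp.mono hKs)).sub
      (aemeasurable_restrict_of_monotoneOn hK.measurableSet (hq.mono hKs))
  refine ⟨?_, ?_⟩
  · have h := ((Complex.continuous_ofReal.measurable.comp_aemeasurable (key _ hre)).add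
      ((Complex.continuous_ofReal.measurable.comp_aemeasurable (key _ him)).mul_const Complex.I))
    refine h.congr (Filter.Eventually.of_forall fun x => ?_)
    exact Complex.re_add_im (u x)
  · refine ⟨‖u c‖ + (eVariationOn u ((openInterval a b : Set ℝ) ∩ Set.Icc c d)).toReal,
      fun x hx => ?_⟩
    have hcc : c ≤ d := (hcd hx).1.trans (hcd hx).2
    have h := (hu c d hc hd).dist_le (x := x) (y := c) ⟨hKs hx, hcd hx⟩ ⟨hc, le_rfl, hcc⟩
    rw [dist_eq_norm] at h
    have := norm_sub_norm_le (u x) (u c)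
    linarith

/-- The distributional derivative `φ ↦ -∫ φ' u` of a vector-valued function. -/
def derivDist (u : ℝ → Fin n → ℂ) (φ : TestFunction (openInterval a b) ℝ ⊤) : Fin n → ℂ :=
  fun i => -∫ x, ((deriv (φ : ℝ → ℝ) x : ℝ) : ℂ) * u x i

/-- The distribution `q u : φ ↦ ∫ φ q u` for `u` of locally bounded variation. -/
def mulDist (q : MatrixDist a b n) (u : ℝ → Fin n → ℂ)
    (φ : TestFunction (openInterval a b) ℝ ⊤) : Fin n → ℂ :=
  fun i => ∫ x, φ x * ((densityRep q).2 x).mulVec (u x) i ∂(densityRep q).1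

/-- The distribution `w f : φ ↦ ∫ (W̃ f) φ dS` for `f ∈ 𝓛²(w)`. -/
def weightMulDist (w : MatrixDist a b n) (f : ℝ → Fin n → ℂ)
    (φ : TestFunction (openInterval a b) ℝ ⊤) : Fin n → ℂ :=
  fun i => ∫ x, φ x * (weightDensity w x).mulVec (f x) i ∂traceMeasure w

/-- The equation `J u' + q u = w f` of distributions on `(a, b)`. -/
def IsSolution (J : Matrix (Fin n) (Fin n) ℂ) (q w : MatrixDist a b n)
    (u f : ℝ → Fin n → ℂ) : Prop :=
  ∀ φ : TestFunction (openInterval a b) ℝ ⊤,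
    J.mulVec (derivDist u φ) + mulDist q u φ = weightMulDist w f φ

theorem integrable_of_tsupport {μ : MeasureTheory.Measure ℝ} {ψ : ℝ → ℝ} (hψ : Continuous ψ)
    (hc : HasCompactSupport ψ) {h : ℝ → ℂ}
    (hh : MeasureTheory.IntegrableOn h (tsupport ψ) μ) :
    MeasureTheory.Integrable (fun x => (ψ x : ℂ) * h x) μ := by
  have hs : Function.support (fun x => (ψ x : ℂ) * h x) ⊆ tsupport ψ := by
    intro x hx
    apply subset_tsupport
    intro h0
    apply hx
    simp [h0]
  rw [← MeasureTheory.integrableOn_iff_integrable_of_support_subset hs]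
  obtain ⟨C, hC⟩ := hψ.bounded_above_of_compact_support hc
  refine MeasureTheory.Integrable.bdd_mul (c := C) hh
    (Complex.continuous_ofReal.comp hψ).aestronglyMeasurable
    (Filter.Eventually.of_forall fun x => ?_)
  simpa using hC x

theorem derivDist_integrable {u : ℝ → Fin n → ℂ} (hu : u ∈ balancedBV a b n)
    (φ : TestFunction (openInterval a b) ℝ ⊤) (i : Fin n) :
    MeasureTheory.Integrable fun x => ((deriv (φ : ℝ → ℝ) x : ℝ) : ℂ) * u x i := by
  have hc : HasCompactSupport (deriv φ) := φ.hasCompactSupport.deriv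
  have hs : tsupport (deriv φ) ⊆ openInterval a b :=
    tsupport_deriv_subset.trans φ.tsupport_subset
  have hd : Continuous (deriv φ) := φ.contDiff.continuous_deriv (by simp)
  refine integrable_of_tsupport hd hc ?_
  obtain ⟨hm, C, hC⟩ := LocallyBV.aemeasurable_bounded (hu i).1 hc hs MeasureTheory.volume
  refine MeasureTheory.IntegrableOn.of_bound hc.measure_lt_top hm.aestronglyMeasurable C ?_
  exact MeasureTheory.ae_restrict_of_forall_mem hc.measurableSet hC

theorem mulDist_integrable (q : MatrixDist a b n) {u : ℝ → Fin n → ℂ}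
    (hu : u ∈ balancedBV a b n) (φ : TestFunction (openInterval a b) ℝ ⊤) (i : Fin n) :
    MeasureTheory.Integrable
      (fun x => (φ x : ℂ) * ((densityRep q).2 x).mulVec (u x) i) (densityRep q).1 := by
  refine integrable_of_tsupport φ.continuous φ.hasCompactSupport ?_
  simp only [Matrix.mulVec, dotProduct]
  refine MeasureTheory.integrable_finsetSum _ fun j _ => ?_
  obtain ⟨hm, C, hC⟩ := LocallyBV.aemeasurable_bounded (hu j).1 φ.hasCompactSupport
    φ.tsupport_subset (densityRep q).1
  refine MeasureTheory.Integrable.mul_bdd (c := C)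
    (densityRep_integrableOn q φ.hasCompactSupport φ.tsupport_subset i j)
    hm.aestronglyMeasurable ?_
  exact MeasureTheory.ae_restrict_of_forall_mem φ.hasCompactSupport.measurableSet hC

theorem weightMulDist_integrable (w : MatrixDist a b n) (f : PreL2 w)
    (φ : TestFunction (openInterval a b) ℝ ⊤) (i : Fin n) :
    MeasureTheory.Integrable
      (fun x => (φ x : ℂ) * (weightDensity w x).mulVec (PreL2.fn w f x) i) (traceMeasure w) := by
  refine integrable_of_tsupport φ.continuous φ.hasCompactSupport ?_
  have h1 : ∀ g : ℝ → Fin n → ℂ, ∀ x, weightForm w (fun _ => Pi.single i 1) g x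
      = (weightDensity w x).mulVec (g x) i := by
    intro g x
    simp [weightForm]
  have h2 := weightForm_integrable w (μ := (traceMeasure w).restrict (tsupport φ))
    (f := fun _ => Pi.single i 1) (g := PreL2.fn w f) aemeasurable_const
    (PreL2.aemeasurable f).restrict ?_ (PreL2.integrable f f).restrict
  · exact h2.congr (Filter.Eventually.of_forall fun x => h1 _ x)
  · refine (weightDensity_integrableOn w φ.hasCompactSupport φ.tsupport_subset i i).congr
      (Filter.Eventually.of_forall fun x => ?_)
    rw [h1]
    simp

/-- The relation `𝓣_max` between representatives. -/
def preMaximal (J : Matrix (Fin n) (Fin n) ℂ) (q w : MatrixDist a b n) :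
    Submodule ℂ (PreL2 w × PreL2 w) where
  carrier := {p | PreL2.fn w p.1 ∈ balancedBV a b n ∧
    IsSolution J q w (PreL2.fn w p.1) (PreL2.fn w p.2)}
  zero_mem' := by
    refine ⟨by simp, fun φ => ?_⟩
    ext i
    simp [derivDist, mulDist, weightMulDist, Matrix.mulVec, dotProduct]
  add_mem' := by
    rintro p r ⟨hp, hp'⟩ ⟨hr, hr'⟩
    refine ⟨by simpa using add_mem hp hr, fun φ => ?_⟩
    have h1 : derivDist (PreL2.fn w (p + r).1) φ
        = derivDist (PreL2.fn w p.1) φ + derivDist (PreL2.fn w r.1) φ := by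
      ext i
      simp only [derivDist, Prod.fst_add, map_add, Pi.add_apply, mul_add]
      rw [MeasureTheory.integral_add (derivDist_integrable hp φ i) (derivDist_integrable hr φ i)]
      ring
    have h2 : mulDist q (PreL2.fn w (p + r).1) φ
        = mulDist q (PreL2.fn w p.1) φ + mulDist q (PreL2.fn w r.1) φ := by
      ext i
      simp only [mulDist, Prod.fst_add, map_add, Pi.add_apply, Matrix.mulVec_add, mul_add]
      rw [MeasureTheory.integral_add (mulDist_integrable q hp φ i) (mulDist_integrable q hr φ i)]
    have h3 : weightMulDist w (PreL2.fn w (p + r).2) φ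
        = weightMulDist w (PreL2.fn w p.2) φ + weightMulDist w (PreL2.fn w r.2) φ := by
      ext i
      simp only [weightMulDist, Prod.snd_add, map_add, Pi.add_apply, Matrix.mulVec_add, mul_add]
      rw [MeasureTheory.integral_add (weightMulDist_integrable w p.2 φ i)
        (weightMulDist_integrable w r.2 φ i)]
    rw [h1, h2, h3, ← hp' φ, ← hr' φ, Matrix.mulVec_add]
    abel
  smul_mem' := by
    rintro c p ⟨hp, hp'⟩
    refine ⟨by simpa using Submodule.smul_mem _ c hp, fun φ => ?_⟩
    have h1 : derivDist (PreL2.fn w (c • p).1) φ = c • derivDist (PreL2.fn w p.1) φ := by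
      ext i
      simp only [derivDist, Prod.smul_fst, map_smul, Pi.smul_apply, smul_eq_mul,
        mul_left_comm _ c]
      rw [MeasureTheory.integral_const_mul]
      ring
    have h2 : mulDist q (PreL2.fn w (c • p).1) φ = c • mulDist q (PreL2.fn w p.1) φ := by
      ext i
      simp only [mulDist, Prod.smul_fst, map_smul, Pi.smul_apply, Matrix.mulVec_smul,
        smul_eq_mul, mul_left_comm _ c]
      rw [MeasureTheory.integral_const_mul]
    have h3 : weightMulDist w (PreL2.fn w (c • p).2) φ
        = c • weightMulDist w (PreL2.fn w p.2) φ := by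
      ext i
      simp only [weightMulDist, Prod.smul_snd, map_smul, Pi.smul_apply, Matrix.mulVec_smul,
        smul_eq_mul, mul_left_comm _ c]
      rw [MeasureTheory.integral_const_mul]
    rw [h1, h2, h3, ← hp' φ, Matrix.mulVec_smul, smul_add]

/-- `u` vanishes on `(a, b)` outside of a compact subset of `(a, b)`. -/
def HasCompactSupportIn (a b : EReal) (u : ℝ → Fin n → ℂ) : Prop :=
  ∃ K : Set ℝ, IsCompact K ∧ K ⊆ openInterval a b ∧ ∀ x ∈ openInterval a b, x ∉ K → u x = 0

/-- The relation `𝓣_min` between representatives. -/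
def preMinimal (J : Matrix (Fin n) (Fin n) ℂ) (q w : MatrixDist a b n) :
    Submodule ℂ (PreL2 w × PreL2 w) where
  carrier := {p | p ∈ preMaximal J q w ∧ HasCompactSupportIn a b (PreL2.fn w p.1)}
  zero_mem' := ⟨zero_mem _, ∅, isCompact_empty, by simp, by simp⟩
  add_mem' := by
    rintro p r ⟨hp, K, hK, hKs, hK0⟩ ⟨hr, L, hL, hLs, hL0⟩
    refine ⟨add_mem hp hr, K ∪ L, hK.union hL, Set.union_subset hKs hLs, fun x hx hx' => ?_⟩
    rw [Set.mem_union, not_or] at hx'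
    simp [hK0 x hx hx'.1, hL0 x hx hx'.2]
  smul_mem' := by
    rintro c p ⟨hp, K, hK, hKs, hK0⟩
    refine ⟨Submodule.smul_mem _ c hp, K, hK, hKs, fun x hx hx' => ?_⟩
    simp [hK0 x hx hx']

/-- The map `(u, f) ↦ ([u], [f])`. -/
def classMap (w : MatrixDist a b n) : PreL2 w × PreL2 w →ₗ[ℂ] L2 w × L2 w :=
  LinearMap.prodMap (SeparationQuotient.mkCLM ℂ (PreL2 w)).toLinearMap
    (SeparationQuotient.mkCLM ℂ (PreL2 w)).toLinearMap

/-- The maximal relation `T_max`. -/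
def maximalRelation (J : Matrix (Fin n) (Fin n) ℂ) (q w : MatrixDist a b n) :
    Submodule ℂ (L2 w × L2 w) :=
  (preMaximal J q w).map (classMap w)

/-- The minimal relation `T_min`. -/
def minimalRelation (J : Matrix (Fin n) (Fin n) ℂ) (q w : MatrixDist a b n) :
    Submodule ℂ (L2 w × L2 w) :=
  (preMinimal J q w).map (classMap w)

end DistSystem

end

open scoped Distributions Topology ComplexConjugate

open MeasureTheory Set Filter

/-! Both distributions get densities with respect to one measure ν (`refMeasure`), so that the
equation becomes J u' + A u ν = F ν. In integrated form (`IsIntegralSolution`) the left-hand limits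
y of u satisfy J(y(d) - y(c)) = ∫_[c,d) (F - A u) dν, and balancedness becomes (2J + Δ)u = 2J y +
ν{x} F at every x, where Δ = ν{x} A(x) is the jump of q. `isSolution_iff` identifies this with the
distributional equation. Invertibility of 2J + Δ recovers u from y and continues solutions to the
right, that of 2J - Δ continues them to the left; so initial value problems are solvable on all of
(a, b) (`exists_isIntegralSolution`), by way of a Volterra equation for y. Integration by parts
gives Lagrange's identity (`lagrange_refForcing`): the increment of y* J z over [c, d) is ∫ (u* W g
- f* W v) dS.

T_max ⊆ T_min*: if u has compact support, the boundary terms of Lagrange's identity vanish on large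
intervals.

T_min* ⊆ T_max: let (v, g) lie in the adjoint and let v₁ solve the equation with right-hand side wg.
If f is supported in [c, d) and orthogonal to all homogeneous solutions, then the solution u with
y(c) = 0 also has y(d) = 0 and vanishes off [c, d) (`exists_solution_supported`). Thus (u, f)
belongs to T_min, and Lagrange's identity against v₁ gives ⟨f, v₁⟩ = ⟨u, g⟩ = ⟨f, v⟩. So on [c, d)
the difference v - v₁ is orthogonal to the orthogonal complement of a finite-dimensional space, that
of the homogeneous solutions, and hence lies in that space (`exists_homogeneous_on_Ico`).

Without definiteness this homogeneous solution is not unique, and those of different intervals need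
not fit together. But the initial values whose solutions are null on [c_N, d_N) form a decreasing
sequence of subspaces of ℂⁿ, which becomes constant; from then on one homogeneous solution serves
all intervals (`exists_homogeneous`). Adding it to v₁ gives a representative of [v] that solves the
equation. -/

/-! ### Integration by parts and power estimates for measures with atoms. -/

/-- Fubini on the square [c, d)², cut into {t < s} and {s ≤ t}. The measures may have common atoms,
so the diagonal counts; it is assigned to the second term, which is why that one has a closed
interval. -/
theorem integrable_mul_setIntegral_Ico {𝕜 : Type*} [RCLike 𝕜] {μ ν : Measure ℝ} [SFinite μ]
    [SFinite ν] {φ ψ : ℝ → 𝕜} {c d : ℝ} (hφ : IntegrableOn φ (Ico c d) μ)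
    (hψ : IntegrableOn ψ (Ico c d) ν) :
    IntegrableOn (fun s => φ s * ∫ t in Ico c s, ψ t ∂ν) (Ico c d) μ ∧
    IntegrableOn (fun t => (∫ s in Icc c t, φ s ∂μ) * ψ t) (Ico c d) ν ∧
    (∫ s in Ico c d, φ s ∂μ) * (∫ t in Ico c d, ψ t ∂ν)
      = (∫ s in Ico c d, φ s * ∫ t in Ico c s, ψ t ∂ν ∂μ)
        + ∫ t in Ico c d, (∫ s in Icc c t, φ s ∂μ) * ψ t ∂ν := by
  set T : Set (ℝ × ℝ) := {z | z.2 < z.1} with hT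
  have hTm : MeasurableSet T := measurableSet_lt measurable_snd measurable_fst
  have hI : Integrable (fun z : ℝ × ℝ => φ z.1 * ψ z.2)
      ((μ.restrict (Ico c d)).prod (ν.restrict (Ico c d))) := hφ.mul_prod hψ
  have h1 := hI.indicator hTm
  have h2 := hI.indicator hTm.compl
  have e1 : ∀ s ∈ Ico c d,
      ∫ t in Ico c d, T.indicator (fun z => φ z.1 * ψ z.2) (s, t) ∂ν
        = φ s * ∫ t in Ico c s, ψ t ∂ν := by
    intro s hs
    have : ∀ t, T.indicator (fun z => φ z.1 * ψ z.2) (s, t)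
        = φ s * (Iio s).indicator ψ t := by
      intro t
      by_cases h : t < s <;> simp [hT, indicator, h]
    simp_rw [this]
    rw [integral_const_mul, setIntegral_indicator measurableSet_Iio]
    congr 3
    ext t
    simp only [mem_inter_iff, mem_Ico, mem_Iio]
    exact ⟨fun h => ⟨h.1.1, h.2⟩, fun h => ⟨⟨h.1, h.2.trans hs.2⟩, h.2⟩⟩
  have e2 : ∀ t ∈ Ico c d,
      ∫ s in Ico c d, Tᶜ.indicator (fun z => φ z.1 * ψ z.2) (s, t) ∂μ
        = (∫ s in Icc c t, φ s ∂μ) * ψ t := by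
    intro t ht
    have : ∀ s, Tᶜ.indicator (fun z => φ z.1 * ψ z.2) (s, t)
        = (Iic t).indicator φ s * ψ t := by
      intro s
      by_cases h : s ≤ t <;> simp [hT, indicator, h]
    simp_rw [this]
    rw [integral_mul_const, setIntegral_indicator measurableSet_Iic]
    congr 3
    ext s
    simp only [mem_inter_iff, mem_Ico, mem_Iic, mem_Icc]
    exact ⟨fun h => ⟨h.1.1, h.2⟩, fun h => ⟨⟨h.1, h.2.trans_lt ht.2⟩, h.2⟩⟩
  refine ⟨?_, ?_, ?_⟩
  · exact h1.integral_prod_left.congr (ae_restrict_of_forall_mem measurableSet_Ico e1)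
  · exact h2.integral_prod_right.congr (ae_restrict_of_forall_mem measurableSet_Ico e2)
  · have hs : (fun z : ℝ × ℝ => φ z.1 * ψ z.2) = T.indicator (fun z => φ z.1 * ψ z.2)
        + Tᶜ.indicator (fun z => φ z.1 * ψ z.2) := (indicator_self_add_compl _ _).symm
    rw [← integral_prod_mul, hs, integral_add' h1 h2, integral_prod _ h1, integral_prod_symm _ h2]
    congr 1
    · exact setIntegral_congr_fun measurableSet_Ico e1
    · exact setIntegral_congr_fun measurableSet_Ico e2

theorem setIntegral_Icc_eq_Ico_add {E : Type*} [NormedAddCommGroup E] [NormedSpace ℝ E]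
    [CompleteSpace E] {ν : Measure ℝ} {φ : ℝ → E} {c t : ℝ} (hct : c ≤ t)
    (hφ : IntegrableOn φ (Icc c t) ν) :
    ∫ s in Icc c t, φ s ∂ν = (∫ s in Ico c t, φ s ∂ν) + ν.real {t} • φ t := by
  rw [← Ico_union_right hct, setIntegral_union (by simp) (measurableSet_singleton t)
    (hφ.mono_set Ico_subset_Icc_self) (hφ.mono_set (by simp [hct]))]
  rw [integral_singleton]

/-- Integration by parts for two functions of locally bounded variation given by densities. -/
theorem mul_sub_mul_eq_setIntegral_Ico {𝕜 : Type*} [RCLike 𝕜] {μ ν : Measure ℝ} [SFinite μ]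
    [SFinite ν] {φ ψ F G : ℝ → 𝕜} {c d : ℝ} (hcd : c ≤ d) (hφ : IntegrableOn φ (Ico c d) μ)
    (hψ : IntegrableOn ψ (Ico c d) ν) (hF : ∀ x ∈ Icc c d, F x = F c + ∫ t in Ico c x, φ t ∂μ)
    (hG : ∀ x ∈ Icc c d, G x = G c + ∫ t in Ico c x, ψ t ∂ν) :
    IntegrableOn (fun s => φ s * G s) (Ico c d) μ ∧
    IntegrableOn (fun t => (F t + μ.real {t} • φ t) * ψ t) (Ico c d) ν ∧
    F d * G d - F c * G c = (∫ s in Ico c d, φ s * G s ∂μ)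
      + ∫ t in Ico c d, (F t + μ.real {t} • φ t) * ψ t ∂ν := by
  obtain ⟨h1, h2, h3⟩ := integrable_mul_setIntegral_Ico hφ hψ
  have g1 : ∀ s ∈ Ico c d, φ s * G s = φ s * G c + φ s * ∫ t in Ico c s, ψ t ∂ν := by
    intro s hs
    rw [hG s (Ico_subset_Icc_self hs), mul_add]
  -- `F t + μ.real {t} • φ t` is the right-hand limit of `F` at `t`, since `F` itself omits the atom
  -- at `t`.
  have g2 : ∀ t ∈ Ico c d, (F t + μ.real {t} • φ t) * ψ t
      = F c * ψ t + (∫ s in Icc c t, φ s ∂μ) * ψ t := by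
    intro t ht
    rw [setIntegral_Icc_eq_Ico_add ht.1 (hφ.mono_set fun s hs => ⟨hs.1, hs.2.trans_lt ht.2⟩),
      hF t (Ico_subset_Icc_self ht)]
    ring
  have i1 := (Integrable.mul_const hφ (G c))
  have i2 := (Integrable.const_mul hψ (F c))
  refine ⟨?_, ?_, ?_⟩
  · exact (i1.add h1).congr (ae_restrict_of_forall_mem measurableSet_Ico fun s hs => (g1 s hs).symm)
  · exact (i2.add h2).congr (ae_restrict_of_forall_mem measurableSet_Ico fun s hs => (g2 s hs).symm)
  · rw [setIntegral_congr_fun measurableSet_Ico g1, setIntegral_congr_fun measurableSet_Ico g2,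
      integral_add i1 h1, integral_add i2 h2, integral_mul_const, integral_const_mul,
      hF d ⟨hcd, le_rfl⟩, hG d ⟨hcd, le_rfl⟩]
    linear_combination h3

/-- The product rule for m(x) = ∫_[c,x) k dν, applied inductively to m · m^(j+1). One factor of the
rule is the right-hand limit of m, which is at least m; hence the density ψ of m^(j+1) only
dominates (j+1) k m^j, with a possible excess at atoms. -/
theorem exists_density_pow {ν : Measure ℝ} [SFinite ν] {k : ℝ → ℝ} {c d : ℝ}
    (hk : IntegrableOn k (Ico c d) ν) (hk0 : ∀ t, 0 ≤ k t) (j : ℕ) :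
    ∃ ψ : ℝ → ℝ, IntegrableOn ψ (Ico c d) ν ∧ (∀ t, 0 ≤ ψ t) ∧
      (∀ t ∈ Ico c d, (j + 1) * (k t * (∫ s in Ico c t, k s ∂ν) ^ j) ≤ ψ t) ∧
      ∀ x ∈ Icc c d, (∫ s in Ico c x, k s ∂ν) ^ (j + 1) = ∫ s in Ico c x, ψ s ∂ν := by
  have hm : ∀ t, 0 ≤ ∫ s in Ico c t, k s ∂ν := fun t => integral_nonneg hk0
  induction j with
  | zero => exact ⟨k, hk, hk0, fun t _ => by simp, fun x _ => by simp⟩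
  | succ j ih =>
    obtain ⟨ψ, hψ, hψ0, hψk, hψm⟩ := ih
    have key : ∀ x ∈ Icc c d, _ := fun x hx =>
      integrable_mul_setIntegral_Ico (hk.mono_set (Ico_subset_Ico_right hx.2))
        (hψ.mono_set (Ico_subset_Ico_right hx.2))
    rcases lt_or_ge d c with hdc | hcd
    · refine ⟨fun t => max 0 ((j + 1 + 1 : ℕ) * (k t * (∫ s in Ico c t, k s ∂ν) ^ (j + 1))),
        ?_, ?_, ?_, ?_⟩
      · simp [hdc.le]
      · exact fun t => le_max_left _ _
      · exact fun t ht => absurd (ht.1.trans_lt ht.2) hdc.not_gt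
      · exact fun t ht => absurd (ht.1.trans ht.2) hdc.not_ge
    refine ⟨fun s => (k s * ∫ t in Ico c s, ψ t ∂ν) + (∫ t in Icc c s, k t ∂ν) * ψ s, ?_, ?_, ?_, ?_⟩
    · exact (key d ⟨hcd, le_rfl⟩).1.add (key d ⟨hcd, le_rfl⟩).2.1
    · intro t
      have h1 : 0 ≤ ∫ s in Ico c t, ψ s ∂ν := integral_nonneg hψ0
      have h2 : 0 ≤ ∫ s in Icc c t, k s ∂ν := integral_nonneg hk0
      have := hk0 t
      have := hψ0 t
      positivity
    · intro t ht
      have h1 := hψm t (Ico_subset_Icc_self ht)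
      have h2 : ∫ s in Ico c t, k s ∂ν ≤ ∫ s in Icc c t, k s ∂ν :=
        setIntegral_mono_set (hk.mono_set fun s hs => ⟨hs.1, hs.2.trans_lt ht.2⟩)
          (Eventually.of_forall hk0) (Ico_subset_Icc_self.eventuallyLE)
      have h3 := hψk t ht
      beta_reduce
      rw [← h1]
      push_cast
      calc _ = k t * (∫ s in Ico c t, k s ∂ν) ^ (j + 1) + (∫ s in Ico c t, k s ∂ν)
            * ((j + 1) * (k t * (∫ s in Ico c t, k s ∂ν) ^ j)) := by ring
        _ ≤ k t * (∫ s in Ico c t, k s ∂ν) ^ (j + 1) + (∫ s in Icc c t, k s ∂ν) * ψ t := by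
          refine add_le_add le_rfl (mul_le_mul h2 h3 ?_ ((hm t).trans h2))
          have := hm t
          have := hk0 t
          positivity
    · intro x hx
      rw [pow_succ', hψm x hx, (key x hx).2.2, integral_add (key x hx).1 (key x hx).2.1]

/-- The substitute for ∫ m^j dm = m^(j+1)/(j+1). With atoms it survives as an inequality because m
is evaluated from the left; this is what makes Picard iteration over half-open intervals converge.
-/
theorem setIntegral_mul_pow_le {ν : Measure ℝ} [SFinite ν] {k : ℝ → ℝ} {c x : ℝ} (hcx : c ≤ x)
    (hk : IntegrableOn k (Ico c x) ν) (hk0 : ∀ t, 0 ≤ k t) (j : ℕ) :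
    IntegrableOn (fun t => k t * (∫ s in Ico c t, k s ∂ν) ^ j) (Ico c x) ν ∧
    ∫ t in Ico c x, k t * (∫ s in Ico c t, k s ∂ν) ^ j ∂ν
      ≤ (∫ s in Ico c x, k s ∂ν) ^ (j + 1) / (j + 1) := by
  have h0 : IntegrableOn (fun t => k t * (∫ s in Ico c t, k s ∂ν) ^ j) (Ico c x) ν := by
    cases j with
    | zero => simpa using hk
    | succ j =>
      obtain ⟨ψ, hψ, -, -, hψm⟩ := exists_density_pow hk hk0 j
      refine (integrable_mul_setIntegral_Ico hk hψ).1.congr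
        (ae_restrict_of_forall_mem measurableSet_Ico fun t ht => ?_)
      simp only [hψm t (Ico_subset_Icc_self ht)]
  obtain ⟨ψ, hψ, -, hψk, hψm⟩ := exists_density_pow hk hk0 j
  refine ⟨h0, ?_⟩
  rw [le_div_iff₀ (by positivity), hψm x ⟨hcx, le_rfl⟩, mul_comm, ← integral_const_mul]
  exact setIntegral_mono_on (h0.const_mul _) hψ measurableSet_Ico hψk

/-! ### Volterra equations with respect to a measure with atoms. -/

section Volterra

variable {n : ℕ}

theorem norm_mulVec_le (M : Matrix (Fin n) (Fin n) ℂ) (v : Fin n → ℂ) :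
    ‖M.mulVec v‖ ≤ (∑ i, ∑ j, ‖M i j‖) * ‖v‖ := by
  refine (pi_norm_le_iff_of_nonneg (by positivity)).2 fun i => ?_
  calc ‖M.mulVec v i‖ ≤ ∑ j, ‖M i j * v j‖ := norm_sum_le Finset.univ fun j => M i j * v j
    _ ≤ ∑ j, ‖M i j‖ * ‖v‖ := by
      refine Finset.sum_le_sum fun j _ => ?_
      rw [norm_mul]
      gcongr
      exact norm_le_pi_norm v j
    _ = (∑ j, ‖M i j‖) * ‖v‖ := (Finset.sum_mul ..).symm
    _ ≤ _ := by
      refine mul_le_mul_of_nonneg_right ?_ (norm_nonneg v)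
      exact Finset.single_le_sum (f := fun i => ∑ j, ‖M i j‖)
        (fun i _ => Finset.sum_nonneg fun j _ => norm_nonneg _) (Finset.mem_univ i)

theorem aestronglyMeasurable_mulVec {ν : Measure ℝ} {K : ℝ → Matrix (Fin n) (Fin n) ℂ}
    {u : ℝ → Fin n → ℂ} (hK : ∀ i j, AEStronglyMeasurable (fun t => K t i j) ν)
    (hu : AEStronglyMeasurable u ν) : AEStronglyMeasurable (fun t => (K t).mulVec (u t)) ν := by
  refine AEMeasurable.aestronglyMeasurable (aemeasurable_pi_iff.2 fun i => ?_)
  simp only [Matrix.mulVec, dotProduct]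
  exact Finset.aemeasurable_fun_sum _ fun j _ =>
    (hK i j).aemeasurable.mul (aemeasurable_pi_iff.1 hu.aemeasurable j)

theorem integrable_mulVec {ν : Measure ℝ} {K : ℝ → Matrix (Fin n) (Fin n) ℂ}
    {u : ℝ → Fin n → ℂ} {C : ℝ} (hK : ∀ i j, Integrable (fun t => K t i j) ν)
    (hu : AEStronglyMeasurable u ν) (hC : ∀ᵐ t ∂ν, ‖u t‖ ≤ C) :
    Integrable (fun t => (K t).mulVec (u t)) ν := by
  have hk : Integrable (fun t => (∑ i, ∑ j, ‖K t i j‖) * C) ν :=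
    (integrable_finsetSum _ fun i _ => integrable_finsetSum _ fun j _ => (hK i j).norm).mul_const _
  refine hk.mono' (aestronglyMeasurable_mulVec (fun i j => (hK i j).1) hu) ?_
  filter_upwards [hC] with t ht
  refine (norm_mulVec_le _ _).trans ?_
  gcongr

theorem integrable_mulVec' {ν : Measure ℝ} {K : ℝ → Matrix (Fin n) (Fin n) ℂ}
    {u : ℝ → Fin n → ℂ} {C : ℝ} (hK : ∀ i j, AEStronglyMeasurable (fun t => K t i j) ν)
    (hC : ∀ᵐ t ∂ν, ∀ i j, ‖K t i j‖ ≤ C) (hu : Integrable u ν) :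
    Integrable (fun t => (K t).mulVec (u t)) ν := by
  have hk : Integrable (fun t => (∑ _i : Fin n, ∑ _j : Fin n, C) * ‖u t‖) ν := hu.norm.const_mul _
  refine hk.mono' (aestronglyMeasurable_mulVec hK hu.1) ?_
  filter_upwards [hC] with t ht
  refine (norm_mulVec_le _ _).trans ?_
  gcongr with i _ j
  exact ht i j

theorem measurable_setIntegral_Ico {E : Type*} [NormedAddCommGroup E] [NormedSpace ℝ E]
    [MeasurableSpace E] [BorelSpace E] [SecondCountableTopology E] {ν : Measure ℝ} [SFinite ν]
    {h : ℝ → E} (hh : Measurable h) (c : ℝ) : Measurable fun x => ∫ t in Ico c x, h t ∂ν := by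
  have hT : MeasurableSet {z : ℝ × ℝ | c ≤ z.2 ∧ z.2 < z.1} :=
    (measurableSet_le measurable_const measurable_snd).inter
      (measurableSet_lt measurable_snd measurable_fst)
  have h1 := ((hh.comp measurable_snd).indicator hT).stronglyMeasurable.integral_prod_right'
    (ν := ν)
  convert h1.measurable using 2 with x
  rw [← integral_indicator measurableSet_Ico]
  rfl

/-- The Picard iterates of a Volterra equation. -/
noncomputable def picard (ν : Measure ℝ) (K : ℝ → Matrix (Fin n) (Fin n) ℂ) (g : ℝ → Fin n → ℂ)
    (c : ℝ) : ℕ → ℝ → Fin n → ℂ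
  | 0 => g
  | k + 1 => fun x => ∫ t in Ico c x, (K t).mulVec (picard ν K g c k t) ∂ν

theorem picard_measurable {ν : Measure ℝ} [SFinite ν] {K : ℝ → Matrix (Fin n) (Fin n) ℂ}
    {g : ℝ → Fin n → ℂ} (hK : ∀ i j, Measurable fun t => K t i j) (hg : Measurable g) (c : ℝ)
    (k : ℕ) : Measurable (picard ν K g c k) := by
  induction k with
  | zero => exact hg
  | succ k ih =>
    refine measurable_setIntegral_Ico (measurable_pi_iff.2 fun i => ?_) c
    simp only [Matrix.mulVec, dotProduct]
    exact Finset.measurable_fun_sum _ fun j _ => (hK i j).mul (measurable_pi_iff.1 ih j)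

/-- Each iteration integrates the bound C m^k/k! against the size of the kernel, and
`setIntegral_mul_pow_le` supplies the next factorial although m may jump. -/
theorem norm_picard_le {ν : Measure ℝ} [SFinite ν] {K : ℝ → Matrix (Fin n) (Fin n) ℂ}
    {g : ℝ → Fin n → ℂ} {c d C : ℝ} (hg : ∀ t ∈ Icc c d, ‖g t‖ ≤ C)
    (hK : ∀ i j, IntegrableOn (fun t => K t i j) (Ico c d) ν) (k : ℕ) :
    ∀ x ∈ Icc c d, ‖picard ν K g c k x‖
      ≤ C * ((∫ t in Ico c x, ∑ i, ∑ j, ‖K t i j‖ ∂ν) ^ k / k.factorial) := by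
  have hk : IntegrableOn (fun t => ∑ i, ∑ j, ‖K t i j‖) (Ico c d) ν :=
    integrable_finsetSum _ fun i _ => integrable_finsetSum _ fun j _ => (hK i j).norm
  have hk0 : ∀ t, 0 ≤ ∑ i, ∑ j, ‖K t i j‖ := fun t => by positivity
  induction k with
  | zero => intro x hx; simpa [picard] using hg x hx
  | succ k ih =>
    intro x hx
    have hC : 0 ≤ C := (norm_nonneg _).trans (hg x hx)
    obtain ⟨h1, h2⟩ := setIntegral_mul_pow_le hx.1 (hk.mono_set (Ico_subset_Ico_right hx.2)) hk0 k
    have h3 := h1.const_mul (C / k.factorial)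
    calc ‖picard ν K g c (k + 1) x‖
        ≤ ∫ t in Ico c x, C / k.factorial * ((∑ i, ∑ j, ‖K t i j‖)
            * (∫ s in Ico c t, ∑ i, ∑ j, ‖K s i j‖ ∂ν) ^ k) ∂ν := by
          refine norm_integral_le_of_norm_le h3 (ae_restrict_of_forall_mem measurableSet_Ico ?_)
          intro t ht
          refine (norm_mulVec_le _ _).trans ?_
          calc _ ≤ (∑ i, ∑ j, ‖K t i j‖)
                * (C * ((∫ s in Ico c t, ∑ i, ∑ j, ‖K s i j‖ ∂ν) ^ k / k.factorial)) := by
                gcongr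
                exact ih t ⟨ht.1, ht.2.le.trans hx.2⟩
            _ = _ := by ring
      _ ≤ C / k.factorial * ((∫ s in Ico c x, ∑ i, ∑ j, ‖K s i j‖ ∂ν) ^ (k + 1) / (k + 1)) := by
          rw [integral_const_mul]
          gcongr
      _ = _ := by
          rw [Nat.factorial_succ]
          push_cast
          field_simp

/-- The solution is the sum of the Picard iterates, dominated by an exponential series. The formula
does not involve `d`, so one function `y` serves every `d` for which the data are integrable and
bounded. -/
theorem exists_volterra (ν : Measure ℝ) [SFinite ν] {K : ℝ → Matrix (Fin n) (Fin n) ℂ}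
    {g : ℝ → Fin n → ℂ} (hK : ∀ i j, Measurable fun t => K t i j) (hg : Measurable g) (c : ℝ) :
    ∃ y : ℝ → Fin n → ℂ, ∀ d, c ≤ d → (∀ i j, IntegrableOn (fun t => K t i j) (Ico c d) ν) →
      (∃ C, ∀ t ∈ Icc c d, ‖g t‖ ≤ C) →
      AEStronglyMeasurable y (ν.restrict (Ico c d)) ∧ (∃ C, ∀ t ∈ Icc c d, ‖y t‖ ≤ C) ∧
      y d = g d + ∫ t in Ico c d, (K t).mulVec (y t) ∂ν := by
  set Y := picard ν K g c with hY
  refine ⟨fun x => ∑' k, Y k x, fun d hcd hKd ⟨C, hC⟩ => ?_⟩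
  have hk : IntegrableOn (fun t => ∑ i, ∑ j, ‖K t i j‖) (Ico c d) ν :=
    integrable_finsetSum _ fun i _ => integrable_finsetSum _ fun j _ => (hKd i j).norm
  have hk0 : ∀ t, 0 ≤ ∑ i, ∑ j, ‖K t i j‖ := fun t => by positivity
  have hC0 : 0 ≤ C := (norm_nonneg _).trans (hC d ⟨hcd, le_rfl⟩)
  set m := ∫ t in Ico c d, ∑ i, ∑ j, ‖K t i j‖ ∂ν
  have hb : ∀ k, ∀ x ∈ Icc c d, ‖Y k x‖ ≤ C * (m ^ k / k.factorial) := by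
    intro k x hx
    refine (norm_picard_le hC hKd k x hx).trans ?_
    gcongr
    exact setIntegral_mono_set hk (Eventually.of_forall hk0)
      (Ico_subset_Ico_right hx.2).eventuallyLE
  have hsum : Summable fun k : ℕ => C * (m ^ k / k.factorial) :=
    (Real.summable_pow_div_factorial m).mul_left C
  have hs : ∀ x ∈ Icc c d, Summable fun k => Y k x := fun x hx =>
    Summable.of_norm_bounded hsum fun k => hb k x hx
  have hmeas : ∀ k, Measurable (Y k) := picard_measurable hK hg c
  have hi : ∀ k, IntegrableOn (fun t => (K t).mulVec (Y k t)) (Ico c d) ν := fun k =>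
    integrable_mulVec hKd (hmeas k).aestronglyMeasurable
      (ae_restrict_of_forall_mem measurableSet_Ico fun t ht => hb k t (Ico_subset_Icc_self ht))
  refine ⟨?_, ⟨∑' k : ℕ, C * (m ^ k / k.factorial), fun t ht =>
    tsum_of_norm_bounded hsum.hasSum fun k => hb k t ht⟩, ?_⟩
  · refine aestronglyMeasurable_of_tendsto_ae atTop (f := fun N t => ∑ k ∈ Finset.range N, Y k t)
      (fun N => ?_) (ae_restrict_of_forall_mem measurableSet_Ico fun t ht =>
        (hs t (Ico_subset_Icc_self ht)).hasSum.tendsto_sum_nat)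
    exact (Finset.measurable_fun_sum _ fun k _ => hmeas k).aestronglyMeasurable
  · have hI := hasSum_integral_of_summable_integral_norm hi ?_
    · have h0 := (hs d ⟨hcd, le_rfl⟩).tsum_eq_zero_add
      beta_reduce
      rw [h0]
      congr 1
      change ∑' k, ∫ t in Ico c d, (K t).mulVec (Y k t) ∂ν = _
      rw [hI.tsum_eq]
      refine setIntegral_congr_fun measurableSet_Ico fun t ht => ?_
      exact ((hs t (Ico_subset_Icc_self ht)).hasSum.mapL
        (Matrix.mulVecLin (K t)).toContinuousLinearMap).tsum_eq
    · have h2 : Summable fun k : ℕ => C * (m ^ k / k.factorial) * m := hsum.mul_right m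
      refine Summable.of_nonneg_of_le (fun k => integral_nonneg fun t => norm_nonneg _)
        (fun k => ?_) h2
      rw [← integral_const_mul]
      refine setIntegral_mono_on (hi k).norm (hk.const_mul _) measurableSet_Ico fun t ht => ?_
      refine (norm_mulVec_le _ _).trans ?_
      rw [mul_comm]
      gcongr
      exact hb k t (Ico_subset_Icc_self ht)

end Volterra

/-! ### The initial value problem to the right of a point. -/

section InitialValue

variable {n : ℕ}

/-- The measure |h| ρ is finite, so only finitely many points carry mass at least ε. -/
theorem tendsto_cofinite_integral_singleton {ρ : Measure ℝ} {h : ℝ → ℂ} (hh : Integrable h ρ) :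
    Tendsto (fun t => (ρ.real {t} : ℂ) * h t) cofinite (𝓝 0) := by
  rw [Metric.tendsto_nhds]
  intro ε hε
  have hfin : (ρ.withDensity fun t => ‖h t‖ₑ) (⋃ t : ℝ, {t}) ≠ ⊤ := by
    rw [iUnion_of_singleton, withDensity_apply _ MeasurableSet.univ, Measure.restrict_univ]
    exact hh.2.ne
  have := Measure.finite_const_le_meas_of_disjoint_iUnion (ρ.withDensity fun t => ‖h t‖ₑ)
    (ENNReal.ofReal_pos.2 hε) (As := fun t : ℝ => {t}) (fun t => measurableSet_singleton t)
    (fun s t hst => by simpa using hst) hfin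
  refine this.subset fun t ht => ?_
  simp only [dist_zero_right, mem_compl_iff, mem_ofPred_eq, not_lt] at ht ⊢
  rw [withDensity_apply _ (measurableSet_singleton t)]
  refine le_trans ?_ (enorm_integral_le_lintegral_enorm _)
  rw [integral_singleton, Complex.real_smul, ← ofReal_norm]
  exact ENNReal.ofReal_le_ofReal ht

/-- The inverse of `2J + Δ` at the point `t`, where `Δ` is the mass of `A ν` at `t`. -/
noncomputable def jumpInv (ν : Measure ℝ) (J : Matrix (Fin n) (Fin n) ℂ)
    (A : ℝ → Matrix (Fin n) (Fin n) ℂ) (t : ℝ) : Matrix (Fin n) (Fin n) ℂ :=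
  ((2 : ℂ) • J + (ν.real {t} : ℂ) • A t)⁻¹

/-- The jumps tend to 0 along the cofinite filter and inversion is continuous at 2J. So the inverses
are bounded off a finite set, and a finite set adds finitely many values. -/
theorem jumpInv_bounded {ν : Measure ℝ} {J : Matrix (Fin n) (Fin n) ℂ} (hJ : IsUnit J)
    {A : ℝ → Matrix (Fin n) (Fin n) ℂ} {s : Set ℝ}
    (hA : ∀ i j, IntegrableOn (fun t => A t i j) s ν) :
    ∃ C, ∀ t ∈ s, ∀ i j, ‖jumpInv ν J A t i j‖ ≤ C := by
  have h2J : IsUnit ((2 : ℂ) • J) := by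
    have : IsUnit (Units.mk0 (2 : ℂ) two_ne_zero • J) := (isUnit_smul_iff _ J).2 hJ
    simpa [Units.smul_def] using this
  have h1 : Tendsto (fun t => (2 : ℂ) • J + ((ν.restrict s).real {t} : ℂ) • A t) cofinite
      (𝓝 ((2 : ℂ) • J)) := by
    conv => rhs; rw [← add_zero ((2 : ℂ) • J)]
    refine tendsto_const_nhds.add (tendsto_pi_nhds.2 fun i => tendsto_pi_nhds.2 fun j => ?_)
    exact tendsto_cofinite_integral_singleton (hA i j)
  have h2 := (continuousAt_matrix_inv _ (Ring.inverse_eq_inv' (G₀ := ℂ) ▸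
    continuousAt_inv₀ ((Matrix.isUnit_iff_isUnit_det _).1 h2J).ne_zero)).tendsto.comp h1
  have h3 : ∀ i j, ∃ C, ∀ t ∈ s, ‖jumpInv ν J A t i j‖ ≤ C := by
    intro i j
    have h4 := ((tendsto_pi_nhds.1 (tendsto_pi_nhds.1 h2 i) j).norm).eventually
      (eventually_le_nhds (lt_add_one _))
    have hfin := (Filter.eventually_cofinite.1 h4)
    obtain ⟨C, hC⟩ := (hfin.image fun t => ‖jumpInv ν J A t i j‖).bddAbove
    refine ⟨max C (‖((2 : ℂ) • J)⁻¹ i j‖ + 1), fun t ht => ?_⟩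
    by_cases h : ‖((2 : ℂ) • J + ((ν.restrict s).real {t} : ℂ) • A t)⁻¹ i j‖
        ≤ ‖((2 : ℂ) • J)⁻¹ i j‖ + 1
    · refine le_max_of_le_right ?_
      have hr : (ν.restrict s).real {t} = ν.real {t} := by
        rw [measureReal_restrict_apply (measurableSet_singleton t),
          inter_eq_left.2 (singleton_subset_iff.2 ht)]
      rwa [hr] at h
    · exact le_max_of_le_left (hC ⟨t, h, rfl⟩)
  choose C hC using h3
  refine ⟨∑ i, ∑ j, |C i j|, fun t ht i j => (hC i j t ht).trans ((le_abs_self _).trans ?_)⟩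
  refine le_trans ?_ (Finset.single_le_sum (f := fun i => ∑ j, |C i j|)
    (fun i _ => Finset.sum_nonneg fun j _ => abs_nonneg _) (Finset.mem_univ i))
  exact Finset.single_le_sum (f := fun j => |C i j|) (fun j _ => abs_nonneg _) (Finset.mem_univ j)

theorem countable_setOf_measure_singleton_ne_zero (ν : Measure ℝ) [SFinite ν] :
    {t : ℝ | ν {t} ≠ 0}.Countable := by
  simpa [pos_iff_ne_zero] using
    Measure.countable_meas_level_set_pos (μ := ν) (g := (id : ℝ → ℝ)) measurable_id

/-- Off the countable set of atoms the inverse is the constant (2J)⁻¹. -/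
theorem jumpInv_measurable {ν : Measure ℝ} [SFinite ν] (J : Matrix (Fin n) (Fin n) ℂ)
    (A : ℝ → Matrix (Fin n) (Fin n) ℂ) (i j : Fin n) :
    Measurable fun t => jumpInv ν J A t i j := by
  have h : {t | ((2 : ℂ) • J)⁻¹ i j ≠ jumpInv ν J A t i j}.Countable := by
    refine (countable_setOf_measure_singleton_ne_zero ν).mono ?_
    intro t ht h0
    exact ht (by simp [jumpInv, Measure.real, h0])
  exact measurable_const.measurable_of_countable_ne h

theorem integrable_matrix_mul {ν : Measure ℝ} {A R : ℝ → Matrix (Fin n) (Fin n) ℂ} {C : ℝ}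
    (hA : ∀ i j, Integrable (fun t => A t i j) ν)
    (hR : ∀ i j, AEStronglyMeasurable (fun t => R t i j) ν)
    (hC : ∀ᵐ t ∂ν, ∀ i j, ‖R t i j‖ ≤ C) (i j : Fin n) :
    Integrable (fun t => (A t * R t) i j) ν := by
  simp only [Matrix.mul_apply]
  refine integrable_finsetSum _ fun k _ => (hA i k).mul_bdd (c := C) (hR k j) ?_
  filter_upwards [hC] with t ht using ht k j

theorem mulVec_integral {ν : Measure ℝ} (M : Matrix (Fin n) (Fin n) ℂ) {h : ℝ → Fin n → ℂ}
    (hh : Integrable h ν) : M.mulVec (∫ t, h t ∂ν) = ∫ t, M.mulVec (h t) ∂ν :=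
  ((Matrix.mulVecLin M).toContinuousLinearMap.integral_comp_comm hh).symm

theorem integrable_const_mulVec {ν : Measure ℝ} (M : Matrix (Fin n) (Fin n) ℂ)
    {h : ℝ → Fin n → ℂ} (hh : Integrable h ν) : Integrable (fun t => M.mulVec (h t)) ν :=
  (Matrix.mulVecLin M).toContinuousLinearMap.integrable_comp hh

/-- Here `y` plays the left-hand limit of `u`. Solving the balance condition gives u = R(2J y + ν{t}
F) with R = (2J + ν{t} A)⁻¹; inserted into F - A u, this leaves 2J R F - A R (2J) y, so `y`
satisfies a Volterra equation whose kernel is integrable because R is bounded. -/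
theorem exists_solution_right (ν : Measure ℝ) [SFinite ν] {J : Matrix (Fin n) (Fin n) ℂ}
    (hJ : IsUnit J) {A : ℝ → Matrix (Fin n) (Fin n) ℂ} {F : ℝ → Fin n → ℂ}
    (hA : ∀ i j, Measurable fun t => A t i j) (hF : Measurable F) (c : ℝ) (y₀ : Fin n → ℂ) :
    ∃ u y : ℝ → Fin n → ℂ, ∀ d, c ≤ d → (∀ i j, IntegrableOn (fun t => A t i j) (Icc c d) ν) →
      IntegrableOn F (Icc c d) ν →
      (∀ t ∈ Icc c d, IsUnit ((2 : ℂ) • J + (ν.real {t} : ℂ) • A t)) →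
      IntegrableOn (fun t => (A t).mulVec (u t)) (Ico c d) ν ∧
      J.mulVec (y d - y₀) = ∫ t in Ico c d, (F t - (A t).mulVec (u t)) ∂ν ∧
      (2 : ℂ) • J.mulVec (u d) + (ν.real {d} : ℂ) • (A d).mulVec (u d)
        = (2 : ℂ) • J.mulVec (y d) + (ν.real {d} : ℂ) • F d := by
  have hJdet : IsUnit J.det := (Matrix.isUnit_iff_isUnit_det J).1 hJ
  set R := jumpInv ν J A with hR
  have hRm : ∀ i j, Measurable fun t => R t i j := jumpInv_measurable J A
  have hRF : Measurable fun t => ((2 : ℂ) • (J * R t)).mulVec (F t) := by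
    refine measurable_pi_iff.2 fun i => ?_
    simp only [Matrix.mulVec, dotProduct, Matrix.smul_apply, Matrix.mul_apply, smul_eq_mul]
    exact Finset.measurable_fun_sum _ fun j _ => ((Finset.measurable_fun_sum _ fun k _ =>
      (hRm k j).const_mul _).const_mul _).mul (measurable_pi_iff.1 hF j)
  obtain ⟨y, hy⟩ := exists_volterra ν (K := fun t => -(J⁻¹ * (A t * R t * ((2 : ℂ) • J))))
    (g := fun x => y₀ + J⁻¹.mulVec (∫ t in Ico c x, ((2 : ℂ) • (J * R t)).mulVec (F t) ∂ν)) (by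
      intro i j
      simp only [Matrix.neg_apply, Matrix.mul_apply]
      refine (Finset.measurable_fun_sum _ fun k _ => (Finset.measurable_fun_sum _ fun l _ =>
        (Finset.measurable_fun_sum _ fun m _ => ?_).mul_const _).const_mul _).neg
      exact (hA _ _).mul (hRm _ _))
    (measurable_const.add ((Matrix.mulVecLin J⁻¹).toContinuousLinearMap.measurable.comp
      (measurable_setIntegral_Ico hRF c))) c
  refine ⟨fun t => (R t).mulVec ((2 : ℂ) • J.mulVec (y t) + (ν.real {t} : ℂ) • F t), y,
    fun d hcd hAd hFd hunit => ?_⟩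
  have hRinv : ∀ t ∈ Icc c d, ((2 : ℂ) • J + (ν.real {t} : ℂ) • A t) * R t = 1 := fun t ht =>
    Matrix.mul_nonsing_inv _ ((Matrix.isUnit_iff_isUnit_det _).1 (hunit t ht))
  obtain ⟨C, hC⟩ := jumpInv_bounded hJ (fun i j => hAd i j)
  have hAd' : ∀ i j, IntegrableOn (fun t => A t i j) (Ico c d) ν := fun i j =>
    (hAd i j).mono_set Ico_subset_Icc_self
  have hFd' := hFd.mono_set (Ico_subset_Icc_self : Ico c d ⊆ Icc c d)
  have hCae : ∀ᵐ t ∂ν.restrict (Ico c d), ∀ i j, ‖R t i j‖ ≤ C :=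
    ae_restrict_of_forall_mem measurableSet_Ico fun t ht => hC t (Ico_subset_Icc_self ht)
  have hAR := integrable_matrix_mul hAd' (fun i j => (hRm i j).aestronglyMeasurable) hCae
  have hK : ∀ i j, IntegrableOn (fun t => (-(J⁻¹ * (A t * R t * ((2 : ℂ) • J)))) i j)
      (Ico c d) ν := by
    intro i j
    change Integrable (fun t => -∑ k, J⁻¹ i k * ∑ l, (A t * R t) k l * ((2 : ℂ) • J) l j) _
    exact (integrable_finsetSum _ fun k _ => (integrable_finsetSum _ fun l _ =>
      (hAR k l).mul_const _).const_mul _).neg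
  have hRFi : IntegrableOn (fun t => (R t).mulVec (F t)) (Ico c d) ν :=
    integrable_mulVec' (fun i j => (hRm i j).aestronglyMeasurable) hCae hFd'
  have hRFi2 : IntegrableOn (fun t => ((2 : ℂ) • (J * R t)).mulVec (F t)) (Ico c d) ν := by
    simp only [Matrix.smul_mulVec, ← Matrix.mulVec_mulVec]
    exact (integrable_const_mulVec J hRFi).smul (2 : ℂ)
  obtain ⟨hym, ⟨Cy, hCy⟩, hyd⟩ := hy d hcd hK ⟨‖y₀‖ + (∑ i, ∑ j, ‖J⁻¹ i j‖)
      * ∫ t in Ico c d, ‖((2 : ℂ) • (J * R t)).mulVec (F t)‖ ∂ν, fun t ht => by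
    refine (norm_add_le _ _).trans ?_
    refine add_le_add le_rfl ((norm_mulVec_le _ _).trans ?_)
    refine mul_le_mul_of_nonneg_left ((norm_integral_le_integral_norm _).trans ?_) (by positivity)
    exact setIntegral_mono_set hRFi2.norm (Eventually.of_forall fun t => norm_nonneg _)
      (Ico_subset_Ico_right ht.2).eventuallyLE⟩
  have hKy : IntegrableOn (fun t => (A t * R t).mulVec ((2 : ℂ) • J.mulVec (y t)))
      (Ico c d) ν := by
    have hm : AEStronglyMeasurable (fun t => (2 : ℂ) • J.mulVec (y t)) (ν.restrict (Ico c d)) :=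
      ((2 : ℂ) • Matrix.mulVecLin J).toContinuousLinearMap.continuous.comp_aestronglyMeasurable hym
    refine integrable_mulVec (C := ‖(2 : ℂ)‖ * ((∑ i, ∑ j, ‖J i j‖) * Cy)) hAR
      hm (ae_restrict_of_forall_mem measurableSet_Ico fun t ht => ?_)
    rw [norm_smul]
    gcongr
    refine (norm_mulVec_le _ _).trans ?_
    gcongr
    exact hCy t (Ico_subset_Icc_self ht)
  -- The relation (2J + ν{t} A) R = 1 turns ν{t} A R F into F - 2J R F, which is integrable because
  -- R is bounded.
  have hpt : ∀ t ∈ Icc c d, (A t).mulVec ((R t).mulVec ((2 : ℂ) • J.mulVec (y t)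
      + (ν.real {t} : ℂ) • F t)) = (A t * R t).mulVec ((2 : ℂ) • J.mulVec (y t))
        + (F t - ((2 : ℂ) • (J * R t)).mulVec (F t)) := by
    intro t ht
    have h1 := congrArg (fun M => Matrix.mulVec M (F t)) (hRinv t ht)
    simp only [add_mul, Matrix.add_mulVec, Matrix.one_mulVec, Matrix.smul_mul] at h1
    rw [sub_eq_of_eq_add' h1.symm, Matrix.mulVec_mulVec, Matrix.mulVec_add,
      Matrix.mulVec_smul _ (ν.real {t} : ℂ), Matrix.smul_mulVec (ν.real {t} : ℂ)]
  refine ⟨?_, ?_, ?_⟩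
  · exact (hKy.add (hFd'.sub hRFi2)).congr (ae_restrict_of_forall_mem measurableSet_Ico
      fun t ht => (hpt t (Ico_subset_Icc_self ht)).symm)
  · have hKe : ∀ t, (-(J⁻¹ * (A t * R t * ((2 : ℂ) • J)))).mulVec (y t)
        = -(J⁻¹.mulVec ((A t * R t).mulVec ((2 : ℂ) • J.mulVec (y t)))) := by
      intro t
      simp only [Matrix.neg_mulVec, Matrix.mulVec_mulVec, Matrix.mulVec_smul, Matrix.mul_smul,
        Matrix.smul_mulVec, Matrix.mul_assoc]
    simp only [hKe] at hyd
    rw [integral_neg, ← mulVec_integral _ hKy] at hyd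
    have hJJ : ∀ v, J.mulVec (J⁻¹.mulVec v) = v := fun v => by
      rw [Matrix.mulVec_mulVec, Matrix.mul_nonsing_inv _ hJdet, Matrix.one_mulVec]
    rw [hyd, add_assoc, add_sub_cancel_left, Matrix.mulVec_add, Matrix.mulVec_neg, hJJ, hJJ,
      ← sub_eq_add_neg, ← integral_sub hRFi2 hKy]
    refine setIntegral_congr_fun measurableSet_Ico fun t ht => ?_
    simp only [hpt t (Ico_subset_Icc_self ht)]
    abel
  · have h1 := congrArg (fun M => Matrix.mulVec M ((2 : ℂ) • J.mulVec (y d)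
      + (ν.real {d} : ℂ) • F d)) (hRinv d ⟨hcd, le_rfl⟩)
    simpa only [← Matrix.mulVec_mulVec, Matrix.add_mulVec, Matrix.one_mulVec,
      Matrix.smul_mulVec] using h1

end InitialValue

/-! ### Splitting of integrals, and reflection of the half-line to the left of a point. -/

theorem setIntegral_Ico_add_Ico {E : Type*} [NormedAddCommGroup E] [NormedSpace ℝ E]
    {ν : Measure ℝ} {h : ℝ → E} {r s t : ℝ} (hrs : r ≤ s) (hst : s ≤ t)
    (hh : IntegrableOn h (Icc r t) ν) :
    (∫ x in Ico r s, h x ∂ν) + ∫ x in Ico s t, h x ∂ν = ∫ x in Ico r t, h x ∂ν := by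
  rw [← Ico_union_Ico_eq_Ico hrs hst, setIntegral_union
    (disjoint_left.2 fun x hx hx' => hx'.1.not_gt hx.2) measurableSet_Ico
    (hh.mono_set fun x hx => ⟨hx.1, hx.2.le.trans hst⟩)
    (hh.mono_set fun x hx => ⟨hrs.trans hx.1, hx.2.le⟩)]

/-- The reflection of the part of `ν` to the left of `c`. -/
noncomputable def reflectLeft (ν : Measure ℝ) (c : ℝ) : Measure ℝ :=
  (ν.restrict (Iio c)).map (MeasurableEquiv.neg ℝ)

instance (ν : Measure ℝ) [SFinite ν] (c : ℝ) : SFinite (reflectLeft ν c) := by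
  unfold reflectLeft; infer_instance

theorem neg_preimage_Ico_inter_Iio (c x : ℝ) :
    MeasurableEquiv.neg ℝ ⁻¹' Ico (-c) (-x) ∩ Iio c = Ioo x c := by
  ext t
  change (-c ≤ -t ∧ -t < -x) ∧ t < c ↔ x < t ∧ t < c
  exact ⟨fun h => ⟨neg_lt_neg_iff.1 h.1.2, h.2⟩,
    fun h => ⟨⟨neg_le_neg h.2.le, neg_lt_neg h.1⟩, h.2⟩⟩

theorem neg_preimage_Icc_inter_Iio (c x : ℝ) :
    MeasurableEquiv.neg ℝ ⁻¹' Icc (-c) (-x) ∩ Iio c = Ico x c := by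
  ext t
  change (-c ≤ -t ∧ -t ≤ -x) ∧ t < c ↔ x ≤ t ∧ t < c
  exact ⟨fun h => ⟨neg_le_neg_iff.1 h.1.2, h.2⟩,
    fun h => ⟨⟨neg_le_neg h.2.le, neg_le_neg h.1⟩, h.2⟩⟩

/-- Reflection moves the open end of the interval to `x`, and the restriction to `Iio c` removes the
atom at `c`. The open interval that remains is the one between the right-hand limit at `x` and the
left-hand limit at `c`. -/
theorem setIntegral_reflectLeft {E : Type*} [NormedAddCommGroup E] [NormedSpace ℝ E]
    (ν : Measure ℝ) (c x : ℝ) (h : ℝ → E) :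
    ∫ t in Ico (-c) (-x), h t ∂reflectLeft ν c = ∫ t in Ioo x c, h (-t) ∂ν := by
  rw [reflectLeft, (MeasurableEquiv.neg ℝ).measurableEmbedding.setIntegral_map,
    Measure.restrict_restrict ((MeasurableEquiv.neg ℝ).measurable measurableSet_Ico)]
  congr 2
  exact neg_preimage_Ico_inter_Iio c x

theorem integrableOn_Icc_reflectLeft {E : Type*} [NormedAddCommGroup E]
    (ν : Measure ℝ) (c x : ℝ) (h : ℝ → E) :
    IntegrableOn h (Icc (-c) (-x)) (reflectLeft ν c) ↔
      IntegrableOn (fun t => h (-t)) (Ico x c) ν := by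
  rw [reflectLeft, (MeasurableEquiv.neg ℝ).measurableEmbedding.integrableOn_map_iff,
    IntegrableOn, Measure.restrict_restrict ((MeasurableEquiv.neg ℝ).measurable measurableSet_Icc)]
  refine iff_of_eq ?_
  unfold IntegrableOn
  congr 2
  exact neg_preimage_Icc_inter_Iio c x

theorem integrableOn_Ico_reflectLeft {E : Type*} [NormedAddCommGroup E]
    (ν : Measure ℝ) (c x : ℝ) (h : ℝ → E) :
    IntegrableOn h (Ico (-c) (-x)) (reflectLeft ν c) ↔
      IntegrableOn (fun t => h (-t)) (Ioo x c) ν := by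
  rw [reflectLeft, (MeasurableEquiv.neg ℝ).measurableEmbedding.integrableOn_map_iff,
    IntegrableOn, Measure.restrict_restrict ((MeasurableEquiv.neg ℝ).measurable measurableSet_Ico)]
  refine iff_of_eq ?_
  unfold IntegrableOn
  congr 2
  exact neg_preimage_Ico_inter_Iio c x

theorem reflectLeft_real_singleton (ν : Measure ℝ) (c t : ℝ) :
    (reflectLeft ν c).real {t} = if -t < c then ν.real {-t} else 0 := by
  rw [reflectLeft, Measure.real, MeasurableEquiv.map_apply,
    Measure.restrict_apply ((MeasurableEquiv.neg ℝ).measurable (measurableSet_singleton t))]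
  have : (MeasurableEquiv.neg ℝ) ⁻¹' {t} = {-t} := by ext s; simp
  rw [this]
  split_ifs with h
  · rw [inter_eq_left.2 (singleton_subset_iff.2 (mem_Iio.2 h))]; rfl
  · rw [singleton_inter_eq_empty.2 (notMem_Iio.2 (not_lt.1 h))]; simp

/-! ### The integrated equation and its initial value problem on (a, b). -/

namespace DistSystem

variable {a b : EReal} {n : ℕ}

/-- The coefficient `q = A ν` of the system and the assumptions imposed on it. -/
structure IsCoefficient (a b : EReal) (ν : Measure ℝ) (J : Matrix (Fin n) (Fin n) ℂ)
    (A : ℝ → Matrix (Fin n) (Fin n) ℂ) : Prop where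
  isUnit : IsUnit J
  skew : J.conjTranspose = -J
  finite : ∀ c ∈ openInterval a b, ∀ d ∈ openInterval a b, ν (Icc c d) < ⊤
  measurable : ∀ i j, Measurable fun t => A t i j
  integrableOn : ∀ c ∈ openInterval a b, ∀ d ∈ openInterval a b, ∀ i j,
    IntegrableOn (fun t => A t i j) (Icc c d) ν
  hermitian : ∀ᵐ t ∂ν, (A t).conjTranspose = A t
  isUnit_add : ∀ x ∈ openInterval a b, IsUnit ((2 : ℂ) • J + (ν.real {x} : ℂ) • A x)
  isUnit_sub : ∀ x ∈ openInterval a b, IsUnit ((2 : ℂ) • J - (ν.real {x} : ℂ) • A x)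

/-- The integrated form of `J u' + A u ν = F ν` on `(a, b)`; the function `y` consists of the
left-hand limits of `u`. -/
structure IsIntegralSolution (a b : EReal) (ν : Measure ℝ) (J : Matrix (Fin n) (Fin n) ℂ)
    (A : ℝ → Matrix (Fin n) (Fin n) ℂ) (F u y : ℝ → Fin n → ℂ) : Prop where
  integrableOn : ∀ c ∈ openInterval a b, ∀ d ∈ openInterval a b, IntegrableOn F (Icc c d) ν
  integrableOn_mulVec : ∀ c ∈ openInterval a b, ∀ d ∈ openInterval a b,
    IntegrableOn (fun t => (A t).mulVec (u t)) (Icc c d) ν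
  eq : ∀ c ∈ openInterval a b, ∀ d ∈ openInterval a b, c ≤ d →
    J.mulVec (y d - y c) = ∫ t in Ico c d, (F t - (A t).mulVec (u t)) ∂ν
  balanced : ∀ x ∈ openInterval a b,
    J.mulVec (u x) = J.mulVec (y x) + (ν.real {x} / 2 : ℂ) • (F x - (A x).mulVec (u x))

variable {ν : Measure ℝ} {J : Matrix (Fin n) (Fin n) ℂ} {A : ℝ → Matrix (Fin n) (Fin n) ℂ}

/-- The balance condition is pointwise, but an almost everywhere equality is an equality at atoms,
and elsewhere `F` enters with the factor 0. -/
theorem IsIntegralSolution.congr {F G u y : ℝ → Fin n → ℂ}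
    (h : IsIntegralSolution a b ν J A F u y)
    (hFG : F =ᵐ[ν.restrict (openInterval a b)] G) :
    IsIntegralSolution a b ν J A G u y := by
  have hsub : ∀ c ∈ openInterval a b, ∀ d ∈ openInterval a b, F =ᵐ[ν.restrict (Icc c d)] G :=
    fun c hc d hd => ae_restrict_of_ae_restrict_of_subset (Icc_subset_openInterval hc hd) hFG
  refine ⟨fun c hc d hd => (h.integrableOn c hc d hd).congr (hsub c hc d hd),
    h.integrableOn_mulVec, fun c hc d hd hcd => ?_, fun x hx => ?_⟩
  · rw [h.eq c hc d hd hcd]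
    refine integral_congr_ae ?_
    filter_upwards [ae_restrict_of_ae_restrict_of_subset Ico_subset_Icc_self (hsub c hc d hd)]
      with t ht
    rw [ht]
  · rw [h.balanced x hx]
    by_cases h0 : ν {x} = 0
    · simp [Measure.real, h0]
    · have : F x = G x := by
        by_contra hne
        refine h0 (measure_mono_null (singleton_subset_iff.2 ?_)
          ((ae_restrict_iff' (openInterval a b).isOpen.measurableSet).1 hFG))
        exact fun hh => hne (hh hx)
      rw [this]

/-- To the right of `c` this is `exists_solution_right`. The substitution t ↦ -t reduces the left
side to the same result with -J for J, and there 2(-J) + Δ = -(2J - Δ); so the two sides use the two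
invertibility assumptions. -/
theorem exists_isIntegralSolution_of_measurable [SFinite ν] (hA : IsCoefficient a b ν J A)
    {F : ℝ → Fin n → ℂ} (hF : Measurable F)
    (hFi : ∀ c ∈ openInterval a b, ∀ d ∈ openInterval a b, IntegrableOn F (Icc c d) ν)
    {c : ℝ} (hc : c ∈ openInterval a b) (y₀ : Fin n → ℂ) :
    ∃ u y : ℝ → Fin n → ℂ, IsIntegralSolution a b ν J A F u y ∧ y c = y₀ := by
  have hJdet : IsUnit J.det := (Matrix.isUnit_iff_isUnit_det J).1 hA.isUnit
  have hJJ : ∀ v, J.mulVec (J⁻¹.mulVec v) = v := fun v => by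
    rw [Matrix.mulVec_mulVec, Matrix.mul_nonsing_inv _ hJdet, Matrix.one_mulVec]
  have hJinj : ∀ v w, J.mulVec v = J.mulVec w → v = w := fun v w h => by
    have := congrArg J⁻¹.mulVec h
    simpa [Matrix.mulVec_mulVec, Matrix.nonsing_inv_mul _ hJdet] using this
  have hsingle : ∀ x ∈ openInterval a b, ∀ h : ℝ → Fin n → ℂ, IntegrableOn h {x} ν := by
    intro x hx h
    rw [integrableOn_singleton_iff]
    have := hA.finite x hx x hx
    rw [Icc_self] at this
    exact Or.inr this
  obtain ⟨u₁, y₁, h₁⟩ := exists_solution_right ν hA.isUnit hA.measurable hF c y₀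
  obtain ⟨u₂, y₂, h₂⟩ := exists_solution_right (reflectLeft ν c) hA.isUnit.neg
    (A := fun t => A (-t)) (F := fun t => F (-t))
    (fun i j => (hA.measurable i j).comp measurable_neg) (hF.comp measurable_neg) (-c) y₀
  have hR : ∀ x ∈ openInterval a b, c ≤ x → _ := fun x hx hcx => h₁ x hcx
    (hA.integrableOn c hc x hx) (hFi c hc x hx)
    (fun t ht => hA.isUnit_add t (Icc_subset_openInterval hc hx ht))
  have hL : ∀ x ∈ openInterval a b, x < c → _ := fun x hx hxc => h₂ (-x) (neg_le_neg hxc.le)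
    (fun i j => (integrableOn_Icc_reflectLeft ν c x fun t => A (-t) i j).2 (by
      simpa using (hA.integrableOn x hx c hc i j).mono_set Ico_subset_Icc_self))
    ((integrableOn_Icc_reflectLeft ν c x fun t => F (-t)).2 (by
      simpa using (hFi x hx c hc).mono_set Ico_subset_Icc_self))
    (fun t ht => by
      rw [reflectLeft_real_singleton]
      split_ifs with htc
      · have h3 := hA.isUnit_sub (-t) (Icc_subset_openInterval hx hc
          ⟨by linarith [ht.2], htc.le⟩)
        simpa [sub_eq_add_neg, add_comm] using h3.neg
      -- Only t = -c is left; its atom has been removed, so the matrix is -2J.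
      · have : IsUnit (Units.mk0 (-2 : ℂ) (by norm_num) • J) := (isUnit_smul_iff _ J).2 hA.isUnit
        simpa [Units.smul_def] using this)
  set u : ℝ → Fin n → ℂ := fun x => if c ≤ x then u₁ x else u₂ (-x) with hu
  -- Left-hand limits in the reflected variable are right-hand limits in the original one, so to the
  -- left of `c` the jump at `x` has to be subtracted.
  set y : ℝ → Fin n → ℂ := fun x => if c ≤ x then y₁ x
    else y₂ (-x) - (ν.real {x} : ℂ) • J⁻¹.mulVec (F x - (A x).mulVec (u x)) with hy
  have hu₁ : ∀ x, c ≤ x → u x = u₁ x := fun x hx => by simp [hu, hx]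
  have hu₂ : ∀ x, x < c → u x = u₂ (-x) := fun x hx => by simp [hu, hx.not_ge]
  have hy₁ : ∀ x, c ≤ x → y x = y₁ x := fun x hx => by simp [hy, hx]
  have hy₂ : ∀ x, x < c → y x
      = y₂ (-x) - (ν.real {x} : ℂ) • J⁻¹.mulVec (F x - (A x).mulVec (u x)) :=
    fun x hx => by simp [hy, hx.not_ge]
  have hyc : y c = y₀ := by
    obtain ⟨-, h, -⟩ := hR c hc le_rfl
    rw [hy₁ c le_rfl]
    refine sub_eq_zero.1 (hJinj _ _ ?_)
    simpa using h
  have iR : ∀ x ∈ openInterval a b, c ≤ x →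
      IntegrableOn (fun t => (A t).mulVec (u t)) (Icc c x) ν := by
    intro x hx hcx
    rw [← Ico_union_right hcx]
    refine IntegrableOn.union ?_ (hsingle x hx _)
    refine (hR x hx hcx).1.congr_fun (fun t ht => ?_) measurableSet_Ico
    simp only [hu₁ t ht.1]
  have iL : ∀ x ∈ openInterval a b, x < c →
      IntegrableOn (fun t => (A t).mulVec (u t)) (Ico x c) ν := by
    intro x hx hxc
    rw [← Ioo_insert_left hxc, insert_eq]
    refine IntegrableOn.union (hsingle x hx _) ?_
    refine ((integrableOn_Ico_reflectLeft ν c x _).1 (hL x hx hxc).1).congr_fun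
      (fun t ht => ?_) measurableSet_Ioo
    simp only [hu₂ t ht.2, neg_neg]
  have iA : ∀ d ∈ openInterval a b, ∀ e ∈ openInterval a b,
      IntegrableOn (fun t => (A t).mulVec (u t)) (Icc d e) ν := by
    intro d hd e he
    have h1 : IntegrableOn (fun t => (A t).mulVec (u t)) (Ico d c) ν := by
      rcases lt_or_ge d c with h | h
      · exact iL d hd h
      · simp [h]
    have h2 : IntegrableOn (fun t => (A t).mulVec (u t)) (Icc c e) ν := by
      rcases le_or_gt c e with h | h
      · exact iR e he h
      · simp [h]
    refine (h1.union h2).mono_set fun t ht => ?_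
    rcases lt_or_ge t c with h | h
    · exact Or.inl ⟨ht.1, h⟩
    · exact Or.inr ⟨h, ht.2⟩
  have iH : ∀ d ∈ openInterval a b, ∀ e ∈ openInterval a b,
      IntegrableOn (fun t => F t - (A t).mulVec (u t)) (Icc d e) ν :=
    fun d hd e he => (hFi d hd e he).sub (iA d hd e he)
  have eR : ∀ x ∈ openInterval a b, c ≤ x →
      J.mulVec (y x - y c) = ∫ t in Ico c x, (F t - (A t).mulVec (u t)) ∂ν := by
    intro x hx hcx
    rw [hyc, hy₁ x hcx, (hR x hx hcx).2.1]
    exact setIntegral_congr_fun measurableSet_Ico fun t ht => by simp only [hu₁ t ht.1]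
  have eL' : ∀ x ∈ openInterval a b, x < c →
      J.mulVec (y₂ (-x) - y c) = -∫ t in Ioo x c, (F t - (A t).mulVec (u t)) ∂ν := by
    intro x hx hxc
    have h := (hL x hx hxc).2.1
    rw [setIntegral_reflectLeft, Matrix.neg_mulVec, neg_eq_iff_eq_neg] at h
    rw [hyc, h, neg_inj]
    exact setIntegral_congr_fun measurableSet_Ioo fun t ht => by simp only [hu₂ t ht.2, neg_neg]
  have eL : ∀ x ∈ openInterval a b, x < c →
      J.mulVec (y x - y c) = -∫ t in Ico x c, (F t - (A t).mulVec (u t)) ∂ν := by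
    intro x hx hxc
    rw [← Ioo_insert_left hxc, insert_eq, setIntegral_union (by simp) measurableSet_Ioo
      (hsingle x hx _) ((iH x hx c hc).mono_set Ioo_subset_Icc_self), integral_singleton,
      neg_add, ← eL' x hx hxc, hy₂ x hxc, sub_right_comm, Matrix.mulVec_sub _ _ (_ • _),
      Matrix.mulVec_smul, hJJ, Complex.coe_smul]
    abel
  refine ⟨u, y, ⟨hFi, iA, fun d hd e he hde => ?_, fun x hx => ?_⟩, hyc⟩
  · have hsplit : y e - y d = (y e - y c) - (y d - y c) := by abel
    rw [hsplit, Matrix.mulVec_sub]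
    rcases lt_or_ge d c with hdc | hdc
    · rw [eL d hd hdc]
      rcases lt_or_ge e c with hec | hec
      · rw [eL e he hec, ← setIntegral_Ico_add_Ico hde hec.le (iH d hd c hc)]
        abel
      · rw [eR e he hec, ← setIntegral_Ico_add_Ico hdc.le hec (iH d hd e he)]
        abel
    · rw [eR d hd hdc, eR e he (hdc.trans hde),
        ← setIntegral_Ico_add_Ico hdc hde (iH c hc e he)]
      abel
  · rcases lt_or_ge x c with hxc | hxc
    · have h := (hL x hx hxc).2.2
      rw [reflectLeft_real_singleton, neg_neg, if_pos hxc, ← hu₂ x hxc] at h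
      have h4 : J.mulVec (y₂ (-x)) = J.mulVec (y x)
          + (ν.real {x} : ℂ) • (F x - (A x).mulVec (u x)) := by
        rw [hy₂ x hxc, Matrix.mulVec_sub, Matrix.mulVec_smul, hJJ]
        abel
      simp only [Matrix.neg_mulVec, h4] at h
      ext i
      have hi := congrFun h i
      simp only [Pi.add_apply, Pi.sub_apply, Pi.neg_apply, Pi.smul_apply, smul_eq_mul] at hi ⊢
      linear_combination (-1 / 2 : ℂ) * hi
    · have h := (hR x hx hxc).2.2
      rw [← hu₁ x hxc, ← hy₁ x hxc] at h
      ext i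
      have hi := congrFun h i
      simp only [Pi.add_apply, Pi.sub_apply, Pi.smul_apply, smul_eq_mul] at hi ⊢
      linear_combination (1 / 2 : ℂ) * hi

theorem exists_isIntegralSolution [SFinite ν] (hA : IsCoefficient a b ν J A)
    {F : ℝ → Fin n → ℂ} (hF : AEStronglyMeasurable F (ν.restrict (openInterval a b)))
    (hFi : ∀ c ∈ openInterval a b, ∀ d ∈ openInterval a b, IntegrableOn F (Icc c d) ν)
    {c : ℝ} (hc : c ∈ openInterval a b) (y₀ : Fin n → ℂ) :
    ∃ u y : ℝ → Fin n → ℂ, IsIntegralSolution a b ν J A F u y ∧ y c = y₀ := by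
  obtain ⟨u, y, h, hy⟩ := exists_isIntegralSolution_of_measurable hA
    (F := hF.mk F) hF.stronglyMeasurable_mk.measurable (fun d hd e he =>
      (hFi d hd e he).congr (ae_restrict_of_ae_restrict_of_subset
        (Icc_subset_openInterval hd he) hF.ae_eq_mk)) hc y₀
  refine ⟨u, y, h.congr hF.ae_eq_mk.symm, hy⟩

end DistSystem

/-! ### One-sided limits and variation of primitives. -/

/-- Dominated convergence for the indicators of `s t`, which are pointwise eventually constant. -/
theorem tendsto_setIntegral_of_eventually_mem_iff {E : Type*} [NormedAddCommGroup E]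
    [NormedSpace ℝ E] {ν : Measure ℝ} {h : ℝ → E} {K s₀ : Set ℝ} {s : ℝ → Set ℝ} {l : Filter ℝ}
    [l.IsCountablyGenerated] (hh : IntegrableOn h K ν) (hK : MeasurableSet K)
    (hs : ∀ t, MeasurableSet (s t))
    (hs₀ : MeasurableSet s₀) (hsK : ∀ᶠ t in l, s t ⊆ K) (hs₀K : s₀ ⊆ K)
    (hl : ∀ x ∈ K, ∀ᶠ t in l, (x ∈ s t ↔ x ∈ s₀)) :
    Tendsto (fun t => ∫ x in s t, h x ∂ν) l (𝓝 (∫ x in s₀, h x ∂ν)) := by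
  have e : ∀ r : Set ℝ, MeasurableSet r → r ⊆ K →
      ∫ x in r, h x ∂ν = ∫ x in K, r.indicator h x ∂ν := by
    intro r hr hrK
    rw [setIntegral_indicator hr, inter_eq_right.2 hrK]
  rw [e s₀ hs₀ hs₀K]
  refine Tendsto.congr' (hsK.mono fun t ht => (e (s t) (hs t) ht).symm) ?_
  refine tendsto_integral_filter_of_dominated_convergence (fun x => ‖h x‖)
    (Eventually.of_forall fun t => (hh.1.indicator (hs t)))
    (Eventually.of_forall fun t => Eventually.of_forall fun x => norm_indicator_le_norm_self _ _)
    hh.norm ?_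
  refine ae_restrict_of_forall_mem hK fun x hx => ?_
  refine tendsto_const_nhds.congr' ((hl x hx).mono fun t ht => ?_)
  change _ = (s t).indicator h x
  by_cases h0 : x ∈ s₀
  · rw [indicator_of_mem h0, indicator_of_mem (ht.2 h0)]
  · rw [indicator_of_notMem h0, indicator_of_notMem fun h1 => h0 (ht.1 h1)]

theorem boundedVariationOn_of_norm_sub_le {E : Type*} [NormedAddCommGroup E] {f : ℝ → E}
    {m : ℝ → ℝ} {s : Set ℝ} {c d : ℝ} (hc : c ∈ s)
    (hd : d ∈ s) (hs : s ⊆ Icc c d)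
    (hf : ∀ x ∈ s, ∀ y ∈ s, x ≤ y → ‖f y - f x‖ ≤ m y - m x) : BoundedVariationOn f s := by
  have hm : MonotoneOn m s := fun x hx y hy hxy =>
    sub_nonneg.1 ((norm_nonneg _).trans (hf x hx y hy hxy))
  have h1 : eVariationOn f s ≤ eVariationOn m s := by
    refine iSup_le fun p => le_trans (Finset.sum_le_sum fun i _ => ?_)
      (eVariationOn.sum_le p.2.2.1 p.2.2.2)
    have h2 := hf _ (p.2.2.2 i) _ (p.2.2.2 (i + 1)) (p.2.2.1 (Nat.le_succ i))
    rw [edist_dist, edist_dist, dist_eq_norm, dist_eq_norm]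
    exact ENNReal.ofReal_le_ofReal (h2.trans (Real.le_norm_self _))
  have h3 := (hm.eVariationOn_eq (a := c) (b := d) hc hd).le
  rw [inter_eq_left.2 hs] at h3
  exact ne_top_of_le_ne_top ENNReal.ofReal_ne_top (h1.trans h3)

section Primitive

variable {E : Type*} [NormedAddCommGroup E] [NormedSpace ℝ E] {ν : Measure ℝ} {h : ℝ → E}
  {c d x : ℝ}

/-- From the left, the primitives over [c, t) and over [c, t] both lose the atom at `x`; from the
right, both contain it. The mean of the two primitives is therefore balanced, and it is the form in
which solutions are written in `IsIntegralSolution.apply_eq`. -/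
theorem tendsto_setIntegral_Ico_left (hh : IntegrableOn h (Icc c d) ν) (hxd : x < d) :
    Tendsto (fun t => ∫ s in Ico c t, h s ∂ν) (𝓝[<] x) (𝓝 (∫ s in Ico c x, h s ∂ν)) := by
  refine tendsto_setIntegral_of_eventually_mem_iff hh measurableSet_Icc
    (fun t => measurableSet_Ico) measurableSet_Ico ?_ (fun s hs => ⟨hs.1, (hs.2.trans hxd).le⟩) ?_
  · filter_upwards [self_mem_nhdsWithin] with t ht s hs
    exact ⟨hs.1, (hs.2.trans (lt_trans ht hxd)).le⟩
  · intro s hs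
    rcases lt_or_ge s x with h | h
    · filter_upwards [Ioo_mem_nhdsLT h] with t ht
      simp [hs.1, ht.1, h]
    · filter_upwards [self_mem_nhdsWithin] with t ht
      exact iff_of_false (fun hm => (lt_trans hm.2 ht).not_ge h) fun hm => hm.2.not_ge h

theorem tendsto_setIntegral_Icc_left (hh : IntegrableOn h (Icc c d) ν) (hxd : x < d) :
    Tendsto (fun t => ∫ s in Icc c t, h s ∂ν) (𝓝[<] x) (𝓝 (∫ s in Ico c x, h s ∂ν)) := by
  refine tendsto_setIntegral_of_eventually_mem_iff hh measurableSet_Icc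
    (fun t => measurableSet_Icc) measurableSet_Ico ?_ (fun s hs => ⟨hs.1, (hs.2.trans hxd).le⟩) ?_
  · filter_upwards [self_mem_nhdsWithin] with t ht s hs
    exact ⟨hs.1, (hs.2.trans_lt (lt_trans ht hxd)).le⟩
  · intro s hs
    rcases lt_or_ge s x with h | h
    · filter_upwards [Ioo_mem_nhdsLT h] with t ht
      simp [hs.1, ht.1.le, h]
    · filter_upwards [self_mem_nhdsWithin] with t ht
      exact iff_of_false (fun hm => (lt_of_le_of_lt hm.2 ht).not_ge h) fun hm => hm.2.not_ge h

theorem tendsto_setIntegral_Ico_right (hh : IntegrableOn h (Icc c d) ν) (hxd : x < d) :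
    Tendsto (fun t => ∫ s in Ico c t, h s ∂ν) (𝓝[>] x) (𝓝 (∫ s in Icc c x, h s ∂ν)) := by
  refine tendsto_setIntegral_of_eventually_mem_iff hh measurableSet_Icc
    (fun t => measurableSet_Ico) measurableSet_Icc ?_ (fun s hs => ⟨hs.1, hs.2.trans hxd.le⟩) ?_
  · filter_upwards [Ioo_mem_nhdsGT hxd] with t ht s hs
    exact ⟨hs.1, (hs.2.trans ht.2).le⟩
  · intro s hs
    rcases le_or_gt s x with h | h
    · filter_upwards [self_mem_nhdsWithin] with t ht
      simp [hs.1, h, (lt_of_le_of_lt h ht)]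
    · filter_upwards [Ioo_mem_nhdsGT h] with t ht
      exact iff_of_false (fun hm => hm.2.not_gt ht.2) fun hm => hm.2.not_gt h

theorem tendsto_setIntegral_Icc_right (hh : IntegrableOn h (Icc c d) ν) (hxd : x < d) :
    Tendsto (fun t => ∫ s in Icc c t, h s ∂ν) (𝓝[>] x) (𝓝 (∫ s in Icc c x, h s ∂ν)) := by
  refine tendsto_setIntegral_of_eventually_mem_iff hh measurableSet_Icc
    (fun t => measurableSet_Icc) measurableSet_Icc ?_ (fun s hs => ⟨hs.1, hs.2.trans hxd.le⟩) ?_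
  · filter_upwards [Ioo_mem_nhdsGT hxd] with t ht s hs
    exact ⟨hs.1, (hs.2.trans_lt ht.2).le⟩
  · intro s hs
    rcases le_or_gt s x with h | h
    · filter_upwards [self_mem_nhdsWithin] with t ht
      simp [hs.1, h, h.trans (le_of_lt ht)]
    · filter_upwards [Ioo_mem_nhdsGT h] with t ht
      exact iff_of_false (fun hm => hm.2.not_gt ht.2) fun hm => hm.2.not_gt h

theorem add_sub_add_eq_setIntegral_add (hh : IntegrableOn h (Icc c d) ν) {s t : ℝ} (hcs : c ≤ s)
    (hst : s ≤ t) (htd : t ≤ d) :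
    ((∫ r in Ico c t, h r ∂ν) + ∫ r in Icc c t, h r ∂ν)
      - ((∫ r in Ico c s, h r ∂ν) + ∫ r in Icc c s, h r ∂ν)
      = (∫ r in Ico s t, h r ∂ν) + ∫ r in Ioc s t, h r ∂ν := by
  rw [← setIntegral_Ico_add_Ico hcs hst (hh.mono_set (Icc_subset_Icc_right htd)),
    ← Icc_union_Ioc_eq_Icc hcs hst, setIntegral_union
    (disjoint_left.2 fun x hx hx' => hx'.1.not_ge hx.2) measurableSet_Ioc
    (hh.mono_set fun x hx => ⟨hx.1, hx.2.trans (hst.trans htd)⟩)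
    (hh.mono_set fun x hx => ⟨hcs.trans hx.1.le, hx.2.trans htd⟩)]
  abel

theorem norm_add_sub_add_le (hh : IntegrableOn h (Icc c d) ν) {s t : ℝ} (hcs : c ≤ s)
    (hst : s ≤ t) (htd : t ≤ d) :
    ‖((∫ r in Ico c t, h r ∂ν) + ∫ r in Icc c t, h r ∂ν)
      - ((∫ r in Ico c s, h r ∂ν) + ∫ r in Icc c s, h r ∂ν)‖
    ≤ ((∫ r in Ico c t, ‖h r‖ ∂ν) + ∫ r in Icc c t, ‖h r‖ ∂ν)
      - ((∫ r in Ico c s, ‖h r‖ ∂ν) + ∫ r in Icc c s, ‖h r‖ ∂ν) := by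
  rw [add_sub_add_eq_setIntegral_add hh hcs hst htd,
    add_sub_add_eq_setIntegral_add hh.norm hcs hst htd]
  exact (norm_add_le _ _).trans
    (add_le_add (norm_integral_le_integral_norm _) (norm_integral_le_integral_norm _))

end Primitive

/-! ### Regularity of integral solutions and Lagrange's identity. -/

namespace DistSystem

variable {a b : EReal} {n : ℕ}

theorem exists_mem_lt {x : ℝ} (hx : x ∈ openInterval a b) : ∃ c ∈ openInterval a b, c < x := by
  obtain ⟨c, hac, hcx⟩ := EReal.lt_iff_exists_real_btwn.1 hx.1
  exact ⟨c, ⟨hac, hcx.trans hx.2⟩, EReal.coe_lt_coe_iff.1 hcx⟩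

theorem exists_mem_gt {x : ℝ} (hx : x ∈ openInterval a b) : ∃ d ∈ openInterval a b, x < d := by
  obtain ⟨d, hxd, hdb⟩ := EReal.lt_iff_exists_real_btwn.1 hx.2
  exact ⟨d, ⟨hx.1.trans hxd, hdb⟩, EReal.coe_lt_coe_iff.1 hxd⟩

theorem mulVec_injective {J : Matrix (Fin n) (Fin n) ℂ} (hJ : IsUnit J) {v w : Fin n → ℂ}
    (h : J.mulVec v = J.mulVec w) : v = w := by
  have := congrArg J⁻¹.mulVec h
  simpa [Matrix.mulVec_mulVec,
    Matrix.nonsing_inv_mul _ ((Matrix.isUnit_iff_isUnit_det J).1 hJ)] using this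

theorem mulVec_inv_cancel {J : Matrix (Fin n) (Fin n) ℂ} (hJ : IsUnit J) (v : Fin n → ℂ) :
    J.mulVec (J⁻¹.mulVec v) = v := by
  rw [Matrix.mulVec_mulVec, Matrix.mul_nonsing_inv _ ((Matrix.isUnit_iff_isUnit_det J).1 hJ),
    Matrix.one_mulVec]

theorem aemeasurable_bounded_of_mem_balancedBV {u : ℝ → Fin n → ℂ} (hu : u ∈ balancedBV a b n)
    {c d : ℝ} (hc : c ∈ openInterval a b) (hd : d ∈ openInterval a b) (μ : Measure ℝ) :
    AEMeasurable u (μ.restrict (Icc c d)) ∧ ∃ C, ∀ x ∈ Icc c d, ‖u x‖ ≤ C := by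
  have h1 := fun i => LocallyBV.aemeasurable_bounded (hu i).1 isCompact_Icc
    (Icc_subset_openInterval hc hd) μ
  refine ⟨aemeasurable_pi_iff.2 fun i => (h1 i).1, ?_⟩
  choose C hC using fun i => (h1 i).2
  refine ⟨∑ i, |C i|, fun x hx => (pi_norm_le_iff_of_nonneg
    (Finset.sum_nonneg fun i _ => abs_nonneg _)).2 fun i => (hC i x hx).trans
      ((le_abs_self _).trans ?_)⟩
  exact Finset.single_le_sum (f := fun i => |C i|) (fun i _ => abs_nonneg _) (Finset.mem_univ i)

variable {ν : Measure ℝ} {J : Matrix (Fin n) (Fin n) ℂ} {A : ℝ → Matrix (Fin n) (Fin n) ℂ}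
  {F G u v y z : ℝ → Fin n → ℂ}

namespace IsIntegralSolution

theorem integrableOn_sub (h : IsIntegralSolution a b ν J A F u y) {c d : ℝ}
    (hc : c ∈ openInterval a b) (hd : d ∈ openInterval a b) :
    IntegrableOn (fun t => F t - (A t).mulVec (u t)) (Icc c d) ν :=
  (h.integrableOn c hc d hd).sub (h.integrableOn_mulVec c hc d hd)

theorem add (h : IsIntegralSolution a b ν J A F u y) (h' : IsIntegralSolution a b ν J A G v z) :
    IsIntegralSolution a b ν J A (F + G) (u + v) (y + z) := by
  refine ⟨fun c hc d hd => (h.integrableOn c hc d hd).add (h'.integrableOn c hc d hd),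
    fun c hc d hd => ?_, fun c hc d hd hcd => ?_, fun x hx => ?_⟩
  · simp only [Pi.add_apply, Matrix.mulVec_add]
    exact (h.integrableOn_mulVec c hc d hd).add (h'.integrableOn_mulVec c hc d hd)
  · have e : (y + z) d - (y + z) c = (y d - y c) + (z d - z c) := by
      simp only [Pi.add_apply]; abel
    rw [e, Matrix.mulVec_add, h.eq c hc d hd hcd, h'.eq c hc d hd hcd,
      ← integral_add ((h.integrableOn_sub hc hd).mono_set Ico_subset_Icc_self)
      ((h'.integrableOn_sub hc hd).mono_set Ico_subset_Icc_self)]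
    congr 1
    ext t : 1
    simp only [Pi.add_apply, Matrix.mulVec_add]
    abel
  · simp only [Pi.add_apply, Matrix.mulVec_add]
    rw [h.balanced x hx, h'.balanced x hx, add_sub_add_comm, smul_add]
    abel

theorem smul (r : ℂ) (h : IsIntegralSolution a b ν J A F u y) :
    IsIntegralSolution a b ν J A (r • F) (r • u) (r • y) := by
  refine ⟨fun c hc d hd => (h.integrableOn c hc d hd).smul r,
    fun c hc d hd => ?_, fun c hc d hd hcd => ?_, fun x hx => ?_⟩
  · simp only [Pi.smul_apply, Matrix.mulVec_smul]
    exact (h.integrableOn_mulVec c hc d hd).smul r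
  · rw [Pi.smul_apply, Pi.smul_apply, ← smul_sub, Matrix.mulVec_smul, h.eq c hc d hd hcd,
      ← integral_smul]
    simp only [Pi.smul_apply, Matrix.mulVec_smul, smul_sub]
  · simp only [Pi.smul_apply, Matrix.mulVec_smul]
    rw [h.balanced x hx, ← smul_sub, smul_add, smul_comm r]

theorem zero : IsIntegralSolution a b ν J A 0 0 0 := by
  constructor <;> simp [IntegrableOn]

/-- Half of the atom at `x` is added to the left-continuous primitive, which amounts to averaging
the primitives over [c, x) and [c, x]. Bounded variation and both one-sided limits of `u` are read
off from this formula. -/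
theorem apply_eq (hJ : IsUnit J) (h : IsIntegralSolution a b ν J A F u y) {c x : ℝ}
    (hc : c ∈ openInterval a b) (hx : x ∈ openInterval a b) (hcx : c ≤ x) :
    u x = y c + J⁻¹.mulVec ((1 / 2 : ℂ) • ((∫ t in Ico c x, (F t - (A t).mulVec (u t)) ∂ν)
      + ∫ t in Icc c x, (F t - (A t).mulVec (u t)) ∂ν)) := by
  refine mulVec_injective hJ ?_
  rw [Matrix.mulVec_add, mulVec_inv_cancel hJ, h.balanced x hx,
    setIntegral_Icc_eq_Ico_add hcx (h.integrableOn_sub hc hx), ← h.eq c hc x hx hcx,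
    Matrix.mulVec_sub, ← Complex.coe_smul]
  ext i
  simp only [Pi.add_apply, Pi.sub_apply, Pi.smul_apply, smul_eq_mul]
  ring

theorem left_apply_eq (hJ : IsUnit J) (h : IsIntegralSolution a b ν J A F u y) {c x : ℝ}
    (hc : c ∈ openInterval a b) (hx : x ∈ openInterval a b) (hcx : c ≤ x) :
    y x = y c + J⁻¹.mulVec (∫ t in Ico c x, (F t - (A t).mulVec (u t)) ∂ν) := by
  refine mulVec_injective hJ ?_
  rw [Matrix.mulVec_add, mulVec_inv_cancel hJ, ← h.eq c hc x hx hcx, Matrix.mulVec_sub]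
  abel

theorem tendsto_left (hJ : IsUnit J) (h : IsIntegralSolution a b ν J A F u y) {x : ℝ}
    (hx : x ∈ openInterval a b) : Tendsto u (𝓝[<] x) (𝓝 (y x)) := by
  obtain ⟨c, hc, hcx⟩ := exists_mem_lt hx
  obtain ⟨d, hd, hxd⟩ := exists_mem_gt hx
  have hi := h.integrableOn_sub hc hd
  rw [h.left_apply_eq hJ hc hx hcx.le]
  have h1 := ((tendsto_setIntegral_Ico_left hi hxd).add
    (tendsto_setIntegral_Icc_left hi hxd)).const_smul (1 / 2 : ℂ)
  rw [← two_smul ℂ, smul_smul, one_div, inv_mul_cancel₀ two_ne_zero, one_smul] at h1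
  have h2 := (((Matrix.mulVecLin J⁻¹).toContinuousLinearMap.continuous.tendsto _).comp h1).const_add
    (y c)
  refine h2.congr' ?_
  filter_upwards [Ioo_mem_nhdsLT hcx] with t ht
  rw [h.apply_eq hJ hc (Icc_subset_openInterval hc hx ⟨ht.1.le, ht.2.le⟩) ht.1.le, one_div]
  rfl

theorem tendsto_right (hJ : IsUnit J) (h : IsIntegralSolution a b ν J A F u y) {x : ℝ}
    (hx : x ∈ openInterval a b) : Tendsto u (𝓝[>] x) (𝓝 ((2 : ℂ) • u x - y x)) := by
  obtain ⟨c, hc, hcx⟩ := exists_mem_lt hx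
  obtain ⟨d, hd, hxd⟩ := exists_mem_gt hx
  have hi := h.integrableOn_sub hc hd
  have h1 := ((tendsto_setIntegral_Ico_right hi hxd).add
    (tendsto_setIntegral_Icc_right hi hxd)).const_smul (1 / 2 : ℂ)
  rw [← two_smul ℂ, smul_smul, one_div, inv_mul_cancel₀ two_ne_zero, one_smul] at h1
  have h2 := (((Matrix.mulVecLin J⁻¹).toContinuousLinearMap.continuous.tendsto _).comp h1).const_add
    (y c)
  have e : (2 : ℂ) • u x - y x
      = y c + J⁻¹.mulVec (∫ t in Icc c x, (F t - (A t).mulVec (u t)) ∂ν) := by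
    rw [h.left_apply_eq hJ hc hx hcx.le, h.apply_eq hJ hc hx hcx.le, Matrix.mulVec_smul,
      Matrix.mulVec_add]
    ext i
    simp only [Pi.add_apply, Pi.sub_apply, Pi.smul_apply, smul_eq_mul]
    ring
  rw [e]
  refine h2.congr' ?_
  filter_upwards [Ioo_mem_nhdsGT hxd] with t ht
  rw [h.apply_eq hJ hc (Icc_subset_openInterval hx hd ⟨ht.1.le, ht.2.le⟩) (hcx.trans ht.1).le,
    one_div]
  rfl

theorem mem_balancedBV (hJ : IsUnit J) (h : IsIntegralSolution a b ν J A F u y) :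
    u ∈ balancedBV a b n := by
  refine fun i => ⟨fun c d hc hd => ?_, fun x hx => ⟨y x i, ((2 : ℂ) • u x - y x) i,
    (continuous_apply i).continuousAt.tendsto.comp (h.tendsto_left hJ hx),
    (continuous_apply i).continuousAt.tendsto.comp (h.tendsto_right hJ hx), ?_⟩⟩
  · rcases lt_or_ge d c with hdc | hcd
    · simp [BoundedVariationOn, hdc.not_ge]
    have hs : (openInterval a b : Set ℝ) ∩ Icc c d ⊆ Icc c d := inter_subset_right
    refine boundedVariationOn_of_norm_sub_le (c := c) (d := d) ⟨hc, le_rfl, hcd⟩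
      ⟨hd, hcd, le_rfl⟩ hs (m := fun x => (∑ i, ∑ j, ‖J⁻¹ i j‖) * (‖(1 / 2 : ℂ)‖ *
        ((∫ t in Ico c x, ‖F t - (A t).mulVec (u t)‖ ∂ν)
          + ∫ t in Icc c x, ‖F t - (A t).mulVec (u t)‖ ∂ν))) fun s hs t ht hst => ?_
    refine (norm_le_pi_norm (u t - u s) i).trans ?_
    rw [h.apply_eq hJ hc ht.1 ht.2.1, h.apply_eq hJ hc hs.1 hs.2.1, add_sub_add_left_eq_sub,
      ← Matrix.mulVec_sub, ← smul_sub]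
    refine (norm_mulVec_le _ _).trans ?_
    rw [norm_smul, ← mul_sub, ← mul_sub]
    gcongr
    exact norm_add_sub_add_le (h.integrableOn_sub hc hd) hs.2.1 hst ht.2.2
  · simp

/-- Lagrange's identity. -/
theorem lagrange [SFinite ν] (hA : IsCoefficient a b ν J A)
    (h : IsIntegralSolution a b ν J A F u y) (h' : IsIntegralSolution a b ν J A G v z) {c d : ℝ}
    (hc : c ∈ openInterval a b) (hd : d ∈ openInterval a b) (hcd : c ≤ d) :
    star (y d) ⬝ᵥ J.mulVec (z d) - star (y c) ⬝ᵥ J.mulVec (z c)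
      = ∫ t in Ico c d, (star (u t) ⬝ᵥ G t - star (F t) ⬝ᵥ v t) ∂ν := by
  set p := fun t => F t - (A t).mulVec (u t) with hp
  set r := fun t => G t - (A t).mulVec (v t) with hr
  have ip : IntegrableOn p (Ico c d) ν :=
    (h.integrableOn_sub hc hd).mono_set Ico_subset_Icc_self
  have ir : IntegrableOn r (Ico c d) ν :=
    (h'.integrableOn_sub hc hd).mono_set Ico_subset_Icc_self
  have iJp := integrable_const_mulVec J⁻¹ ip
  have hI : ∀ x ∈ Icc c d, x ∈ openInterval a b := fun x hx => Icc_subset_openInterval hc hd hx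
  -- Integration by parts for the products of the components of conj(y) and J z, whose densities are
  -- those of conj(J⁻¹ p) and r.
  have key : ∀ i, _ := fun i => mul_sub_mul_eq_setIntegral_Ico (μ := ν) (ν := ν) (𝕜 := ℂ)
    (φ := fun t => conj (J⁻¹.mulVec (p t) i)) (ψ := fun t => r t i)
    (F := fun x => conj (y x i)) (G := fun x => J.mulVec (z x) i) hcd
    (Complex.conjCLE.toContinuousLinearMap.integrable_comp
      ((ContinuousLinearMap.proj (R := ℝ) (φ := fun _ : Fin n => ℂ) i).integrable_comp iJp))
    ((ContinuousLinearMap.proj (R := ℝ) (φ := fun _ : Fin n => ℂ) i).integrable_comp ir)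
    (fun x hx => by
      have hx' : IntegrableOn p (Ico c x) ν := ip.mono_set (Ico_subset_Ico_right hx.2)
      rw [h.left_apply_eq hA.isUnit hc (hI x hx) hx.1, mulVec_integral _ hx', integral_conj,
        Pi.add_apply, map_add]
      congr 2
      exact ((ContinuousLinearMap.proj (R := ℝ) (φ := fun _ : Fin n => ℂ) i).integral_comp_comm
        (integrable_const_mulVec J⁻¹ hx')).symm)
    (fun x hx => by
      have hx' : IntegrableOn r (Ico c x) ν := ir.mono_set (Ico_subset_Ico_right hx.2)
      have h3 := congrFun (h'.eq c hc x (hI x hx) hx.1) i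
      rw [Matrix.mulVec_sub, Pi.sub_apply, sub_eq_iff_eq_add'] at h3
      rw [h3]
      congr 1
      exact ((ContinuousLinearMap.proj (R := ℝ) (φ := fun _ : Fin n => ℂ) i).integral_comp_comm
        hx').symm)
  have hsum : star (y d) ⬝ᵥ J.mulVec (z d) - star (y c) ⬝ᵥ J.mulVec (z c)
      = ∑ i, (conj (y d i) * J.mulVec (z d) i - conj (y c i) * J.mulVec (z c) i) := by
    rw [Finset.sum_sub_distrib]; rfl
  rw [hsum, Finset.sum_congr rfl fun i _ => (key i).2.2,
    Finset.sum_congr rfl fun i _ => (integral_add (key i).1 (key i).2.1).symm]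
  refine (integral_finsetSum _ fun i _ => (key i).1.add (key i).2.1).symm.trans ?_
  refine integral_congr_ae ?_
  filter_upwards [ae_restrict_of_ae hA.hermitian, ae_restrict_mem measurableSet_Ico] with t hAt ht
  have htI := hI t (Ico_subset_Icc_self ht)
  have e1 : ∑ i, (conj (J⁻¹.mulVec (p t) i) * J.mulVec (z t) i
        + (conj (y t i) + ν.real {t} • conj (J⁻¹.mulVec (p t) i)) * r t i)
      = star (J⁻¹.mulVec (p t)) ⬝ᵥ J.mulVec (z t)
        + (star (y t) + (ν.real {t} : ℂ) • star (J⁻¹.mulVec (p t))) ⬝ᵥ r t := by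
    simp only [Finset.sum_add_distrib, dotProduct, Pi.add_apply, Pi.smul_apply, Pi.star_apply,
      Complex.real_smul, smul_eq_mul]
    rfl
  have e2 : star (u t) = star (y t) + (ν.real {t} / 2 : ℂ) • star (J⁻¹.mulVec (p t)) := by
    have : u t = y t + (ν.real {t} / 2 : ℂ) • J⁻¹.mulVec (p t) := by
      refine mulVec_injective hA.isUnit ?_
      rw [h.balanced t htI, Matrix.mulVec_add, Matrix.mulVec_smul, mulVec_inv_cancel hA.isUnit]
    rw [this]
    simp
  have e3 : J.mulVec (v t) = J.mulVec (z t) + (ν.real {t} / 2 : ℂ) • r t := h'.balanced t htI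
  have e4 : star (J⁻¹.mulVec (p t)) ⬝ᵥ J.mulVec (v t) = -(star (p t) ⬝ᵥ v t) := by
    have h5 : star (p t) = -(Matrix.vecMul (star (J⁻¹.mulVec (p t))) J) := by
      conv_lhs => rw [← mulVec_inv_cancel hA.isUnit (p t)]
      rw [Matrix.star_mulVec, hA.skew, Matrix.vecMul_neg]
    rw [h5, Matrix.dotProduct_mulVec, neg_dotProduct, neg_neg]
  have e5 : star (u t) ⬝ᵥ r t - star (p t) ⬝ᵥ v t
      = star (u t) ⬝ᵥ G t - star (F t) ⬝ᵥ v t := by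
    simp only [hp, hr, star_sub, sub_dotProduct, dotProduct_sub, Matrix.star_mulVec, hAt,
      Matrix.dotProduct_mulVec]
    abel
  refine e1.trans (Eq.trans ?_ e5)
  -- One factor is the right-hand limit of `y`, the other the left-hand limit of `z`. Rewritten with
  -- the midpoints `u` and `v` they differ by half an atom in opposite directions, and the two
  -- corrections cancel. This is where balancedness is used.
  have e6 : J.mulVec (z t) = J.mulVec (v t) - (ν.real {t} / 2 : ℂ) • r t := by rw [e3]; abel
  rw [e2, e6, dotProduct_sub, e4, add_dotProduct, add_dotProduct, dotProduct_smul,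
    smul_dotProduct, smul_dotProduct]
  simp only [smul_eq_mul]
  ring

end IsIntegralSolution

end DistSystem

/-! ### Equivalence of the distributional and the integrated equation. -/

/-- This upgrades almost everywhere equality of two functions to equality of their left-hand limits
at every point. -/
theorem frequently_nhdsLT_of_ae {p : ℝ → Prop} (hp : ∀ᵐ t, p t) (x : ℝ) : ∃ᶠ t in 𝓝[<] x, p t := by
  intro h
  obtain ⟨l, hl, hlx⟩ := (mem_nhdsLT_iff_exists_Ioo_subset).1 h
  have h0 : volume (Ioo l x) = 0 := measure_mono_null (fun t ht => hlx ht) hp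
  rw [Real.volume_Ioo, ENNReal.ofReal_eq_zero] at h0
  exact absurd hl (by simpa using h0)

theorem frequently_nhdsGT_of_ae {p : ℝ → Prop} (hp : ∀ᵐ t, p t) (x : ℝ) : ∃ᶠ t in 𝓝[>] x, p t := by
  intro h
  obtain ⟨l, hl, hlx⟩ := (mem_nhdsGT_iff_exists_Ioo_subset).1 h
  have h0 : volume (Ioo x l) = 0 := measure_mono_null (fun t ht => hlx ht) hp
  rw [Real.volume_Ioo, ENNReal.ofReal_eq_zero] at h0
  exact absurd hl (by simpa using h0)

/-- The primitive of `h dν` that vanishes at `c` and is continuous from the left. -/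
noncomputable def leftPrimitive {E : Type*} [NormedAddCommGroup E] [NormedSpace ℝ E]
    (ν : Measure ℝ) (h : ℝ → E) (c x : ℝ) : E :=
  if c ≤ x then ∫ t in Ico c x, h t ∂ν else -∫ t in Ico x c, h t ∂ν

namespace DistSystem

variable {a b : EReal} {n : ℕ}

theorem exists_Ioo_superset {K : Set ℝ} (hne : (openInterval a b : Set ℝ).Nonempty)
    (hK : IsCompact K) (hKs : K ⊆ openInterval a b) :
    ∃ c ∈ openInterval a b, ∃ d ∈ openInterval a b, c < d ∧ K ⊆ Ioo c d := by
  rcases exists_Icc_superset hK hKs with rfl | ⟨c, d, hc, hd, hKcd⟩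
  · obtain ⟨x, hx⟩ := hne
    obtain ⟨d, hd, hxd⟩ := exists_mem_gt hx
    exact ⟨x, hx, d, hd, hxd, empty_subset _⟩
  · obtain ⟨c', hc', hcc'⟩ := exists_mem_lt hc
    obtain ⟨d', hd', hdd'⟩ := exists_mem_gt hd
    rcases lt_or_ge c' d' with h | h
    · exact ⟨c', hc', d', hd', h, fun x hx =>
        ⟨hcc'.trans_le (hKcd hx).1, (hKcd hx).2.trans_lt hdd'⟩⟩
    · obtain ⟨d'', hd'', hdd''⟩ := exists_mem_gt hc'
      exact ⟨c', hc', d'', hd'', hdd'', fun x hx =>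
        absurd ((hKcd hx).1.trans (hKcd hx).2) (by linarith)⟩

theorem leftPrimitive_sub {E : Type*} [NormedAddCommGroup E] [NormedSpace ℝ E] {ν : Measure ℝ}
    {h : ℝ → E}
    (hh : ∀ c ∈ openInterval a b, ∀ d ∈ openInterval a b, IntegrableOn h (Icc c d) ν) {c x y : ℝ}
    (hc : c ∈ openInterval a b) (hx : x ∈ openInterval a b) (hy : y ∈ openInterval a b)
    (hxy : x ≤ y) :
    leftPrimitive ν h c y - leftPrimitive ν h c x = ∫ t in Ico x y, h t ∂ν := by
  unfold leftPrimitive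
  rcases le_or_gt c x with hcx | hcx
  · rw [if_pos hcx, if_pos (hcx.trans hxy), ← setIntegral_Ico_add_Ico hcx hxy (hh c hc y hy)]
    abel
  · rw [if_neg hcx.not_ge]
    split_ifs with hcy
    · rw [← setIntegral_Ico_add_Ico hcx.le hcy (hh x hx y hy)]
      abel
    · rw [← setIntegral_Ico_add_Ico hxy (not_le.1 hcy).le (hh x hx c hc)]
      abel

theorem locallyBoundedVariationOn_of_sub_eq {ν : Measure ℝ} {h P : ℝ → ℂ}
    (hh : ∀ c ∈ openInterval a b, ∀ d ∈ openInterval a b, IntegrableOn h (Icc c d) ν)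
    (hP : ∀ x ∈ openInterval a b, ∀ y ∈ openInterval a b, x ≤ y →
      P y - P x = ∫ t in Ico x y, h t ∂ν) :
    LocallyBoundedVariationOn P (openInterval a b) := by
  intro c d hc hd
  rcases lt_or_ge d c with hdc | hcd
  · simp [BoundedVariationOn, hdc.not_ge]
  refine boundedVariationOn_of_norm_sub_le (c := c) (d := d) ⟨hc, le_rfl, hcd⟩
    ⟨hd, hcd, le_rfl⟩ inter_subset_right (m := fun x => ∫ t in Ico c x, ‖h t‖ ∂ν)
    fun s hs t ht hst => ?_
  rw [hP s hs.1 t ht.1 hst, ← setIntegral_Ico_add_Ico hs.2.1 hst (hh c hc t ht.1).norm,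
    add_sub_cancel_left]
  exact norm_integral_le_integral_norm _

theorem tendsto_left_of_sub_eq {ν : Measure ℝ} {h P : ℝ → ℂ}
    (hh : ∀ c ∈ openInterval a b, ∀ d ∈ openInterval a b, IntegrableOn h (Icc c d) ν)
    (hP : ∀ x ∈ openInterval a b, ∀ y ∈ openInterval a b, x ≤ y →
      P y - P x = ∫ t in Ico x y, h t ∂ν) {x : ℝ} (hx : x ∈ openInterval a b) :
    Tendsto P (𝓝[<] x) (𝓝 (P x)) := by
  obtain ⟨c, hc, hcx⟩ := exists_mem_lt hx
  obtain ⟨d, hd, hxd⟩ := exists_mem_gt hx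
  have h1 := (tendsto_setIntegral_Ico_left (hh c hc d hd) hxd).const_add (P c)
  rw [← hP c hc x hx hcx.le, add_sub_cancel] at h1
  refine h1.congr' ?_
  filter_upwards [Ioo_mem_nhdsLT hcx] with t ht
  rw [← hP c hc t (Icc_subset_openInterval hc hx ⟨ht.1.le, ht.2.le⟩) ht.1.le, add_sub_cancel]

theorem tendsto_right_of_sub_eq {ν : Measure ℝ} {h P : ℝ → ℂ}
    (hh : ∀ c ∈ openInterval a b, ∀ d ∈ openInterval a b, IntegrableOn h (Icc c d) ν)
    (hP : ∀ x ∈ openInterval a b, ∀ y ∈ openInterval a b, x ≤ y →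
      P y - P x = ∫ t in Ico x y, h t ∂ν) {x : ℝ} (hx : x ∈ openInterval a b) :
    Tendsto P (𝓝[>] x) (𝓝 (P x + ν.real {x} * h x)) := by
  obtain ⟨c, hc, hcx⟩ := exists_mem_lt hx
  obtain ⟨d, hd, hxd⟩ := exists_mem_gt hx
  have h1 := (tendsto_setIntegral_Ico_right (hh c hc d hd) hxd).const_add (P c)
  rw [setIntegral_Icc_eq_Ico_add hcx.le (hh c hc x hx), ← hP c hc x hx hcx.le, ← add_assoc,
    add_sub_cancel, Complex.real_smul] at h1
  refine h1.congr' ?_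
  filter_upwards [Ioo_mem_nhdsGT hxd] with t ht
  rw [← hP c hc t (Icc_subset_openInterval hx hd ⟨ht.1.le, ht.2.le⟩) (hcx.trans ht.1).le,
    add_sub_cancel]

theorem locallyIntegrableOn_of_locallyBoundedVariationOn {f : ℝ → ℂ}
    (hf : LocallyBoundedVariationOn f (openInterval a b)) :
    LocallyIntegrableOn f (openInterval a b) := by
  rw [locallyIntegrableOn_iff (openInterval a b).isOpen.isLocallyClosed]
  intro K hKs hK
  obtain ⟨hm, C, hC⟩ := LocallyBV.aemeasurable_bounded hf hK hKs volume
  exact IntegrableOn.of_bound hK.measure_lt_top hm.aestronglyMeasurable C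
    (ae_restrict_of_forall_mem hK.measurableSet hC)

theorem integrable_deriv_mul {f : ℝ → ℂ} (hf : LocallyIntegrableOn f (openInterval a b))
    {φ : ℝ → ℝ} (hφ : ContDiff ℝ 1 φ) (hc : HasCompactSupport φ)
    (hs : tsupport φ ⊆ openInterval a b) :
    Integrable fun x => ((deriv φ x : ℝ) : ℂ) * f x :=
  integrable_of_tsupport hφ.continuous_deriv_one hc.deriv
    (hf.integrableOn_compact_subset (tsupport_deriv_subset.trans hs) hc.deriv)

/-- Integration by parts with Lebesgue measure as one of the measures: it has no atoms, and the
boundary terms vanish by compact support. In other words, the distributional derivative of `P` is h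
ν. -/
theorem integral_deriv_mul_eq_neg {ν : Measure ℝ} [SFinite ν] {h P : ℝ → ℂ}
    (hh : ∀ c ∈ openInterval a b, ∀ d ∈ openInterval a b, IntegrableOn h (Icc c d) ν)
    (hP : ∀ x ∈ openInterval a b, ∀ y ∈ openInterval a b, x ≤ y →
      P y - P x = ∫ t in Ico x y, h t ∂ν)
    {φ : ℝ → ℝ} (hφ : ContDiff ℝ 1 φ) (hc : HasCompactSupport φ)
    (hs : tsupport φ ⊆ openInterval a b) :
    ∫ x, ((deriv φ x : ℝ) : ℂ) * P x = -∫ x, (φ x : ℂ) * h x ∂ν := by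
  rcases (openInterval a b : Set ℝ).eq_empty_or_nonempty with hI | hne
  · have h0 : φ = 0 := by
      rw [← tsupport_eq_empty_iff]
      exact subset_empty_iff.1 (hs.trans hI.subset)
    simp [h0]
  obtain ⟨c, hcI, d, hdI, hcd, hK⟩ := exists_Ioo_superset hne hc hs
  have hφ0 : ∀ x, x ∉ Ioo c d → φ x = 0 := fun x hx => image_eq_zero_of_notMem_tsupport
    fun h => hx (hK h)
  have hφ'0 : ∀ x, x ∉ Ioo c d → deriv φ x = 0 := fun x hx => image_eq_zero_of_notMem_tsupport
    fun h => hx (hK (tsupport_deriv_subset h))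
  have hd' : Continuous (deriv φ) := hφ.continuous_deriv_one
  have hI : ∀ x ∈ Icc c d, x ∈ openInterval a b := fun x hx => Icc_subset_openInterval hcI hdI hx
  obtain ⟨i1, i2, e⟩ := mul_sub_mul_eq_setIntegral_Ico (𝕜 := ℂ) (μ := volume) (ν := ν)
    (φ := fun x => ((deriv φ x : ℝ) : ℂ)) (ψ := h) (F := fun x => (φ x : ℂ)) (G := P) hcd.le
    ((Complex.continuous_ofReal.comp hd').integrableOn_Icc.mono_set Ico_subset_Icc_self)
    ((hh c hcI d hdI).mono_set Ico_subset_Icc_self)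
    (fun x hx => by
      rw [setIntegral_congr_set Ico_ae_eq_Ioc, ← intervalIntegral.integral_of_le hx.1,
        intervalIntegral.integral_ofReal, intervalIntegral.integral_deriv_eq_sub
          (fun y _ => (hφ.differentiable one_ne_zero).differentiableAt)
          (hd'.intervalIntegrable _ _)]
      simp)
    (fun x hx => by rw [← hP c hcI x (hI x hx) hx.1]; ring)
  simp only [hφ0 c (by simp), hφ0 d (by simp), measureReal_def, Real.volume_singleton] at e
  rw [← setIntegral_eq_integral_of_forall_compl_eq_zero (s := Ico c d) fun x hx => by
      rw [hφ'0 x fun h => hx (Ioo_subset_Ico_self h)]; simp,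
    ← setIntegral_eq_integral_of_forall_compl_eq_zero (s := Ico c d) (μ := ν) fun x hx => by
      rw [hφ0 x fun h => hx (Ioo_subset_Ico_self h)]; simp]
  simp at e
  linear_combination -e

/-- A function with vanishing distributional derivative is constant almost everywhere. -/
theorem ae_const_of_integral_deriv_mul_eq_zero {f : ℝ → ℂ}
    (hf : LocallyIntegrableOn f (openInterval a b))
    (h : ∀ φ : ℝ → ℝ, ContDiff ℝ (⊤ : ℕ∞) φ → HasCompactSupport φ →
      tsupport φ ⊆ openInterval a b → ∫ x, ((deriv φ x : ℝ) : ℂ) * f x = 0) :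
    ∃ κ : ℂ, ∀ᵐ x, x ∈ openInterval a b → f x = κ := by
  rcases (openInterval a b : Set ℝ).eq_empty_or_nonempty with hI | ⟨x₀, hx₀⟩
  · exact ⟨0, Eventually.of_forall fun x hx => absurd (show x ∈ (openInterval a b : Set ℝ) from hx)
      (by simp [hI])⟩
  obtain ⟨ε, hε, hball⟩ := Metric.isOpen_iff.1 (openInterval a b).isOpen x₀ hx₀
  let B : ContDiffBump x₀ := ⟨ε / 4, ε / 2, by positivity, by linarith⟩
  set η : ℝ → ℝ := B.normed volume with hη
  have hηs : tsupport η ⊆ openInterval a b := by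
    rw [hη, B.tsupport_normed_eq]
    exact (Metric.closedBall_subset_ball (by change ε / 2 < ε; linarith)).trans hball
  have hηc : HasCompactSupport η := B.hasCompactSupport_normed
  have hηd : ContDiff ℝ (⊤ : ℕ∞) η := B.contDiff_normed
  have hη1 : ∫ x, η x = 1 := B.integral_normed
  have hint : ∀ φ : ℝ → ℝ, Continuous φ → HasCompactSupport φ → tsupport φ ⊆ openInterval a b →
      Integrable fun x => (φ x : ℂ) * f x := fun φ hφ hc hs =>
    integrable_of_tsupport hφ hc (hf.integrableOn_compact_subset hs hc)
  set κ := ∫ x, (η x : ℂ) * f x with hκ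
  refine ⟨κ, ?_⟩
  have key := (openInterval a b).isOpen.ae_eq_zero_of_integral_contDiff_smul_eq_zero
    (μ := (volume : Measure ℝ)) (f := fun x => f x - κ) (hf.sub (locallyIntegrableOn_const κ))
    fun φ hφ hc hs => ?_
  · filter_upwards [key] with x hx hxI using sub_eq_zero.1 (hx hxI)
  set m := ∫ x, φ x with hm
  -- This combination has integral 0, hence is the derivative of a test function Ψ; testing `f`
  -- against Ψ' gives ∫ φ f = κ ∫ φ.
  set ψ : ℝ → ℝ := fun x => φ x - m * η x with hψ
  have hψd : ContDiff ℝ (⊤ : ℕ∞) ψ := hφ.sub (contDiff_const.mul hηd)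
  obtain ⟨c, hcI, d, hdI, hcd, hK⟩ := exists_Ioo_superset ⟨x₀, hx₀⟩ (hc.isCompact.union hηc)
    (union_subset hs hηs)
  have hφ0 : ∀ x, x ∉ Ioo c d → φ x = 0 := fun x hx => image_eq_zero_of_notMem_tsupport
    fun h => hx (hK (Or.inl h))
  have hη0 : ∀ x, x ∉ Ioo c d → η x = 0 := fun x hx => image_eq_zero_of_notMem_tsupport
    fun h => hx (hK (Or.inr h))
  have hψ0 : ∀ x, x ∉ Ioo c d → ψ x = 0 := fun x hx => by simp [hψ, hφ0 x hx, hη0 x hx]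
  have iφ : Integrable φ := hφ.continuous.integrable_of_hasCompactSupport hc
  have iη : Integrable η := hηd.continuous.integrable_of_hasCompactSupport hηc
  have hψ1 : ∫ x, ψ x = 0 := by
    rw [hψ, integral_sub iφ (iη.const_mul m), integral_const_mul, hη1, ← hm]; ring
  set Ψ : ℝ → ℝ := fun x => ∫ t in c..x, ψ t with hΨ
  have hΨ' : ∀ x, HasDerivAt Ψ (ψ x) x := fun x =>
    (hψd.continuous.integral_hasStrictDerivAt c x).hasDerivAt
  have hderiv : deriv Ψ = ψ := funext fun x => (hΨ' x).deriv
  have hΨd : ContDiff ℝ (⊤ : ℕ∞) Ψ := by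
    rw [contDiff_infty_iff_deriv, hderiv]
    exact ⟨fun x => (hΨ' x).differentiableAt, hψd⟩
  have hΨ0 : ∀ x, x ∉ Icc c d → Ψ x = 0 := by
    intro x hx
    rcases lt_or_ge x c with hxc | hcx
    · rw [hΨ]
      refine intervalIntegral.integral_zero_ae (Eventually.of_forall fun t ht => hψ0 t fun h => ?_)
      rw [uIoc_of_ge hxc.le] at ht
      exact absurd ht.2 h.1.not_ge
    · have hdx : d < x := not_le.1 fun h => hx ⟨hcx, h⟩
      rw [hΨ]
      simp only
      rw [intervalIntegral.integral_of_le hcx,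
        setIntegral_eq_integral_of_forall_compl_eq_zero (s := Ioc c x) fun t ht =>
          hψ0 t fun h => ht ⟨h.1, h.2.le.trans hdx.le⟩, hψ1]
  have hΨt : tsupport Ψ ⊆ Icc c d := closure_minimal (fun x hx => by
    by_contra h; exact hx (hΨ0 x h)) isClosed_Icc
  have h1 := h Ψ hΨd (HasCompactSupport.of_support_subset_isCompact isCompact_Icc
    (subset_closure.trans hΨt)) (hΨt.trans (Icc_subset_openInterval hcI hdI))
  rw [hderiv] at h1
  have e1 : ∀ x, (ψ x : ℂ) * f x = (φ x : ℂ) * f x - m * ((η x : ℂ) * f x) := by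
    intro x; simp only [hψ]; push_cast; ring
  have i1 := hint φ hφ.continuous hc hs
  have i2 := hint η hηd.continuous hηc hηs
  simp only [e1] at h1
  rw [integral_sub i1 (i2.const_mul _), integral_const_mul, ← hκ] at h1
  have e2 : ∀ x, φ x • (f x - κ) = (φ x : ℂ) * f x - (φ x : ℂ) * κ := by
    intro x; rw [Complex.real_smul]; ring
  simp only [e2]
  have i3 : Integrable fun x => (φ x : ℂ) * κ := (Integrable.ofReal (𝕜 := ℂ) iφ).mul_const κ
  rw [integral_sub i1 i3, integral_mul_const]
  have e3 : ∫ x, (φ x : ℂ) = m := integral_ofReal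
  rw [e3]
  exact h1

end DistSystem

namespace DistSystem

variable {a b : EReal} {n : ℕ} {ν : Measure ℝ} {J : Matrix (Fin n) (Fin n) ℂ}
  {A : ℝ → Matrix (Fin n) (Fin n) ℂ}

theorem IsCoefficient.integrableOn_mulVec (hA : IsCoefficient a b ν J A) {u : ℝ → Fin n → ℂ}
    (hu : u ∈ balancedBV a b n) {c d : ℝ} (hc : c ∈ openInterval a b) (hd : d ∈ openInterval a b) :
    IntegrableOn (fun t => (A t).mulVec (u t)) (Icc c d) ν := by
  obtain ⟨hm, C, hC⟩ := aemeasurable_bounded_of_mem_balancedBV hu hc hd ν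
  exact integrable_mulVec (hA.integrableOn c hc d hd) hm.aestronglyMeasurable
    (ae_restrict_of_forall_mem measurableSet_Icc hC)

theorem integral_apply {h : ℝ → Fin n → ℂ} {s : Set ℝ} (hh : IntegrableOn h s ν) (i : Fin n) :
    (∫ t in s, h t ∂ν) i = ∫ t in s, h t i ∂ν :=
  ((ContinuousLinearMap.proj (R := ℝ) (φ := fun _ : Fin n => ℂ) i).integral_comp_comm hh).symm

theorem integrableOn_apply {h : ℝ → Fin n → ℂ} {s : Set ℝ} (hh : IntegrableOn h s ν) (i : Fin n) :
    IntegrableOn (fun t => h t i) s ν :=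
  (ContinuousLinearMap.proj (R := ℝ) (φ := fun _ : Fin n => ℂ) i).integrable_comp hh

theorem mulVec_neg_integral_deriv {u : ℝ → Fin n → ℂ} {φ : ℝ → ℝ}
    (hu : ∀ j, Integrable fun x => ((deriv φ x : ℝ) : ℂ) * u x j) (i : Fin n) :
    J.mulVec (fun j => -∫ x, ((deriv φ x : ℝ) : ℂ) * u x j) i
      = -∫ x, ((deriv φ x : ℝ) : ℂ) * J.mulVec (u x) i := by
  have e : ∀ x, ((deriv φ x : ℝ) : ℂ) * J.mulVec (u x) i
      = ∑ j, J i j * (((deriv φ x : ℝ) : ℂ) * u x j) := by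
    intro x
    simp only [Matrix.mulVec, dotProduct, Finset.mul_sum]
    exact Finset.sum_congr rfl fun j _ => by ring
  simp only [e]
  rw [integral_finsetSum _ fun j _ => (hu j).const_mul _]
  simp only [Matrix.mulVec, dotProduct, integral_const_mul, mul_neg, Finset.sum_neg_distrib]

theorem integrable_deriv_mul_of_mem_balancedBV {u : ℝ → Fin n → ℂ} (hu : u ∈ balancedBV a b n)
    {φ : ℝ → ℝ} (hφ : ContDiff ℝ (⊤ : ℕ∞) φ) (hc : HasCompactSupport φ)
    (hs : tsupport φ ⊆ openInterval a b) (j : Fin n) :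
    Integrable fun x => ((deriv φ x : ℝ) : ℂ) * u x j :=
  integrable_deriv_mul (locallyIntegrableOn_of_locallyBoundedVariationOn (hu j).1)
    (hφ.of_le (by simp)) hc hs

theorem locallyBoundedVariationOn_mulVec {u : ℝ → Fin n → ℂ} (hu : u ∈ balancedBV a b n)
    (i : Fin n) : LocallyBoundedVariationOn (fun x => J.mulVec (u x) i) (openInterval a b) := by
  simp only [Matrix.mulVec, dotProduct]
  induction (Finset.univ : Finset (Fin n)) using Finset.induction_on with
  | empty => simpa using (LipschitzWith.const (0 : ℂ)).locallyBoundedVariationOn _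
  | insert j s hj ih =>
    simp only [Finset.sum_insert hj]
    exact LocallyBV.add (LocallyBV.const_mul _ (hu j).1) ih

/-- J u and the primitive of (F - A u) ν have the same distributional derivative, so they differ
almost everywhere by a constant and their one-sided limits differ by it everywhere. The left-hand
limits of `u` serve as `y`, and the balance condition is the mean of the two limits. -/
theorem exists_isIntegralSolution_of_integral_eq [SFinite ν] (hA : IsCoefficient a b ν J A)
    {F u : ℝ → Fin n → ℂ} (hu : u ∈ balancedBV a b n)
    (hF : ∀ c ∈ openInterval a b, ∀ d ∈ openInterval a b, IntegrableOn F (Icc c d) ν)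
    (h : ∀ φ : ℝ → ℝ, ContDiff ℝ (⊤ : ℕ∞) φ → HasCompactSupport φ →
      tsupport φ ⊆ openInterval a b → ∀ i,
      J.mulVec (fun j => -∫ x, ((deriv φ x : ℝ) : ℂ) * u x j) i
        = ∫ x, (φ x : ℂ) * (F x - (A x).mulVec (u x)) i ∂ν) :
    ∃ y, IsIntegralSolution a b ν J A F u y := by
  have iA : ∀ c ∈ openInterval a b, ∀ d ∈ openInterval a b,
      IntegrableOn (fun t => (A t).mulVec (u t)) (Icc c d) ν :=
    fun c hc d hd => hA.integrableOn_mulVec hu hc hd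
  rcases (openInterval a b : Set ℝ).eq_empty_or_nonempty with hI | ⟨c₀, hc₀⟩
  · have hI' : ∀ x, x ∉ openInterval a b := fun x hx => by
      have : x ∈ (openInterval a b : Set ℝ) := hx
      simp [hI] at this
    exact ⟨0, hF, iA, fun c hc => absurd hc (hI' c), fun c hc => absurd hc (hI' c)⟩
  have ih : ∀ i, ∀ c ∈ openInterval a b, ∀ d ∈ openInterval a b,
      IntegrableOn (fun t => (F t - (A t).mulVec (u t)) i) (Icc c d) ν := fun i c hc d hd =>
    integrableOn_apply ((hF c hc d hd).sub (iA c hc d hd)) i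
  choose! l r hl hr hlr using fun i => (hu i).2
  set P : Fin n → ℝ → ℂ := fun i => leftPrimitive ν (fun t => (F t - (A t).mulVec (u t)) i) c₀
    with hPdef
  have hP : ∀ i, ∀ x ∈ openInterval a b, ∀ y ∈ openInterval a b, x ≤ y →
      P i y - P i x = ∫ t in Ico x y, (F t - (A t).mulVec (u t)) i ∂ν := fun i x hx y hy hxy =>
    leftPrimitive_sub (ih i) hc₀ hx hy hxy
  have hconst : ∀ i, ∃ κ : ℂ, ∀ᵐ x, x ∈ openInterval a b → J.mulVec (u x) i - P i x = κ := by
    intro i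
    have l1 := locallyIntegrableOn_of_locallyBoundedVariationOn
      (locallyBoundedVariationOn_mulVec (J := J) hu i)
    have l2 := locallyIntegrableOn_of_locallyBoundedVariationOn
      (locallyBoundedVariationOn_of_sub_eq (ih i) (hP i))
    refine ae_const_of_integral_deriv_mul_eq_zero (l1.sub l2) fun φ hφ hc hs => ?_
    have hφ1 : ContDiff ℝ 1 φ := hφ.of_le (by simp)
    have h1 := h φ hφ hc hs i
    rw [mulVec_neg_integral_deriv fun j => integrable_deriv_mul_of_mem_balancedBV hu hφ hc hs j]
      at h1
    have h2 := integral_deriv_mul_eq_neg (ih i) (hP i) hφ1 hc hs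
    simp only [mul_sub]
    rw [integral_sub (integrable_deriv_mul l1 hφ1 hc hs) (integrable_deriv_mul l2 hφ1 hc hs), h2]
    linear_combination -h1
  choose κ hκ using hconst
  have tJ : ∀ (L : Filter ℝ) (v : Fin n → ℂ), (∀ j, Tendsto (fun x => u x j) L (𝓝 (v j))) → ∀ i,
      Tendsto (fun x => J.mulVec (u x) i) L (𝓝 (J.mulVec v i)) := by
    intro L v hv i
    simp only [Matrix.mulVec, dotProduct]
    exact tendsto_finsetSum _ fun j _ => (hv j).const_mul _
  have eL : ∀ i, ∀ x ∈ openInterval a b, J.mulVec (fun j => l j x) i = P i x + κ i := by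
    intro i x hx
    obtain ⟨c, hc, hcx⟩ := exists_mem_lt hx
    have t1 := tJ _ _ (fun j => hl j x hx) i
    have t2 := (tendsto_left_of_sub_eq (ih i) (hP i) hx).add_const (κ i)
    refine tendsto_nhds_unique_of_frequently_eq t1 t2 ?_
    refine ((frequently_nhdsLT_of_ae (hκ i) x).and_eventually (Ioo_mem_nhdsLT hcx)).mono ?_
    rintro t ⟨ht, ht'⟩
    rw [← ht (Icc_subset_openInterval hc hx ⟨ht'.1.le, ht'.2.le⟩)]
    ring
  have eR : ∀ i, ∀ x ∈ openInterval a b, J.mulVec (fun j => r j x) i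
      = P i x + ν.real {x} * (F x - (A x).mulVec (u x)) i + κ i := by
    intro i x hx
    obtain ⟨d, hd, hxd⟩ := exists_mem_gt hx
    have t1 := tJ _ _ (fun j => hr j x hx) i
    have t2 := (tendsto_right_of_sub_eq (ih i) (hP i) hx).add_const (κ i)
    refine tendsto_nhds_unique_of_frequently_eq t1 t2 ?_
    refine ((frequently_nhdsGT_of_ae (hκ i) x).and_eventually (Ioo_mem_nhdsGT hxd)).mono ?_
    rintro t ⟨ht, ht'⟩
    rw [← ht (Icc_subset_openInterval hx hd ⟨ht'.1.le, ht'.2.le⟩)]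
    ring
  refine ⟨fun x j => l j x, hF, iA, fun c hc d hd hcd => ?_, fun x hx => ?_⟩
  · ext i
    rw [Matrix.mulVec_sub, Pi.sub_apply, eL i d hd, eL i c hc, add_sub_add_right_eq_sub,
      hP i c hc d hd hcd]
    exact (integral_apply (((hF c hc d hd).sub (iA c hc d hd)).mono_set Ico_subset_Icc_self)
      i).symm
  · ext i
    have hux : u x = (1 / 2 : ℂ) • ((fun j => l j x) + fun j => r j x) := by
      ext j
      simp only [Pi.smul_apply, Pi.add_apply, smul_eq_mul]
      exact (hlr j x hx).trans (by ring)
    have h1 : J.mulVec (u x) i = (1 / 2 : ℂ) * (J.mulVec (fun j => l j x) i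
        + J.mulVec (fun j => r j x) i) := by
      conv_lhs => rw [hux]
      rw [Matrix.mulVec_smul, Matrix.mulVec_add]
      rfl
    rw [h1, eR i x hx, Pi.add_apply, eL i x hx, Pi.smul_apply, smul_eq_mul]
    ring

/-- On (a, b) the functions `u` and `y` differ at most at the atoms of ν, a countable and hence
Lebesgue-null set, so `y` may replace `u` under the integral with φ'. -/
theorem IsIntegralSolution.integral_eq [SFinite ν] (hA : IsCoefficient a b ν J A)
    {F u y : ℝ → Fin n → ℂ} (hu : IsIntegralSolution a b ν J A F u y) {φ : ℝ → ℝ}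
    (hφ : ContDiff ℝ (⊤ : ℕ∞) φ) (hc : HasCompactSupport φ) (hs : tsupport φ ⊆ openInterval a b)
    (i : Fin n) : J.mulVec (fun j => -∫ x, ((deriv φ x : ℝ) : ℂ) * u x j) i
      = ∫ x, (φ x : ℂ) * (F x - (A x).mulVec (u x)) i ∂ν := by
  have hφ1 : ContDiff ℝ 1 φ := hφ.of_le (by simp)
  have hbv := hu.mem_balancedBV hA.isUnit
  have ih : ∀ c ∈ openInterval a b, ∀ d ∈ openInterval a b,
      IntegrableOn (fun t => (F t - (A t).mulVec (u t)) i) (Icc c d) ν := fun c hc d hd =>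
    integrableOn_apply (hu.integrableOn_sub hc hd) i
  have h2 := integral_deriv_mul_eq_neg (P := fun x => J.mulVec (y x) i) ih
    (fun c hc d hd hcd => by
      rw [← integral_apply ((hu.integrableOn_sub hc hd).mono_set Ico_subset_Icc_self),
        ← hu.eq c hc d hd hcd, Matrix.mulVec_sub, Pi.sub_apply]) hφ1 hc hs
  rw [mulVec_neg_integral_deriv fun j => integrable_deriv_mul_of_mem_balancedBV hbv hφ hc hs j,
    neg_eq_iff_eq_neg, ← h2]
  refine integral_congr_ae ?_
  have h0 : ∀ᵐ x : ℝ, ν {x} = 0 := by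
    have := (countable_setOf_measure_singleton_ne_zero ν).measure_zero volume
    simpa [ae_iff] using this
  filter_upwards [h0] with x hx
  by_cases hxI : x ∈ openInterval a b
  · rw [hu.balanced x hxI]
    simp [Measure.real, hx]
  · have : deriv φ x = 0 := image_eq_zero_of_notMem_tsupport fun h =>
      hxI (hs (tsupport_deriv_subset h))
    simp [this]

end DistSystem

/-! ### A common reference measure for q and w. -/

theorem integrableOn_rnDeriv_smul_iff {E : Type*} [NormedAddCommGroup E] [NormedSpace ℝ E]
    {μ ν : Measure ℝ} [SigmaFinite μ] [SigmaFinite ν] (hμν : μ ≪ ν) {f : ℝ → E} {s : Set ℝ}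
    (hs : MeasurableSet s) :
    IntegrableOn (fun x => (μ.rnDeriv ν x).toReal • f x) s ν ↔ IntegrableOn f s μ := by
  rw [← integrable_indicator_iff hs, ← integrable_indicator_iff hs,
    ← integrable_rnDeriv_smul_iff hμν]
  refine iff_of_eq (congrArg (fun g => Integrable g ν) ?_)
  ext x
  by_cases hx : x ∈ s <;> simp [hx]

namespace DistSystem

variable {a b : EReal} {n : ℕ}

theorem exists_exhaustion (hab : a < b) : ∃ c d : ℕ → ℝ, (∀ N, c N ∈ openInterval a b) ∧
    (∀ N, d N ∈ openInterval a b) ∧ Antitone c ∧ Monotone d ∧ (∀ N, c N < d N) ∧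
    ∀ x ∈ openInterval a b, ∃ N, ∀ M, N ≤ M → c M < x ∧ x < d M := by
  obtain ⟨u, v, hu, hv, hua, hvb, huv, hul, hvl⟩ := exists_seq_strictAnti_strictMono_tendsto hab
  have hu' : ∀ k, ((u k).toReal : EReal) = u k := fun k =>
    EReal.coe_toReal (hua k).2.ne_top (hua k).1.ne_bot
  have hv' : ∀ k, ((v k).toReal : EReal) = v k := fun k =>
    EReal.coe_toReal (hvb k).2.ne_top (hvb k).1.ne_bot
  refine ⟨fun k => (u k).toReal, fun k => (v k).toReal, fun k => ?_, fun k => ?_, fun k l hkl => ?_,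
    fun k l hkl => ?_, fun k => ?_, fun x hx => ?_⟩
  · change a < ((u k).toReal : EReal) ∧ ((u k).toReal : EReal) < b
    rw [hu' k]; exact hua k
  · change a < ((v k).toReal : EReal) ∧ ((v k).toReal : EReal) < b
    rw [hv' k]; exact hvb k
  · have := hu.antitone hkl
    rwa [← hu' k, ← hu' l, EReal.coe_le_coe_iff] at this
  · have := hv.monotone hkl
    rwa [← hv' k, ← hv' l, EReal.coe_le_coe_iff] at this
  · have := huv k k
    rwa [← hu' k, ← hv' k, EReal.coe_lt_coe_iff] at this
  · obtain ⟨N, hN⟩ := eventually_atTop.1 ((hul.eventually_lt_const hx.1).and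
      (hvl.eventually_const_lt hx.2))
    refine ⟨N, fun M hM => ?_⟩
    have := hN M hM
    rwa [← hu' M, ← hv' M, EReal.coe_lt_coe_iff, EReal.coe_lt_coe_iff] at this

theorem sigmaFinite_of_compl_eq_zero (hab : a < b) {μ : Measure ℝ}
    (h0 : μ (openInterval a b : Set ℝ)ᶜ = 0)
    (hfin : ∀ K : Set ℝ, IsCompact K → K ⊆ openInterval a b → μ K < ⊤) : SigmaFinite μ := by
  obtain ⟨c, d, hc, hd, -, -, -, hx⟩ := exists_exhaustion hab
  refine ⟨⟨⟨fun N => Icc (c N) (d N) ∪ (openInterval a b : Set ℝ)ᶜ, fun _ => trivial,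
    fun N => (measure_union_le _ _).trans_lt ?_, ?_⟩⟩⟩
  · rw [h0, add_zero]
    exact hfin _ isCompact_Icc (Icc_subset_openInterval (hc N) (hd N))
  · refine eq_univ_of_forall fun x => mem_iUnion.2 ?_
    by_cases hxI : x ∈ openInterval a b
    · obtain ⟨N, hN⟩ := hx x hxI
      exact ⟨N, Or.inl ⟨(hN N le_rfl).1.le, (hN N le_rfl).2.le⟩⟩
    · exact ⟨0, Or.inr hxI⟩

section Representation

variable (q w : MatrixDist a b n)

theorem densityRep_measurable (i j : Fin n) : Measurable fun x => (densityRep q).2 x i j := by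
  unfold densityRep
  split_ifs with h
  · exact h.choose_spec.measurable i j
  · exact measurable_const

theorem densityRep_compl : (densityRep q).1 (openInterval a b : Set ℝ)ᶜ = 0 := by
  unfold densityRep
  split_ifs with h
  · exact h.choose_spec.compl
  · simp

theorem densityRep_finite {K : Set ℝ} (hK : IsCompact K) (hKs : K ⊆ openInterval a b) :
    (densityRep q).1 K < ⊤ := by
  unfold densityRep
  split_ifs with h
  · exact h.choose_spec.finite K hK hKs
  · simp

theorem traceMeasure_compl : traceMeasure w (openInterval a b : Set ℝ)ᶜ = 0 := by
  unfold traceMeasure weightRep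
  split_ifs with h
  · exact h.choose_spec.compl
  · simp

theorem traceMeasure_finite {K : Set ℝ} (hK : IsCompact K) (hKs : K ⊆ openInterval a b) :
    traceMeasure w K < ⊤ := by
  unfold traceMeasure weightRep
  split_ifs with h
  · exact h.choose_spec.finite K hK hKs
  · simp

/-- A measure which dominates the measures belonging to `q` and `w`. -/
noncomputable def refMeasure : Measure ℝ := (densityRep q).1 + traceMeasure w

/-- The density of `q` with respect to the reference measure. -/
noncomputable def refCoeff (x : ℝ) : Matrix (Fin n) (Fin n) ℂ :=
  ((densityRep q).1.rnDeriv (refMeasure q w) x).toReal • (densityRep q).2 x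

/-- The density of `w f` with respect to the reference measure. -/
noncomputable def refForcing (f : ℝ → Fin n → ℂ) (x : ℝ) : Fin n → ℂ :=
  ((traceMeasure w).rnDeriv (refMeasure q w) x).toReal • (weightDensity w x).mulVec (f x)

theorem densityRep_absolutelyContinuous : (densityRep q).1 ≪ refMeasure q w :=
  Measure.AbsolutelyContinuous.rfl.add_right _

theorem traceMeasure_absolutelyContinuous : traceMeasure w ≪ refMeasure q w := by
  rw [refMeasure, add_comm]
  exact Measure.AbsolutelyContinuous.rfl.add_right _

theorem refMeasure_compl : refMeasure q w (openInterval a b : Set ℝ)ᶜ = 0 := by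
  simp [refMeasure, densityRep_compl, traceMeasure_compl]

theorem refMeasure_finite {K : Set ℝ} (hK : IsCompact K) (hKs : K ⊆ openInterval a b) :
    refMeasure q w K < ⊤ :=
  ENNReal.add_lt_top.2 ⟨densityRep_finite q hK hKs, traceMeasure_finite w hK hKs⟩

theorem sigmaFinite_densityRep (hab : a < b) : SigmaFinite (densityRep q).1 :=
  sigmaFinite_of_compl_eq_zero hab (densityRep_compl q) fun _ => densityRep_finite q

theorem sigmaFinite_traceMeasure (hab : a < b) : SigmaFinite (traceMeasure w) :=
  sigmaFinite_of_compl_eq_zero hab (traceMeasure_compl w) fun _ => traceMeasure_finite w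

theorem sigmaFinite_refMeasure (hab : a < b) : SigmaFinite (refMeasure q w) :=
  sigmaFinite_of_compl_eq_zero hab (refMeasure_compl q w) fun _ => refMeasure_finite q w

theorem traceMeasure_restrict :
    (traceMeasure w).restrict (openInterval a b) = traceMeasure w :=
  Measure.restrict_eq_self_of_ae_mem (traceMeasure_compl w)

theorem refCoeff_measurable (i j : Fin n) : Measurable fun x => refCoeff q w x i j :=
  (Measure.measurable_rnDeriv _ _).ennreal_toReal.smul (densityRep_measurable q i j)

theorem refCoeff_integrableOn (hab : a < b) {K : Set ℝ} (hK : IsCompact K)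
    (hKs : K ⊆ openInterval a b) (i j : Fin n) :
    IntegrableOn (fun x => refCoeff q w x i j) K (refMeasure q w) := by
  have := sigmaFinite_densityRep q hab
  have := sigmaFinite_refMeasure q w hab
  exact (integrableOn_rnDeriv_smul_iff (densityRep_absolutelyContinuous q w) hK.measurableSet).2
    (densityRep_integrableOn q hK hKs i j)

theorem integral_mul_refCoeff (hab : a < b) (φ : ℝ → ℂ) (i j : Fin n) :
    ∫ x, φ x * refCoeff q w x i j ∂refMeasure q w
      = ∫ x, φ x * (densityRep q).2 x i j ∂(densityRep q).1 := by
  have := sigmaFinite_densityRep q hab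
  have := sigmaFinite_refMeasure q w hab
  rw [← integral_rnDeriv_smul (densityRep_absolutelyContinuous q w)]
  simp only [refCoeff, Matrix.smul_apply, mul_smul_comm]

variable {q}

theorem apply_eq_integral_refCoeff (hab : a < b)
    (hq : IsDensityRep (densityRep q).1 (densityRep q).2 q)
    (φ : TestFunction (openInterval a b) ℝ 0) (i j : Fin n) :
    q i j φ = ∫ x, φ x * refCoeff q w x i j ∂refMeasure q w := by
  rw [integral_mul_refCoeff q w hab (fun x => (φ x : ℂ)), hq.apply_eq]

/-- A locally integrable density that annihilates all test functions vanishes almost everywhere;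
this is applied to the entries of A - A*. -/
theorem refCoeff_hermitian (hab : a < b) (hq : IsDensityRep (densityRep q).1 (densityRep q).2 q)
    (hherm : IsHermitianDist q) :
    ∀ᵐ x ∂refMeasure q w, (refCoeff q w x).conjTranspose = refCoeff q w x := by
  have hloc : ∀ i j, LocallyIntegrableOn (fun x => refCoeff q w x i j) (openInterval a b)
      (refMeasure q w) := by
    intro i j
    rw [locallyIntegrableOn_iff (openInterval a b).isOpen.isLocallyClosed]
    exact fun K hKs hK => refCoeff_integrableOn q w hab hK hKs i j
  have hconj : ∀ i j, LocallyIntegrableOn (fun x => conj (refCoeff q w x i j)) (openInterval a b)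
      (refMeasure q w) := by
    intro i j
    rw [locallyIntegrableOn_iff (openInterval a b).isOpen.isLocallyClosed]
    exact fun K hKs hK => Complex.conjCLE.toContinuousLinearMap.integrable_comp
      (refCoeff_integrableOn q w hab hK hKs i j)
  have key : ∀ i j, ∀ᵐ x ∂refMeasure q w, x ∈ openInterval a b →
      refCoeff q w x i j - conj (refCoeff q w x j i) = 0 := by
    intro i j
    refine (openInterval a b).isOpen.ae_eq_zero_of_integral_contDiff_smul_eq_zero
      ((hloc i j).sub (hconj j i)) fun φ hφ hc hs => ?_
    let φ' : TestFunction (openInterval a b) ℝ 0 := ⟨φ, hφ.of_le (by simp), hc, hs⟩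
    have h1 := hherm φ' i j
    rw [apply_eq_integral_refCoeff w hab hq, apply_eq_integral_refCoeff w hab hq,
      ← integral_conj] at h1
    have i1 : Integrable (fun x => (φ x : ℂ) * refCoeff q w x i j) (refMeasure q w) :=
      integrable_of_tsupport hφ.continuous hc (refCoeff_integrableOn q w hab hc hs i j)
    have i2 : Integrable (fun x => (φ x : ℂ) * conj (refCoeff q w x j i)) (refMeasure q w) :=
      integrable_of_tsupport hφ.continuous hc
        ((hconj j i).integrableOn_compact_subset hs hc)
    simp only [Complex.real_smul, mul_sub]
    rw [integral_sub i1 i2, sub_eq_zero]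
    simp only [map_mul, Complex.conj_ofReal] at h1
    exact h1
  have hmem : ∀ᵐ x ∂refMeasure q w, x ∈ (openInterval a b : Set ℝ) := refMeasure_compl q w
  filter_upwards [hmem, ae_all_iff.2 fun i => ae_all_iff.2 (key i)] with x hx hx'
  ext i j
  exact (sub_eq_zero.1 (hx' i j hx)).symm

theorem exists_tendsto_of_locallyBoundedVariationOn {f : ℝ → ℂ}
    (hf : LocallyBoundedVariationOn f (openInterval a b)) {x : ℝ} (hx : x ∈ openInterval a b) :
    (∃ l, Tendsto f (𝓝[<] x) (𝓝 l)) ∧ ∃ r, Tendsto f (𝓝[>] x) (𝓝 r) := by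
  obtain ⟨c, hc, hcx⟩ := exists_mem_lt hx
  obtain ⟨d, hd, hxd⟩ := exists_mem_gt hx
  have h := hf c d hc hd
  have hs : (openInterval a b : Set ℝ) ∩ Icc c d ∈ 𝓝 x :=
    inter_mem ((openInterval a b).isOpen.mem_nhds hx) (Icc_mem_nhds hcx hxd)
  refine ⟨?_, ?_⟩
  · obtain ⟨l, hl⟩ := h.exists_tendsto_left x
    rw [inter_comm, nhdsWithin_inter_of_mem' (mem_nhdsWithin_of_mem_nhds hs)] at hl
    exact ⟨l, hl⟩
  · obtain ⟨l, hl⟩ := h.exists_tendsto_right x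
    rw [inter_comm, nhdsWithin_inter_of_mem' (mem_nhdsWithin_of_mem_nhds hs)] at hl
    exact ⟨l, hl⟩

/-- The chosen antiderivative and the explicit primitive of the density differ almost everywhere by
a constant. Jumps are not affected by this, so they do not depend on the choice. -/
theorem jump_eq_of_isDensityRep (hab : a < b)
    (hq : IsDensityRep (densityRep q).1 (densityRep q).2 q) {x : ℝ} (hx : x ∈ openInterval a b) :
    jump q x = ((refMeasure q w).real {x} : ℂ) • refCoeff q w x := by
  have := sigmaFinite_refMeasure q w hab
  ext i j
  set P := leftPrimitive (refMeasure q w) (fun t => refCoeff q w t i j) x with hPdef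
  have ih : ∀ c ∈ openInterval a b, ∀ d ∈ openInterval a b,
      IntegrableOn (fun t => refCoeff q w t i j) (Icc c d) (refMeasure q w) := fun c hc d hd =>
    refCoeff_integrableOn q w hab isCompact_Icc (Icc_subset_openInterval hc hd) i j
  have hP : ∀ y ∈ openInterval a b, ∀ z ∈ openInterval a b, y ≤ z →
      P z - P y = ∫ t in Ico y z, refCoeff q w t i j ∂refMeasure q w := fun y hy z hz hyz =>
    leftPrimitive_sub ih hx hy hz hyz
  have hPbv := locallyBoundedVariationOn_of_sub_eq ih hP
  -- The primitive `P` is a witness, so `antiderivative` does not take its default value.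
  have hanti : ∃ Q, IsAntiderivative Q (q i j) := by
    refine ⟨P, hPbv, fun φ => ?_⟩
    have h1 := integral_deriv_mul_eq_neg ih hP (φ.contDiff.of_le (by simp)) φ.hasCompactSupport
      φ.tsupport_subset
    simp only [Complex.real_smul]
    rw [h1, neg_neg, apply_eq_integral_refCoeff w hab hq]
    rfl
  obtain ⟨hQbv, hQ⟩ : IsAntiderivative (antiderivative (q i j)) (q i j) := by
    rw [antiderivative, dif_pos hanti]
    exact hanti.choose_spec
  set Q := antiderivative (q i j)
  have lP := locallyIntegrableOn_of_locallyBoundedVariationOn hPbv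
  have lQ := locallyIntegrableOn_of_locallyBoundedVariationOn hQbv
  obtain ⟨κ, hκ⟩ := ae_const_of_integral_deriv_mul_eq_zero (lQ.sub lP) fun φ hφ hc hs => by
    have hφ1 : ContDiff ℝ 1 φ := hφ.of_le (by simp)
    have h1 := hQ ⟨φ, hφ, hc, hs⟩
    have h2 := integral_deriv_mul_eq_neg ih hP hφ1 hc hs
    rw [apply_eq_integral_refCoeff w hab hq] at h1
    simp only [Complex.real_smul] at h1
    have h3 : ∫ x, (φ x : ℂ) * refCoeff q w x i j ∂refMeasure q w
        = -∫ x, ((deriv φ x : ℝ) : ℂ) * Q x := h1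
    simp only [Pi.sub_apply, mul_sub]
    rw [integral_sub (integrable_deriv_mul lQ hφ1 hc hs) (integrable_deriv_mul lP hφ1 hc hs), h2]
    linear_combination h3
  obtain ⟨⟨l, hl⟩, r, hr⟩ := exists_tendsto_of_locallyBoundedVariationOn hQbv hx
  obtain ⟨c, hc, hcx⟩ := exists_mem_lt hx
  obtain ⟨d, hd, hxd⟩ := exists_mem_gt hx
  have el : l = P x + κ := by
    refine tendsto_nhds_unique_of_frequently_eq hl
      ((tendsto_left_of_sub_eq ih hP hx).add_const κ) ?_
    refine ((frequently_nhdsLT_of_ae hκ x).and_eventually (Ioo_mem_nhdsLT hcx)).mono ?_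
    rintro t ⟨ht, ht'⟩
    rw [← ht (Icc_subset_openInterval hc hx ⟨ht'.1.le, ht'.2.le⟩), Pi.sub_apply]
    ring
  have er : r = P x + (refMeasure q w).real {x} * refCoeff q w x i j + κ := by
    refine tendsto_nhds_unique_of_frequently_eq hr
      ((tendsto_right_of_sub_eq ih hP hx).add_const κ) ?_
    refine ((frequently_nhdsGT_of_ae hκ x).and_eventually (Ioo_mem_nhdsGT hxd)).mono ?_
    rintro t ⟨ht, ht'⟩
    rw [← ht (Icc_subset_openInterval hx hd ⟨ht'.1.le, ht'.2.le⟩), Pi.sub_apply]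
    ring
  rw [jump, Matrix.of_apply, leftLim_eq_of_tendsto hl, rightLim_eq_of_tendsto hr, el, er,
    Matrix.smul_apply, smul_eq_mul]
  ring

/-- The jump condition of the system in terms of the reference measure. The coefficient vanishes
identically when `densityRep q` takes its default value. -/
theorem isCoefficient_refCoeff (hab : a < b) {J : Matrix (Fin n) (Fin n) ℂ} (hJ : IsUnit J)
    (hJskew : J.conjTranspose = -J) (hq : IsHermitianDist q)
    (hjump : ∀ x ∈ openInterval a b,
      IsUnit ((2 : ℂ) • J + jump q x) ∧ IsUnit ((2 : ℂ) • J - jump q x)) :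
    IsCoefficient a b (refMeasure q w) J (refCoeff q w) := by
  have hbase : (∀ᵐ x ∂refMeasure q w, (refCoeff q w x).conjTranspose = refCoeff q w x) ∧
      ∀ x ∈ openInterval a b,
        IsUnit ((2 : ℂ) • J + ((refMeasure q w).real {x} : ℂ) • refCoeff q w x) ∧
        IsUnit ((2 : ℂ) • J - ((refMeasure q w).real {x} : ℂ) • refCoeff q w x) := by
    by_cases h : ∃ p : Measure ℝ × (ℝ → Matrix (Fin n) (Fin n) ℂ), IsDensityRep p.1 p.2 q
    · have hrep : IsDensityRep (densityRep q).1 (densityRep q).2 q := by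
        rw [densityRep, dif_pos h]
        exact h.choose_spec
      refine ⟨refCoeff_hermitian w hab hrep hq, fun x hx => ?_⟩
      rw [← jump_eq_of_isDensityRep w hab hrep hx]
      exact hjump x hx
    · have h0 : ∀ x, refCoeff q w x = 0 := fun x => by simp [refCoeff, densityRep, dif_neg h]
      have h2J : IsUnit ((2 : ℂ) • J) := by
        have : IsUnit (Units.mk0 (2 : ℂ) two_ne_zero • J) := (isUnit_smul_iff _ J).2 hJ
        simpa [Units.smul_def] using this
      simp [h0, h2J]
  exact
    { isUnit := hJ
      skew := hJskew
      finite := fun c hc d hd =>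
        refMeasure_finite q w isCompact_Icc (Icc_subset_openInterval hc hd)
      measurable := refCoeff_measurable q w
      integrableOn := fun c hc d hd =>
        refCoeff_integrableOn q w hab isCompact_Icc (Icc_subset_openInterval hc hd)
      hermitian := hbase.1
      isUnit_add := fun x hx => (hbase.2 x hx).1
      isUnit_sub := fun x hx => (hbase.2 x hx).2 }

variable (q) {w}

/-- The i-th component of W f is the weight form of the constant unit vector e_i with f. Both have
integrable weight form on compact sets, the first because W is locally integrable. -/
theorem weightDensity_mulVec_integrableOn (f : PreL2 w) {K : Set ℝ} (hK : IsCompact K)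
    (hKs : K ⊆ openInterval a b) :
    IntegrableOn (fun x => (weightDensity w x).mulVec (PreL2.fn w f x)) K (traceMeasure w) := by
  refine Integrable.of_eval fun i => ?_
  have h1 : ∀ g : ℝ → Fin n → ℂ, ∀ x, weightForm w (fun _ => Pi.single i 1) g x
      = (weightDensity w x).mulVec (g x) i := by
    intro g x
    simp [weightForm]
  have h2 := weightForm_integrable w (μ := (traceMeasure w).restrict K)
    (f := fun _ => Pi.single i 1) (g := PreL2.fn w f) aemeasurable_const
    (PreL2.aemeasurable f).restrict ?_ (PreL2.integrable f f).restrict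
  · exact h2.congr (Filter.Eventually.of_forall fun x => h1 _ x)
  · refine (weightDensity_integrableOn w hK hKs i i).congr
      (Filter.Eventually.of_forall fun x => ?_)
    rw [h1]
    simp

theorem refForcing_integrableOn (hab : a < b) (f : PreL2 w) {K : Set ℝ} (hK : IsCompact K)
    (hKs : K ⊆ openInterval a b) :
    IntegrableOn (refForcing q w (PreL2.fn w f)) K (refMeasure q w) := by
  have := sigmaFinite_traceMeasure w hab
  have := sigmaFinite_refMeasure q w hab
  exact (integrableOn_rnDeriv_smul_iff (traceMeasure_absolutelyContinuous q w) hK.measurableSet).2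
    (weightDensity_mulVec_integrableOn f hK hKs)

/-- The function `f` is measurable only with respect to S, so the measurability of the forcing for
the larger reference measure is taken from its local integrability. -/
theorem refForcing_aestronglyMeasurable (hab : a < b) (f : PreL2 w) :
    AEStronglyMeasurable (refForcing q w (PreL2.fn w f))
      ((refMeasure q w).restrict (openInterval a b)) := by
  obtain ⟨c, d, hc, hd, -, -, -, hx⟩ := exists_exhaustion hab
  have hU : (openInterval a b : Set ℝ) ⊆ ⋃ N, Icc (c N) (d N) := fun x hxI => by
    obtain ⟨N, hN⟩ := hx x hxI
    exact mem_iUnion.2 ⟨N, (hN N le_rfl).1.le, (hN N le_rfl).2.le⟩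
  refine AEStronglyMeasurable.mono_set hU (aestronglyMeasurable_iUnion_iff.2 fun N => ?_)
  exact (refForcing_integrableOn q hab f isCompact_Icc
    (Icc_subset_openInterval (hc N) (hd N))).1

open scoped ComplexOrder in
theorem weightForm_eq_star_mulVec (f g : ℝ → Fin n → ℂ) (x : ℝ) :
    weightForm w f g x = star ((weightDensity w x).mulVec (f x)) ⬝ᵥ g x := by
  rw [weightForm, Matrix.star_mulVec, (weightDensity_posSemidef w x).isHermitian.eq,
    Matrix.dotProduct_mulVec]

theorem dotProduct_refForcing (u f : ℝ → Fin n → ℂ) (x : ℝ) :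
    star (u x) ⬝ᵥ refForcing q w f x
      = ((traceMeasure w).rnDeriv (refMeasure q w) x).toReal • weightForm w u f x := by
  rw [refForcing, dotProduct_smul]; rfl

theorem refForcing_dotProduct (u f : ℝ → Fin n → ℂ) (x : ℝ) :
    star (refForcing q w f x) ⬝ᵥ u x
      = ((traceMeasure w).rnDeriv (refMeasure q w) x).toReal • weightForm w f u x := by
  rw [refForcing, star_smul, smul_dotProduct, weightForm_eq_star_mulVec]; rfl

/-- Radon–Nikodym derivatives carry q u and w f over to the reference measure; the two directions
are then `exists_isIntegralSolution_of_integral_eq` and `IsIntegralSolution.integral_eq`. -/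
theorem isSolution_iff (hab : a < b) {J : Matrix (Fin n) (Fin n) ℂ}
    (hA : IsCoefficient a b (refMeasure q w) J (refCoeff q w)) {u : ℝ → Fin n → ℂ}
    (hu : u ∈ balancedBV a b n) (f : PreL2 w) :
    IsSolution J q w u (PreL2.fn w f) ↔ ∃ y, IsIntegralSolution a b (refMeasure q w) J
      (refCoeff q w) (refForcing q w (PreL2.fn w f)) u y := by
  have := sigmaFinite_traceMeasure w hab
  have := sigmaFinite_densityRep q hab
  have := sigmaFinite_refMeasure q w hab
  have hF : ∀ c ∈ openInterval a b, ∀ d ∈ openInterval a b,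
      IntegrableOn (refForcing q w (PreL2.fn w f)) (Icc c d) (refMeasure q w) := fun c hc d hd =>
    refForcing_integrableOn q hab f isCompact_Icc (Icc_subset_openInterval hc hd)
  have e1 : ∀ (φ : TestFunction (openInterval a b) ℝ ⊤) i, mulDist q u φ i
      = ∫ x, (φ x : ℂ) * ((refCoeff q w x).mulVec (u x)) i ∂refMeasure q w := by
    intro φ i
    rw [mulDist, ← integral_rnDeriv_smul (densityRep_absolutelyContinuous q w)]
    simp only [refCoeff, Matrix.smul_mulVec, Pi.smul_apply, mul_smul_comm]
  have e2 : ∀ (φ : TestFunction (openInterval a b) ℝ ⊤) i,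
      weightMulDist w (PreL2.fn w f) φ i
      = ∫ x, (φ x : ℂ) * refForcing q w (PreL2.fn w f) x i ∂refMeasure q w := by
    intro φ i
    rw [weightMulDist, ← integral_rnDeriv_smul (traceMeasure_absolutelyContinuous q w)]
    simp only [refForcing, Pi.smul_apply, mul_smul_comm]
  have i1 : ∀ (φ : TestFunction (openInterval a b) ℝ ⊤) i, Integrable
      (fun x => (φ x : ℂ) * ((refCoeff q w x).mulVec (u x)) i) (refMeasure q w) := by
    intro φ i
    have h := (integrable_rnDeriv_smul_iff (densityRep_absolutelyContinuous q w)).2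
      (mulDist_integrable q hu φ i)
    refine h.congr (Eventually.of_forall fun x => ?_)
    simp only [refCoeff, Matrix.smul_mulVec, Pi.smul_apply, mul_smul_comm]
  have i2 : ∀ (φ : TestFunction (openInterval a b) ℝ ⊤) i, Integrable
      (fun x => (φ x : ℂ) * refForcing q w (PreL2.fn w f) x i) (refMeasure q w) := by
    intro φ i
    have h := (integrable_rnDeriv_smul_iff (traceMeasure_absolutelyContinuous q w)).2
      (weightMulDist_integrable w f φ i)
    refine h.congr (Eventually.of_forall fun x => ?_)
    simp only [refForcing, Pi.smul_apply, mul_smul_comm]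
  have e3 : ∀ (φ : TestFunction (openInterval a b) ℝ ⊤) i,
      ∫ x, (φ x : ℂ) * (refForcing q w (PreL2.fn w f) x - (refCoeff q w x).mulVec (u x)) i
        ∂refMeasure q w = weightMulDist w (PreL2.fn w f) φ i - mulDist q u φ i := by
    intro φ i
    simp only [Pi.sub_apply, mul_sub]
    rw [integral_sub (i2 φ i) (i1 φ i), e1, e2]
  constructor
  · intro h
    refine exists_isIntegralSolution_of_integral_eq hA hu hF fun φ hφ hc hs i => ?_
    let φ' : TestFunction (openInterval a b) ℝ ⊤ := ⟨φ, hφ, hc, hs⟩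
    have h1 := congrFun (h φ') i
    rw [Pi.add_apply] at h1
    exact (eq_sub_of_add_eq h1).trans (e3 φ' i).symm
  · rintro ⟨y, hy⟩ φ
    ext i
    have h1 := hy.integral_eq hA φ.contDiff φ.hasCompactSupport φ.tsupport_subset i
    rw [e3] at h1
    rw [Pi.add_apply]
    exact add_eq_of_eq_sub h1

end Representation

end DistSystem

/-! ### Null functions, exhaustion and truncation in 𝓛²(w). -/

namespace DistSystem

variable {a b : EReal} {n : ℕ}

section WeightSpace

variable {w : MatrixDist a b n}

open scoped ComplexOrder in
theorem weightForm_self_eq_zero_iff (f : ℝ → Fin n → ℂ) (x : ℝ) :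
    weightForm w f f x = 0 ↔ (weightDensity w x).mulVec (f x) = 0 :=
  (weightDensity_posSemidef w x).dotProduct_mulVec_zero_iff (f x)

theorem weightForm_self_congr {f g : ℝ → Fin n → ℂ} {x : ℝ}
    (h : (weightDensity w x).mulVec (f x - g x) = 0) :
    weightForm w f f x = weightForm w g g x := by
  rw [Matrix.mulVec_sub, sub_eq_zero] at h
  rw [weightForm, h, ← weightForm, weightForm_eq_star_mulVec, h, ← weightForm_eq_star_mulVec]

open scoped ComplexOrder in
-- For positive semidefinite W, h* W h = 0 forces W h = 0. The resulting condition is linear in the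
-- functions and can be localised to intervals, which the gluing argument needs.
theorem PreL2.mk_eq_mk_iff (f g : PreL2 w) :
    (SeparationQuotient.mk f : L2 w) = SeparationQuotient.mk g ↔
      ∀ᵐ x ∂traceMeasure w, (weightDensity w x).mulVec (PreL2.fn w f x - PreL2.fn w g x) = 0 := by
  have e : ∀ x, PreL2.fn w (f - g) x = PreL2.fn w f x - PreL2.fn w g x := fun x => by
    rw [map_sub, Pi.sub_apply]
  have hi := PreL2.integrable (f - g) (f - g)
  have hn : 0 ≤ fun x => RCLike.re (weightForm w (PreL2.fn w (f - g)) (PreL2.fn w (f - g)) x) :=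
    fun x => (Complex.le_def.1 (weightForm_self_nonneg w (PreL2.fn w (f - g)) x)).1
  rw [SeparationQuotient.mk_eq_mk, Metric.inseparable_iff, dist_eq_norm, ← sq_eq_zero_iff,
    ← inner_self_eq_norm_sq (𝕜 := ℂ), PreL2.inner_def, ← integral_re hi,
    integral_eq_zero_iff_of_nonneg hn hi.re]
  refine eventually_congr (Eventually.of_forall fun x => ?_)
  rw [← e, ← weightForm_self_eq_zero_iff]
  have h := (Complex.le_def.1 (weightForm_self_nonneg w (PreL2.fn w (f - g)) x)).2
  rw [Complex.ext_iff]
  simp only [Complex.zero_im] at h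
  exact ⟨fun h0 => ⟨h0, h.symm⟩, fun h0 => h0.1⟩

theorem tendsto_setIntegral_exhaustion {c d : ℕ → ℝ} (hc : Antitone c) (hd : Monotone d)
    (hx : ∀ x ∈ openInterval a b, ∃ N, ∀ M, N ≤ M → c M < x ∧ x < d M) {h : ℝ → ℂ}
    (hh : Integrable h (traceMeasure w)) :
    Tendsto (fun N => ∫ x in Ico (c N) (d N), h x ∂traceMeasure w) atTop
      (𝓝 (∫ x, h x ∂traceMeasure w)) := by
  have h1 := tendsto_setIntegral_of_monotone (μ := traceMeasure w) (f := h)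
    (s := fun N => Ico (c N) (d N)) (fun N => measurableSet_Ico)
    (fun M N hMN => Ico_subset_Ico (hc hMN) (hd hMN)) hh.integrableOn
  rwa [setIntegral_eq_integral_of_ae_compl_eq_zero] at h1
  have hmem : ∀ᵐ x ∂traceMeasure w, x ∈ (openInterval a b : Set ℝ) := traceMeasure_compl w
  filter_upwards [hmem] with x hxI hx'
  obtain ⟨N, hN⟩ := hx x hxI
  have hxN : x ∈ Ico (c N) (d N) := ⟨(hN N le_rfl).1.le, (hN N le_rfl).2⟩
  exact absurd (mem_iUnion.2 ⟨N, hxN⟩) hx'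

theorem ae_traceMeasure_of_exhaustion {c d : ℕ → ℝ}
    (hx : ∀ x ∈ openInterval a b, ∃ N, ∀ M, N ≤ M → c M < x ∧ x < d M) {p : ℝ → Prop}
    (hp : ∀ N, ∀ᵐ x ∂(traceMeasure w).restrict (Ico (c N) (d N)), p x) :
    ∀ᵐ x ∂traceMeasure w, p x := by
  have hmem : ∀ᵐ x ∂traceMeasure w, x ∈ (openInterval a b : Set ℝ) := traceMeasure_compl w
  filter_upwards [hmem, ae_all_iff.2 fun N => (ae_restrict_iff' measurableSet_Ico).1 (hp N)]
    with x hxI h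
  obtain ⟨N, hN⟩ := hx x hxI
  exact h N ⟨(hN N le_rfl).1.le, (hN N le_rfl).2⟩

theorem aemeasurable_traceMeasure_of_mem_balancedBV (hab : a < b) {u : ℝ → Fin n → ℂ}
    (hu : u ∈ balancedBV a b n) : AEMeasurable u (traceMeasure w) := by
  obtain ⟨c, d, hc, hd, -, -, -, hx⟩ := exists_exhaustion hab
  have hU : (openInterval a b : Set ℝ) ⊆ ⋃ N, Icc (c N) (d N) := fun x hxI => by
    obtain ⟨N, hN⟩ := hx x hxI
    exact mem_iUnion.2 ⟨N, (hN N le_rfl).1.le, (hN N le_rfl).2.le⟩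
  rw [← traceMeasure_restrict]
  exact AEMeasurable.mono_set hU (aemeasurable_iUnion_iff.2 fun N =>
    (aemeasurable_bounded_of_mem_balancedBV hu (hc N) (hd N) _).1)

theorem weightForm_integrableOn_of_mem_balancedBV {u : ℝ → Fin n → ℂ}
    (hu : u ∈ balancedBV a b n) {c d : ℝ} (hc : c ∈ openInterval a b)
    (hd : d ∈ openInterval a b) :
    IntegrableOn (weightForm w u u) (Icc c d) (traceMeasure w) := by
  obtain ⟨hm, C, hC⟩ := aemeasurable_bounded_of_mem_balancedBV hu hc hd (traceMeasure w)
  have hC' : ∀ i, ∀ x ∈ Icc c d, ‖u x i‖ ≤ C := fun i x hx =>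
    (norm_le_pi_norm (u x) i).trans (hC x hx)
  have hm' : ∀ i, AEStronglyMeasurable (fun x => u x i) ((traceMeasure w).restrict (Icc c d)) :=
    fun i => (aemeasurable_pi_iff.1 hm i).aestronglyMeasurable
  have h : weightForm w u u = fun x => ∑ i, star (u x i) * ∑ j, weightDensity w x i j * u x j := by
    ext x
    simp [weightForm, dotProduct, Matrix.mulVec]
  rw [h]
  refine integrable_finsetSum _ fun i _ => Integrable.bdd_mul (c := C)
    (integrable_finsetSum _ fun j _ => Integrable.mul_bdd (c := C)
      (weightDensity_integrableOn w isCompact_Icc (Icc_subset_openInterval hc hd) i j) (hm' j) ?_)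
    (Complex.continuous_conj.comp_aestronglyMeasurable (hm' i)) ?_
  · exact ae_restrict_of_forall_mem measurableSet_Icc (hC' j)
  · exact ae_restrict_of_forall_mem measurableSet_Icc fun x hx => by
      rw [norm_star]; exact hC' i x hx

theorem mem_squareIntegrable_of_mem_balancedBV (hab : a < b) {u : ℝ → Fin n → ℂ}
    (hu : u ∈ balancedBV a b n) {c d : ℝ} (hc : c ∈ openInterval a b)
    (hd : d ∈ openInterval a b) (h0 : ∀ x ∈ openInterval a b, x ∉ Icc c d → u x = 0) :
    u ∈ squareIntegrable w := by
  refine ⟨aemeasurable_traceMeasure_of_mem_balancedBV hab hu, ?_⟩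
  refine (weightForm_integrableOn_of_mem_balancedBV hu hc hd).integrable_of_ae_notMem_eq_zero ?_
  have hmem : ∀ᵐ x ∂traceMeasure w, x ∈ (openInterval a b : Set ℝ) := traceMeasure_compl w
  filter_upwards [hmem] with x hx hx'
  simp [weightForm, h0 x hx hx']

theorem weightForm_indicator_left (s : Set ℝ) (f g : ℝ → Fin n → ℂ) :
    weightForm w (s.indicator f) g = s.indicator (weightForm w f g) := by
  ext x
  by_cases hx : x ∈ s <;> simp [weightForm, hx]

theorem weightForm_indicator_right (s : Set ℝ) (f g : ℝ → Fin n → ℂ) :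
    weightForm w f (s.indicator g) = s.indicator (weightForm w f g) := by
  ext x
  by_cases hx : x ∈ s <;> simp [weightForm, hx]

theorem indicator_mem_squareIntegrable {s : Set ℝ} (hs : MeasurableSet s) {f : ℝ → Fin n → ℂ}
    (hf : AEMeasurable f (traceMeasure w)) (hi : IntegrableOn (weightForm w f f) s (traceMeasure w)) :
    s.indicator f ∈ squareIntegrable w := by
  refine ⟨hf.indicator hs, ?_⟩
  rwa [weightForm_indicator_left, weightForm_indicator_right, indicator_indicator, inter_self,
    integrable_indicator_iff hs]

theorem indicator_mem_squareIntegrable_of_mem_balancedBV (hab : a < b) {u : ℝ → Fin n → ℂ}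
    (hu : u ∈ balancedBV a b n) {c d : ℝ} (hc : c ∈ openInterval a b)
    (hd : d ∈ openInterval a b) : (Ico c d).indicator u ∈ squareIntegrable w :=
  indicator_mem_squareIntegrable measurableSet_Ico
    (aemeasurable_traceMeasure_of_mem_balancedBV hab hu)
    ((weightForm_integrableOn_of_mem_balancedBV hu hc hd).mono_set Ico_subset_Icc_self)

end WeightSpace

section Lagrange

variable {J : Matrix (Fin n) (Fin n) ℂ} {q w : MatrixDist a b n}

theorem refForcing_zero : refForcing q w (PreL2.fn w 0) = 0 := by
  ext x
  simp [refForcing]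

theorem lagrange_refForcing (hab : a < b)
    (hA : IsCoefficient a b (refMeasure q w) J (refCoeff q w)) {f g : PreL2 w}
    {u y v z : ℝ → Fin n → ℂ}
    (h : IsIntegralSolution a b (refMeasure q w) J (refCoeff q w)
      (refForcing q w (PreL2.fn w f)) u y)
    (h' : IsIntegralSolution a b (refMeasure q w) J (refCoeff q w)
      (refForcing q w (PreL2.fn w g)) v z) {c d : ℝ}
    (hc : c ∈ openInterval a b) (hd : d ∈ openInterval a b) (hcd : c ≤ d) :
    star (y d) ⬝ᵥ J.mulVec (z d) - star (y c) ⬝ᵥ J.mulVec (z c)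
      = (∫ x in Ico c d, weightForm w u (PreL2.fn w g) x ∂traceMeasure w)
        - ∫ x in Ico c d, weightForm w (PreL2.fn w f) v x ∂traceMeasure w := by
  have := sigmaFinite_traceMeasure w hab
  have := sigmaFinite_refMeasure q w hab
  have hac := traceMeasure_absolutelyContinuous q w
  have hbv : ∀ {F u y : ℝ → Fin n → ℂ}, IsIntegralSolution a b (refMeasure q w) J
      (refCoeff q w) F u y → AEMeasurable u ((traceMeasure w).restrict (Ico c d)) ∧
      IntegrableOn (weightForm w u u) (Ico c d) (traceMeasure w) := fun h =>
    ⟨(aemeasurable_traceMeasure_of_mem_balancedBV hab (h.mem_balancedBV hA.isUnit)).restrict,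
      (weightForm_integrableOn_of_mem_balancedBV (h.mem_balancedBV hA.isUnit) hc hd).mono_set
        Ico_subset_Icc_self⟩
  have i1 : IntegrableOn (weightForm w u (PreL2.fn w g)) (Ico c d) (traceMeasure w) :=
    weightForm_integrable w (hbv h).1 (PreL2.aemeasurable g).restrict (hbv h).2
      (PreL2.integrable g g).integrableOn
  have i2 : IntegrableOn (weightForm w (PreL2.fn w f) v) (Ico c d) (traceMeasure w) :=
    weightForm_integrable w (PreL2.aemeasurable f).restrict (hbv h').1
      (PreL2.integrable f f).integrableOn (hbv h').2
  rw [h.lagrange hA h' hc hd hcd]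
  simp only [dotProduct_refForcing, refForcing_dotProduct]
  rw [integral_sub ((integrableOn_rnDeriv_smul_iff hac measurableSet_Ico).2 i1)
    ((integrableOn_rnDeriv_smul_iff hac measurableSet_Ico).2 i2),
    setIntegral_rnDeriv_smul hac measurableSet_Ico, setIntegral_rnDeriv_smul hac measurableSet_Ico]

end Lagrange

end DistSystem

/-! ### Homogeneous solutions, and the inclusion T_max ⊆ T_min*. -/

namespace DistSystem

variable {a b : EReal} {n : ℕ}

/-- The pairs of a solution of the homogeneous equation and its left-continuous version. -/
def homogeneousSolutions (a b : EReal) (ν : Measure ℝ) (J : Matrix (Fin n) (Fin n) ℂ)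
    (A : ℝ → Matrix (Fin n) (Fin n) ℂ) :
    Submodule ℂ ((ℝ → Fin n → ℂ) × (ℝ → Fin n → ℂ)) where
  carrier := {p | IsIntegralSolution a b ν J A 0 p.1 p.2}
  zero_mem' := IsIntegralSolution.zero
  add_mem' := fun {p r} hp hr => by
    have := IsIntegralSolution.add hp hr
    rwa [add_zero] at this
  smul_mem' := fun r p hp => by
    have := IsIntegralSolution.smul r hp
    rwa [smul_zero] at this

/-- Evaluation of the left-hand limit at `c` maps the homogeneous solutions onto ℂⁿ. A linear right
inverse selects them linearly in the initial value, without any appeal to uniqueness. -/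
theorem exists_fundamental_system {ν : Measure ℝ} [SFinite ν] {J : Matrix (Fin n) (Fin n) ℂ}
    {A : ℝ → Matrix (Fin n) (Fin n) ℂ} (hA : IsCoefficient a b ν J A) {c : ℝ}
    (hc : c ∈ openInterval a b) :
    ∃ U Y : (Fin n → ℂ) →ₗ[ℂ] (ℝ → Fin n → ℂ),
      ∀ ξ, IsIntegralSolution a b ν J A 0 (U ξ) (Y ξ) ∧ Y ξ c = ξ := by
  let e : homogeneousSolutions a b ν J A →ₗ[ℂ] (Fin n → ℂ) :=
    LinearMap.proj c ∘ₗ LinearMap.snd ℂ _ _ ∘ₗ (homogeneousSolutions a b ν J A).subtype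
  obtain ⟨g, hg⟩ := e.exists_rightInverse_of_surjective <| LinearMap.range_eq_top.2 fun ξ => by
    obtain ⟨u, y, h, hy⟩ := exists_isIntegralSolution hA (F := 0) aestronglyMeasurable_const
      (fun _ _ _ _ => integrableOn_zero) hc ξ
    exact ⟨⟨(u, y), h⟩, hy⟩
  exact ⟨LinearMap.fst ℂ _ _ ∘ₗ (homogeneousSolutions a b ν J A).subtype ∘ₗ g,
    LinearMap.snd ℂ _ _ ∘ₗ (homogeneousSolutions a b ν J A).subtype ∘ₗ g,
    fun ξ => ⟨(g ξ).2, LinearMap.congr_fun hg ξ⟩⟩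

open scoped ComplexOrder in
theorem eq_zero_of_forall_star_dotProduct {v : Fin n → ℂ} (h : ∀ ξ, star ξ ⬝ᵥ v = 0) : v = 0 :=
  dotProduct_star_self_eq_zero.1 (h v)

/-- By Lagrange's identity Y(x)* J Y(x) = J for all x. Hence Y(x) is injective, and in finite
dimension surjective. -/
theorem IsCoefficient.fundamental_system_surjective {ν : Measure ℝ} [SFinite ν]
    {J : Matrix (Fin n) (Fin n) ℂ} {A : ℝ → Matrix (Fin n) (Fin n) ℂ}
    (hA : IsCoefficient a b ν J A) {c x : ℝ} (hc : c ∈ openInterval a b)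
    (hx : x ∈ openInterval a b) {U Y : (Fin n → ℂ) →ₗ[ℂ] (ℝ → Fin n → ℂ)}
    (hUY : ∀ ξ, IsIntegralSolution a b ν J A 0 (U ξ) (Y ξ) ∧ Y ξ c = ξ) (η : Fin n → ℂ) :
    ∃ ξ, Y ξ x = η := by
  have hW : ∀ ξ η, star (Y ξ x) ⬝ᵥ J.mulVec (Y η x) = star ξ ⬝ᵥ J.mulVec η := by
    intro ξ η
    rcases le_total c x with hcx | hcx
    · have h := (hUY ξ).1.lagrange hA (hUY η).1 hc hx hcx
      simpa [(hUY ξ).2, (hUY η).2, sub_eq_zero] using h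
    · have h := (hUY ξ).1.lagrange hA (hUY η).1 hx hc hcx
      rw [(hUY ξ).2, (hUY η).2] at h
      exact (sub_eq_zero.1 (h.trans (by simp))).symm
  have hinj : Function.Injective (LinearMap.proj x ∘ₗ Y : (Fin n → ℂ) →ₗ[ℂ] (Fin n → ℂ)) := by
    rw [← LinearMap.ker_eq_bot, LinearMap.ker_eq_bot']
    intro η hη
    have hη' : Y η x = 0 := hη
    refine mulVec_injective hA.isUnit ((eq_zero_of_forall_star_dotProduct fun ξ => ?_).trans
      (Matrix.mulVec_zero J).symm)
    rw [← hW, hη', Matrix.mulVec_zero, dotProduct_zero]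
  exact LinearMap.injective_iff_surjective.1 hinj η

section Relation

variable {J : Matrix (Fin n) (Fin n) ℂ} {q w : MatrixDist a b n}

/-- Lagrange's identity along an exhaustion: once the interval contains the support of `u`, both
boundary terms vanish, and the limit yields ⟨f, v⟩ = ⟨u, g⟩. -/
theorem maximalRelation_le_adjoint (hab : a < b)
    (hA : IsCoefficient a b (refMeasure q w) J (refCoeff q w)) :
    maximalRelation J q w ≤ (minimalRelation J q w).adjoint := by
  rintro _ ⟨⟨v, g⟩, ⟨hv, hvg⟩, rfl⟩
  rw [Submodule.mem_adjoint_iff]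
  rintro _ _ ⟨⟨u, f⟩, ⟨⟨hu, huf⟩, K, hK, hKs, hK0⟩, h⟩
  obtain ⟨rfl, rfl⟩ := Prod.ext_iff.1 h
  change inner ℂ f v - inner ℂ u g = 0
  obtain ⟨y, hy⟩ := (isSolution_iff q hab hA hu f).1 huf
  obtain ⟨z, hz⟩ := (isSolution_iff q hab hA hv g).1 hvg
  obtain ⟨c, d, hc, hd, hcm, hdm, hcd, hx⟩ := exists_exhaustion hab
  obtain ⟨r, hr, s, hs, -, hrs⟩ := exists_Ioo_superset ⟨c 0, hc 0⟩ hK hKs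
  obtain ⟨N₁, hN₁⟩ := hx r hr
  obtain ⟨N₂, hN₂⟩ := hx s hs
  have hy0 : ∀ x ∈ openInterval a b, x ≤ r ∨ s < x → y x = 0 := by
    intro x hxI hxrs
    refine tendsto_nhds_unique (hy.tendsto_left hA.isUnit hxI)
      (tendsto_const_nhds.congr' (EventuallyEq.symm ?_))
    obtain ⟨t, ht, htx⟩ := exists_mem_lt hxI
    rcases hxrs with hxr | hsx
    · filter_upwards [Ioo_mem_nhdsLT htx] with t' ht'
      exact hK0 t' (Icc_subset_openInterval ht hxI ⟨ht'.1.le, ht'.2.le⟩) fun h =>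
        absurd (hrs h).1 (not_lt.2 (ht'.2.le.trans hxr))
    · filter_upwards [Ioo_mem_nhdsLT hsx, Ioo_mem_nhdsLT htx] with t' ht' ht''
      exact hK0 t' (Icc_subset_openInterval ht hxI ⟨ht''.1.le, ht''.2.le⟩) fun h =>
        absurd (hrs h).2 (not_lt.2 ht'.1.le)
  have hlim := (tendsto_setIntegral_exhaustion hcm hdm hx (PreL2.integrable u g)).sub
    (tendsto_setIntegral_exhaustion hcm hdm hx (PreL2.integrable f v))
  have h0 := tendsto_nhds_unique_of_eventuallyEq hlim (tendsto_const_nhds (x := (0 : ℂ))) ?_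
  · rw [PreL2.inner_def, PreL2.inner_def, ← neg_sub, h0, neg_zero]
  · filter_upwards [eventually_ge_atTop N₁, eventually_ge_atTop N₂] with M hM₁ hM₂
    rw [← lagrange_refForcing hab hA hy hz (hc M) (hd M) (hcd M).le,
      hy0 _ (hd M) (Or.inr (hN₂ M hM₂).2), hy0 _ (hc M) (Or.inl (hN₁ M hM₁).1.le)]
    simp

/-- A forcing term supported in `[c, d)` and orthogonal there to the solutions of the homogeneous
equation admits a solution supported in `[c, d)`. -/
theorem exists_solution_supported (hab : a < b)
    (hA : IsCoefficient a b (refMeasure q w) J (refCoeff q w)) {c₀ c d : ℝ}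
    (hc₀ : c₀ ∈ openInterval a b) (hc : c ∈ openInterval a b) (hd : d ∈ openInterval a b)
    (hcd : c ≤ d) {U Y : (Fin n → ℂ) →ₗ[ℂ] (ℝ → Fin n → ℂ)}
    (hUY : ∀ ξ, IsIntegralSolution a b (refMeasure q w) J (refCoeff q w) 0 (U ξ) (Y ξ) ∧
      Y ξ c₀ = ξ) {f : PreL2 w} (hf : ∀ x ∉ Ico c d, PreL2.fn w f x = 0)
    (horth : ∀ ξ, ∫ x in Ico c d, weightForm w (U ξ) (PreL2.fn w f) x ∂traceMeasure w = 0) :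
    ∃ u y : ℝ → Fin n → ℂ, IsIntegralSolution a b (refMeasure q w) J (refCoeff q w)
      (refForcing q w (PreL2.fn w f)) u y ∧ y c = 0 ∧ y d = 0 ∧
      ∀ x ∈ openInterval a b, x ∉ Ico c d → u x = 0 := by
  have := sigmaFinite_refMeasure q w hab
  obtain ⟨u, y, h, hyc⟩ := exists_isIntegralSolution hA
    (refForcing_aestronglyMeasurable q hab f) (fun c hc d hd =>
      refForcing_integrableOn q hab f isCompact_Icc (Icc_subset_openInterval hc hd)) hc 0
  have hU0 : ∀ ξ, IsIntegralSolution a b (refMeasure q w) J (refCoeff q w)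
      (refForcing q w (PreL2.fn w 0)) (U ξ) (Y ξ) := fun ξ => by
    rw [refForcing_zero]; exact (hUY ξ).1
  have hlag : ∀ ξ, ∀ r ∈ openInterval a b, ∀ s ∈ openInterval a b, r ≤ s →
      star (Y ξ s) ⬝ᵥ J.mulVec (y s) - star (Y ξ r) ⬝ᵥ J.mulVec (y r)
      = ∫ x in Ico r s, weightForm w (U ξ) (PreL2.fn w f) x ∂traceMeasure w := by
    intro ξ r hr s hs hrs
    rw [lagrange_refForcing hab hA (hU0 ξ) h hr hs hrs]
    simp [weightForm]
  have hzero : ∀ x ∈ openInterval a b, (∀ ξ, star (Y ξ x) ⬝ᵥ J.mulVec (y x) = 0) → y x = 0 := by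
    intro x hx h0
    refine mulVec_injective hA.isUnit ((eq_zero_of_forall_star_dotProduct fun η => ?_).trans
      (Matrix.mulVec_zero J).symm)
    obtain ⟨ξ, rfl⟩ := hA.fundamental_system_surjective hc₀ hx hUY η
    exact h0 ξ
  have hvanish : ∀ ξ r s, Disjoint (Ico r s) (Ico c d) →
      ∫ x in Ico r s, weightForm w (U ξ) (PreL2.fn w f) x ∂traceMeasure w = 0 := by
    intro ξ r s hrs
    refine setIntegral_eq_zero_of_forall_eq_zero fun x hx => ?_
    simp [weightForm, hf x (disjoint_left.1 hrs hx)]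
  -- Starting from y(c) = 0, Lagrange's identity turns the orthogonality into (Y ξ)(d)* J y(d) = 0
  -- for all ξ, and the vectors (Y ξ)(d) fill ℂⁿ.
  have hyd : y d = 0 := by
    refine hzero d hd fun ξ => ?_
    have := hlag ξ c hc d hd hcd
    rwa [horth, hyc, Matrix.mulVec_zero, dotProduct_zero, sub_zero] at this
  have hy0 : ∀ x ∈ openInterval a b, x ∉ Ico c d → y x = 0 := by
    intro x hx hxcd
    refine hzero x hx fun ξ => ?_
    rcases lt_or_ge x c with hxc | hcx
    · have := hlag ξ x hx c hc hxc.le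
      rwa [hvanish ξ x c (disjoint_left.2 fun t ht ht' => absurd ht.2 (not_lt.2 ht'.1)), hyc,
        Matrix.mulVec_zero, dotProduct_zero, zero_sub, neg_eq_zero] at this
    · have hdx : d ≤ x := not_lt.1 fun hlt => hxcd ⟨hcx, hlt⟩
      have := hlag ξ d hd x hx hdx
      rwa [hvanish ξ d x (disjoint_left.2 fun t ht ht' => absurd ht'.2 (not_lt.2 ht.1)), hyd,
        Matrix.mulVec_zero, dotProduct_zero, sub_zero] at this
  refine ⟨u, y, h, hyc, hyd, fun x hx hxcd => ?_⟩
  -- With y(x) = 0 and F(x) = 0 the balance condition reads (2J + Δ)u(x) = 0. This covers x = d,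
  -- whereas u(c) may be nonzero although y(c) = 0.
  have hb := h.balanced x hx
  have hF : refForcing q w (PreL2.fn w f) x = 0 := by simp [refForcing, hf x hxcd]
  rw [hy0 x hx hxcd, hF, Matrix.mulVec_zero, zero_add, zero_sub] at hb
  refine mulVec_injective (hA.isUnit_add x hx) ?_
  rw [Matrix.mulVec_zero, Matrix.add_mulVec, Matrix.smul_mulVec, Matrix.smul_mulVec, hb, smul_smul,
    smul_neg, mul_div_cancel₀ _ (two_ne_zero' ℂ), neg_add_cancel]

end Relation

end DistSystem

/-! ### The inclusion T_min* ⊆ T_max. -/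

namespace DistSystem

variable {a b : EReal} {n : ℕ} {J : Matrix (Fin n) (Fin n) ℂ} {q w : MatrixDist a b n}

/-- Solving the homogeneous equation and restricting to `[c, d)`, as a linear map into `𝓛²(w)`. -/
theorem exists_indicator_linearMap (hab : a < b) {c d : ℝ} (hc : c ∈ openInterval a b)
    (hd : d ∈ openInterval a b) {E : Type*} [AddCommGroup E] [Module ℂ E]
    (U : E →ₗ[ℂ] (ℝ → Fin n → ℂ)) (hU : ∀ ξ, U ξ ∈ balancedBV a b n) :
    ∃ κ : E →ₗ[ℂ] PreL2 w, ∀ ξ, PreL2.fn w (κ ξ) = (Ico c d).indicator (U ξ) := by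
  let κ : E →ₗ[ℂ] squareIntegrable w :=
    { toFun ξ := ⟨(Ico c d).indicator (U ξ),
        indicator_mem_squareIntegrable_of_mem_balancedBV hab (hU ξ) hc hd⟩
      map_add' ξ η := Subtype.ext <| by
        change (Ico c d).indicator (U (ξ + η))
          = (Ico c d).indicator (U ξ) + (Ico c d).indicator (U η)
        rw [map_add, indicator_add']
      map_smul' r ξ := Subtype.ext <| by
        change (Ico c d).indicator (U (r • ξ)) = r • (Ico c d).indicator (U ξ)
        rw [map_smul]
        exact indicator_const_smul (Ico c d) r (U ξ) }
  exact ⟨κ, fun ξ => rfl⟩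

theorem inner_eq_setIntegral_right {f g : PreL2 w} {s : Set ℝ} (hs : MeasurableSet s)
    {u : ℝ → Fin n → ℂ} (hg : PreL2.fn w g = s.indicator u) :
    inner ℂ f g = ∫ x in s, weightForm w (PreL2.fn w f) u x ∂traceMeasure w := by
  rw [PreL2.inner_def, hg, weightForm_indicator_right, integral_indicator hs]

theorem inner_eq_setIntegral_left {f g : PreL2 w} {s : Set ℝ} (hs : MeasurableSet s)
    {u : ℝ → Fin n → ℂ} (hf : PreL2.fn w f = s.indicator u) :
    inner ℂ f g = ∫ x in s, weightForm w u (PreL2.fn w g) x ∂traceMeasure w := by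
  rw [PreL2.inner_def, hf, weightForm_indicator_left, integral_indicator hs]

/-- On `[c, d)`, an element of the adjoint of the minimal relation differs from a solution of the
inhomogeneous equation by a solution of the homogeneous one. -/
theorem exists_homogeneous_on_Ico (hab : a < b)
    (hA : IsCoefficient a b (refMeasure q w) J (refCoeff q w)) {c₀ c d : ℝ}
    (hc₀ : c₀ ∈ openInterval a b) (hc : c ∈ openInterval a b) (hd : d ∈ openInterval a b)
    (hcd : c ≤ d) {U Y : (Fin n → ℂ) →ₗ[ℂ] (ℝ → Fin n → ℂ)}
    (hUY : ∀ ξ, IsIntegralSolution a b (refMeasure q w) J (refCoeff q w) 0 (U ξ) (Y ξ) ∧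
      Y ξ c₀ = ξ) {v g : PreL2 w} {v₁ y₁ : ℝ → Fin n → ℂ}
    (h₁ : IsIntegralSolution a b (refMeasure q w) J (refCoeff q w)
      (refForcing q w (PreL2.fn w g)) v₁ y₁)
    (hvg : ∀ u f : PreL2 w, (u, f) ∈ preMinimal J q w → inner ℂ f v = inner ℂ u g) :
    ∃ ξ, ∀ᵐ x ∂(traceMeasure w).restrict (Ico c d),
      (weightDensity w x).mulVec (PreL2.fn w v x - v₁ x - U ξ x) = 0 := by
  obtain ⟨κ, hκ⟩ := exists_indicator_linearMap (w := w) hab hc hd U fun ξ =>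
    (hUY ξ).1.mem_balancedBV hA.isUnit
  have hcut : ∀ f : PreL2 w, ∃ f' : PreL2 w,
      PreL2.fn w f' = (Ico c d).indicator (PreL2.fn w f) := fun f =>
    ⟨⟨_, indicator_mem_squareIntegrable measurableSet_Ico (PreL2.aemeasurable f)
      (PreL2.integrable f f).integrableOn⟩, rfl⟩
  obtain ⟨v', hv'⟩ := hcut v
  obtain ⟨p, hp⟩ : ∃ p : PreL2 w, PreL2.fn w p = (Ico c d).indicator v₁ :=
    ⟨⟨_, indicator_mem_squareIntegrable_of_mem_balancedBV hab (h₁.mem_balancedBV hA.isUnit) hc hd⟩,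
      rfl⟩
  let K : Submodule ℂ (L2 w) :=
    ((SeparationQuotient.mkCLM ℂ (PreL2 w)).toLinearMap ∘ₗ κ).range
  have hmem : (SeparationQuotient.mk (v' - p) : L2 w) ∈ K := by
    -- K, the classes of truncated homogeneous solutions, is finite-dimensional and thus equals its
    -- double orthogonal complement. It remains to test v' - p against f orthogonal to K, and only
    -- the truncation of f to [c, d) matters.
    rw [← K.orthogonal_orthogonal, Submodule.mem_orthogonal]
    intro k hk
    obtain ⟨f, rfl⟩ := SeparationQuotient.surjective_mk k
    obtain ⟨f', hf'⟩ := hcut f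
    rw [Submodule.mem_orthogonal] at hk
    have horth : ∀ ξ, ∫ x in Ico c d, weightForm w (U ξ) (PreL2.fn w f') x ∂traceMeasure w = 0 := by
      intro ξ
      have h0 : inner ℂ (κ ξ) f = 0 := hk _ ⟨ξ, rfl⟩
      rw [inner_eq_setIntegral_left measurableSet_Ico (hκ ξ)] at h0
      rw [hf', weightForm_indicator_right, setIntegral_indicator measurableSet_Ico, inter_self, h0]
    obtain ⟨u, y, hu, hyc, hyd, hu0⟩ := exists_solution_supported hab hA hc₀ hc hd hcd hUY
      (f := f') (fun x hx => by rw [hf', indicator_of_notMem hx]) horth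
    have hubv := hu.mem_balancedBV hA.isUnit
    have hu0' : ∀ x ∈ openInterval a b, x ∉ Icc c d → u x = 0 := fun x hx hx' =>
      hu0 x hx fun h => hx' (Ico_subset_Icc_self h)
    obtain ⟨u', hu'⟩ : ∃ u' : PreL2 w, PreL2.fn w u' = u :=
      ⟨⟨u, mem_squareIntegrable_of_mem_balancedBV hab hubv hc hd hu0'⟩, rfl⟩
    have hmin : (u', f') ∈ preMinimal J q w := by
      refine ⟨⟨?_, ?_⟩, Icc c d, isCompact_Icc, Icc_subset_openInterval hc hd, ?_⟩
      · change PreL2.fn w u' ∈ _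
        rwa [hu']
      · change IsSolution J q w (PreL2.fn w u') (PreL2.fn w f')
        rw [hu']
        exact (isSolution_iff q hab hA hubv f').2 ⟨y, hu⟩
      · change ∀ x ∈ openInterval a b, x ∉ Icc c d → PreL2.fn w u' x = 0
        rwa [hu']
    -- Since y(c) = y(d) = 0, this says ⟨u, g⟩ = ⟨f', v₁⟩ over [c, d), while membership in the
    -- adjoint gives ⟨f', v⟩ = ⟨u, g⟩.
    have h2 := lagrange_refForcing hab hA hu h₁ hc hd hcd
    have h3 : ∫ x in Ico c d, weightForm w u (PreL2.fn w g) x ∂traceMeasure w = inner ℂ u' g := by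
      rw [PreL2.inner_def, hu']
      refine setIntegral_eq_integral_of_ae_compl_eq_zero ?_
      have hI : ∀ᵐ x ∂traceMeasure w, x ∈ (openInterval a b : Set ℝ) := traceMeasure_compl w
      filter_upwards [hI] with x hx hx'
      simp [weightForm, hu0 x hx hx']
    rw [hyc, hyd, h3, ← hvg u' f' hmin, ← inner_eq_setIntegral_right measurableSet_Ico hp,
      ← inner_sub_right] at h2
    have h4 : inner ℂ f' (v - p) = inner ℂ f (v' - p) := by
      have e : PreL2.fn w (v' - p) = (Ico c d).indicator (PreL2.fn w (v - p)) := by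
        rw [map_sub, map_sub, hv', hp, indicator_sub', indicator_indicator, inter_self]
      rw [inner_eq_setIntegral_left measurableSet_Ico hf',
        inner_eq_setIntegral_right measurableSet_Ico e]
    rw [h4] at h2
    rw [SeparationQuotient.inner_mk_mk, ← h2]
    simp
  obtain ⟨ξ, hξ⟩ := hmem
  have hξ' : (SeparationQuotient.mk (v' - p) : L2 w) = SeparationQuotient.mk (κ ξ) := hξ.symm
  rw [PreL2.mk_eq_mk_iff] at hξ'
  refine ⟨ξ, (ae_restrict_iff' measurableSet_Ico).2 (hξ'.mono fun x hx hxm => ?_)⟩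
  rwa [map_sub, Pi.sub_apply, hv', hp, hκ, indicator_of_mem hxm, indicator_of_mem hxm,
    indicator_of_mem hxm] at hx

/-- The vectors ξ N of the single intervals are determined only modulo Z N, the initial values whose
solutions are null on the N-th interval. These subspaces of ℂⁿ decrease and become constant at some
N, and then ξ N works on every interval. -/
theorem exists_homogeneous (hab : a < b)
    (hA : IsCoefficient a b (refMeasure q w) J (refCoeff q w)) {v g : PreL2 w}
    {v₁ y₁ : ℝ → Fin n → ℂ}
    (h₁ : IsIntegralSolution a b (refMeasure q w) J (refCoeff q w)
      (refForcing q w (PreL2.fn w g)) v₁ y₁)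
    (hvg : ∀ u f : PreL2 w, (u, f) ∈ preMinimal J q w → inner ℂ f v = inner ℂ u g) :
    ∃ u y : ℝ → Fin n → ℂ, IsIntegralSolution a b (refMeasure q w) J (refCoeff q w) 0 u y ∧
      ∀ᵐ x ∂traceMeasure w, (weightDensity w x).mulVec (PreL2.fn w v x - v₁ x - u x) = 0 := by
  have := sigmaFinite_refMeasure q w hab
  obtain ⟨c, d, hc, hd, hcm, hdm, hcd, hx⟩ := exists_exhaustion hab
  obtain ⟨U, Y, hUY⟩ := exists_fundamental_system hA (hc 0)
  choose ξ hξ using fun N => exists_homogeneous_on_Ico hab hA (hc 0) (hc N) (hd N) (hcd N).le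
    hUY h₁ hvg
  let Z : ℕ → Submodule ℂ (Fin n → ℂ) := fun N =>
    { carrier := {η | ∀ᵐ x ∂(traceMeasure w).restrict (Ico (c N) (d N)),
        (weightDensity w x).mulVec (U η x) = 0}
      zero_mem' := by
        change ∀ᵐ x ∂_, _
        simp
      add_mem' := fun {η ζ} hη hζ => by
        change ∀ᵐ x ∂_, _
        filter_upwards [hη, hζ] with x h h'
        rw [map_add, Pi.add_apply, Matrix.mulVec_add, h, h', add_zero]
      smul_mem' := fun r η hη => by
        change ∀ᵐ x ∂_, _
        filter_upwards [hη] with x h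
        rw [map_smul, Pi.smul_apply, Matrix.mulVec_smul, h, smul_zero] }
  have hsub : ∀ {M N}, M ≤ N → Ico (c M) (d M) ⊆ Ico (c N) (d N) := fun h =>
    Ico_subset_Ico (hcm h) (hdm h)
  have hZ : Antitone Z := fun M N hMN η hη => ae_restrict_of_ae_restrict_of_subset (hsub hMN) hη
  obtain ⟨N, hN⟩ := IsArtinian.monotone_stabilizes ⟨fun k => OrderDual.toDual (Z k), hZ⟩
  refine ⟨U (ξ N), Y (ξ N), (hUY _).1, ae_traceMeasure_of_exhaustion hx fun M => ?_⟩
  have hmax : ∀ᵐ x ∂(traceMeasure w).restrict (Ico (c (max M N)) (d (max M N))),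
      (weightDensity w x).mulVec (PreL2.fn w v x - v₁ x - U (ξ N) x) = 0 := by
    -- On the smaller interval both vectors represent v - v₁, so the difference is null there; as Z
    -- N = Z (max M N), it is null on the larger interval as well.
    have hmem : ξ (max M N) - ξ N ∈ Z N := by
      change ∀ᵐ x ∂_, _
      filter_upwards [hξ N, ae_restrict_of_ae_restrict_of_subset (hsub (le_max_right M N))
        (hξ (max M N))] with x h h'
      have e : U (ξ (max M N) - ξ N) x = (PreL2.fn w v x - v₁ x - U (ξ N) x)
          - (PreL2.fn w v x - v₁ x - U (ξ (max M N)) x) := by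
        rw [map_sub, Pi.sub_apply]; abel
      rw [e, Matrix.mulVec_sub, h, h', sub_zero]
    rw [show Z N = Z (max M N) from hN _ (le_max_right M N)] at hmem
    filter_upwards [hξ (max M N), hmem] with x h h'
    have e : PreL2.fn w v x - v₁ x - U (ξ N) x = (PreL2.fn w v x - v₁ x - U (ξ (max M N)) x)
        + U (ξ (max M N) - ξ N) x := by
      rw [map_sub, Pi.sub_apply]; abel
    rw [e, Matrix.mulVec_add, h, h', add_zero]
  exact ae_restrict_of_ae_restrict_of_subset (hsub (le_max_left M N)) hmax

/-- The sum of v₁ and the homogeneous solution solves the equation with right-hand side wg and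
differs from `v` by a null function, so it is the balanced representative required of [v]. -/
theorem adjoint_le_maximalRelation (hab : a < b)
    (hA : IsCoefficient a b (refMeasure q w) J (refCoeff q w)) :
    (minimalRelation J q w).adjoint ≤ maximalRelation J q w := by
  have := sigmaFinite_refMeasure q w hab
  rintro ⟨v, g⟩ hvg
  obtain ⟨v, rfl⟩ := SeparationQuotient.surjective_mk v
  obtain ⟨g, rfl⟩ := SeparationQuotient.surjective_mk g
  rw [Submodule.mem_adjoint_iff] at hvg
  obtain ⟨c, -, hc, -⟩ := exists_exhaustion hab
  obtain ⟨v₁, y₁, h₁, -⟩ := exists_isIntegralSolution hA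
    (refForcing_aestronglyMeasurable q hab g) (fun c hc d hd =>
      refForcing_integrableOn q hab g isCompact_Icc (Icc_subset_openInterval hc hd)) (hc 0) 0
  obtain ⟨u, y, hu, hnull⟩ := exists_homogeneous hab hA h₁ fun u f huf =>
    sub_eq_zero.1 (hvg (SeparationQuotient.mk u) (SeparationQuotient.mk f) ⟨(u, f), huf, rfl⟩)
  have hsol := h₁.add hu
  rw [add_zero] at hsol
  have hbv := hsol.mem_balancedBV hA.isUnit
  have hnull' : ∀ᵐ x ∂traceMeasure w,
      (weightDensity w x).mulVec (PreL2.fn w v x - (v₁ + u) x) = 0 :=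
    hnull.mono fun x hx => by rwa [Pi.add_apply, ← sub_sub]
  -- Square integrability near the endpoints is inherited from `v`: the two weight forms agree
  -- almost everywhere.
  obtain ⟨v', hv'⟩ : ∃ v' : PreL2 w, PreL2.fn w v' = v₁ + u :=
    ⟨⟨v₁ + u, aemeasurable_traceMeasure_of_mem_balancedBV hab hbv,
      (PreL2.integrable v v).congr (hnull'.mono fun x hx => weightForm_self_congr hx)⟩, rfl⟩
  refine ⟨(v', g), ⟨?_, ?_⟩, Prod.ext ?_ rfl⟩
  · change PreL2.fn w v' ∈ _
    rwa [hv']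
  · change IsSolution J q w (PreL2.fn w v') (PreL2.fn w g)
    rw [hv']
    exact (isSolution_iff q hab hA hbv g).2 ⟨_, hsol⟩
  · refine Eq.symm ((PreL2.mk_eq_mk_iff v v').2 ?_)
    rwa [hv']

end DistSystem

theorem theoremT4p1p6 {n : ℕ} {a b : EReal} (hab : a < b)
    (J : Matrix (Fin n) (Fin n) ℂ) (hJ : IsUnit J) (hJskew : J.conjTranspose = -J)
    (q w : DistSystem.MatrixDist a b n)
    (hq : DistSystem.IsHermitianDist q) (hw : DistSystem.IsNonnegDist w)
    (hjump : ∀ x ∈ DistSystem.openInterval a b,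
      IsUnit ((2 : ℂ) • J + DistSystem.jump q x) ∧ IsUnit ((2 : ℂ) • J - DistSystem.jump q x)) :
    (DistSystem.minimalRelation J q w).adjoint = DistSystem.maximalRelation J q w :=
  have hA := DistSystem.isCoefficient_refCoeff w hab hJ hJskew hq hjump
  le_antisymm (DistSystem.adjoint_le_maximalRelation hab hA)
    (DistSystem.maximalRelation_le_adjoint hab hA)
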